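/- All manifolds, maps, bundles, forms and connections are holomorphic. \textbf{Joyce structures.} Let $M$ be a complex manifold, $\pi\colon X=T_M\to M$ its tangent bundle and $v\colon \pi^*(T_M)\to T_X$ the canonical vertical lift. A connection on a submersion $f\colon Y\to B$ is a bundle map $k\colon f^*(T_B)\to T_Y$ with $f_*\circ k=1$; it is flat if $\operatorname{im}(k)$ is closed under Lie bracket, and symplectic for a relative symplectic form $\Omega$ if $\mathcal L_{k(u)}\Omega=0$ for all local vector fields $u$ on $B$. A Joyce structure on $M$ consists of (a) a lattice $T_M^{\mathbb Z}\subset T_M$, with associated flat linear connection $\nabla$, and a vector field $Z$ on $M$ with $\nabla(Z)=\mathrm{id}$; (b) a symplectic form $\omega$ on $M$ and a connection $h$ on $\pi$ such that for all $\epsilon\in\mathbb C^*$ the connection $h_\epsilon=h+\epsilon^{-1}v$ is flat and symplectic (for the relative form $\Omega_\pi(v(a),v(b))=\omega(a,b)$); such that (J1) $(2\pi i)^{-1}\omega^{-1}$ is integral on the dual lattice; (J2) $h$ is invariant under translations by $2\pi i\,T_M^{\mathbb Z}$; (J3) $h([Z,u])=[E,h(u)]$ for all local vector fields $u$ on $M$,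 where $E$ is the $\nabla$-horizontal lift of $Z$ to $X$; (J4) $h$ is invariant under multiplication by $-1$ on the fibres of $\pi$. On $X$ define $I,J,K\in\operatorname{End}(T_X)$ by $Ih=ih$, $Iv=-iv$, $Jh=-v$, $Jv=h$, $Kh=iv$, $Kv=ih$, a metric $g$ by $g(h(a),v(b))=\tfrac12\omega(a,b)$, $g(h,h)=g(v,v)=0$, and 2-forms $\Omega_I=g(I\cdot,\cdot)$, $\Omega_-=g((J-iK)\cdot,\cdot)$. Let $q_\epsilon\colon X\to Z_\epsilon$, $\epsilon\in\mathbb C^*$, and $q_\infty\colon X\to Z_\infty$ be the quotients by the foliations $\operatorname{im}(h_\epsilon)$ and $\operatorname{im}(h)$. The form $\Omega_-$ descends to the symplectic form $\Omega_\infty$ of $Z_\infty$. \textbf{Data.} Suppose given a Joyce structure on $M$; a cotangent bundle structure, i.e. an open embedding $M\subset T_B^*$ such that $\omega$ is the restriction of the canonical form $-d\lambda=\sum_i dt_i\wedge ds_i$, where $\lambda=\sum_i s_i\,dt_i$ is the Liouville form ($t_i$ local coordinates on $B$ and $s_i$ the induced linear fibre coordinates); and a Lagrangian submanifold $R\subset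 Z_\infty$. Let $\rho\colon M\to B$ be the projection and $\beta\in H^0(M,\rho^*(T_B^*))$ the tautological section. Let $i\colon Y=q_\infty^{-1}(R)\hookrightarrow X$ be the inclusion (an embedded submanifold), $p=\pi\circ i\colon Y\to M$ and $f=\rho\circ p\colon Y\to B$. Assume: $(\star)$ for each $b\in B$ the restriction of $q_1\colon X\to Z_1$ to the fibre $f^{-1}(b)\subset Y$ is étale, i.e. for each $y\in Y$ the natural map $\ker(f_*)_y\to T_{X,y}/\operatorname{im}(h_1)_y$ is an isomorphism. \textbf{Hamiltonian systems.} A time-dependent Hamiltonian system on $f\colon Y\to B$ consists of a relative symplectic form $\Omega$ on the submersion $f$, a flat symplectic connection $k$ on $f$, and a section $\varpi\in H^0(Y,f^*(T_B^*))$. For a local vector field $u$ on $B$ put $H_u=(f^*(u),\varpi)$, and $k_\epsilon(u)=k(u)+\epsilon^{-1}\,\Omega^\sharp(dH_u)$ for $\epsilon\in\mathbb C^*$, where $\Omega^\sharp(dH)$ is the vertical vector field with $\Omega(w,\Omega^\sharp(dH))=dH(w)$ for all vertical $w$. The system is strongly-integrable if the connections $k_\epsilon$ are flat for all $\epsilon\in\mathbb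 C^*$. \textbf{Theorem.} Under these hypotheses $f$ is a submersion, and there is a strongly-integrable time-dependent Hamiltonian system on $f\colon Y\to B$ which is uniquely specified, among all time-dependent Hamiltonian systems on $f$, by the following conditions: (i) the relative symplectic form $\Omega$ is induced by the 2-form $i^*(2i\Omega_I)$ on $Y$ (the scalar $i$ in $2i\Omega_I$ being $\sqrt{-1}$); (ii) for each $\epsilon\in\mathbb C^*$ the connection $k_\epsilon$ satisfies $\operatorname{im}(k_\epsilon)=T_Y\cap\operatorname{im}(h_\epsilon)\subset T_X$; (iii) the Hamiltonian form is $\varpi=p^*(\beta)$. -/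

import Mathlib

open scoped Manifold ContDiff Topology

noncomputable section

namespace JoyceHam

/-! ### Holomorphic functions, vector fields and forms

Complex manifolds are manifolds over `ℂ` of class `C^ω`. Local objects (functions, vector fields
on an open set `U`) are total functions of which only the restriction to `U` is used. -/

section General

variable {E H N : Type*} [NormedAddCommGroup E] [NormedSpace ℂ E] [TopologicalSpace H]
  (I : ModelWithCorners ℂ E H) [TopologicalSpace N] [ChartedSpace H N]

/-- `F` is a holomorphic function on `U`. -/
def HolFun (U : Set N) (F : N → ℂ) : Prop := ContMDiffOn I 𝓘(ℂ, ℂ) ω F U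

/-- `u` is a holomorphic vector field on `U`. -/
def HolVF [IsManifold I ω N] (U : Set N) (u : ∀ x : N, TangentSpace I x) : Prop :=
  ContMDiffOn I I.tangent ω (fun x => (⟨x, u x⟩ : TangentBundle I N)) U

/-- The derivative `dF(w)` of a function `F` at `x` along the tangent vector `w`. -/
def dirDeriv (F : N → ℂ) (x : N) (w : TangentSpace I x) : ℂ := mfderiv I 𝓘(ℂ, ℂ) F x w

/-- A field of complex bilinear forms on the tangent spaces. -/
abbrev FormField (N : Type*) [TopologicalSpace N] [ChartedSpace H N] :=
  ∀ x : N, LinearMap.BilinForm ℂ (TangentSpace I x)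

/-- A holomorphic symplectic form: an alternating, nondegenerate, holomorphic and closed 2-form.
Closedness is `dη(a, b, c) = 0` with the invariant formula for the exterior derivative. -/
structure IsSymplecticForm [IsManifold I ω N] (η : FormField I N) : Prop where
  alt : ∀ x a, η x a a = 0
  nondeg : ∀ x a, (∀ b, η x a b = 0) → a = 0
  hol : ∀ (U : Set N) (a b : ∀ x : N, TangentSpace I x), IsOpen U → HolVF I U a → HolVF I U b →
    HolFun I U (fun x => η x (a x) (b x))
  closed : ∀ (U : Set N) (a b c : ∀ x : N, TangentSpace I x), IsOpen U →
    HolVF I U a → HolVF I U b → HolVF I U c → ∀ x ∈ U,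
      dirDeriv I (fun x => η x (b x) (c x)) x (a x)
        - dirDeriv I (fun x => η x (a x) (c x)) x (b x)
        + dirDeriv I (fun x => η x (a x) (b x)) x (c x)
        - η x (VectorField.mlieBracket I a b x) (c x)
        + η x (VectorField.mlieBracket I a c x) (b x)
        - η x (VectorField.mlieBracket I b c x) (a x) = 0

/-- `η = dα` for a 1-form `α`, that is
`η(a, b) = a(α(b)) - b(α(a)) - α([a, b])` for all local holomorphic vector fields. -/
def IsExteriorDerivative [IsManifold I ω N] (α : ∀ x : N, TangentSpace I x →ₗ[ℂ] ℂ)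
    (η : FormField I N) : Prop :=
  ∀ (U : Set N) (a b : ∀ x : N, TangentSpace I x), IsOpen U → HolVF I U a → HolVF I U b →
    ∀ x ∈ U, η x (a x) (b x) = dirDeriv I (fun x => α x (b x)) x (a x)
      - dirDeriv I (fun x => α x (a x)) x (b x) - α x (VectorField.mlieBracket I a b x)

/-- The sub-bundle `D` of the tangent bundle is closed under Lie bracket. -/
def IsInvolutive [IsManifold I ω N] (D : ∀ x : N, Submodule ℂ (TangentSpace I x)) : Prop :=
  ∀ (U : Set N) (a b : ∀ x : N, TangentSpace I x), IsOpen U → HolVF I U a → HolVF I U b →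
    (∀ x ∈ U, a x ∈ D x) → (∀ x ∈ U, b x ∈ D x) →
    ∀ x ∈ U, VectorField.mlieBracket I a b x ∈ D x

/-- The curve `γ` (in real time) has velocity `v` at time `t`; the velocity is computed in the
preferred chart at `γ t`, which is the chart identifying `TangentSpace I (γ t)` with `E`. -/
def HasVelocityAt (γ : ℝ → N) (t : ℝ) (v : TangentSpace I (γ t)) : Prop :=
  ContinuousAt γ t ∧ HasDerivAt (fun s : ℝ => extChartAt I (γ t) (γ s)) (v : E) t

/-- `x` and `y` are joined by a curve everywhere tangent to `D`. -/
def TangentCurveJoins (D : ∀ x : N, Submodule ℂ (TangentSpace I x)) (x y : N) : Prop :=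
  ∃ (γ : ℝ → N) (a b : ℝ), a ≤ b ∧ γ a = x ∧ γ b = y ∧
    ∀ t ∈ Set.Icc a b, ∃ v ∈ D (γ t), HasVelocityAt I γ t v

/-- Two points are in the same leaf of the foliation defined by `D` when they are joined by a
finite chain of curves tangent to `D`. -/
def leafSetoid (D : ∀ x : N, Submodule ℂ (TangentSpace I x)) : Setoid N :=
  Relation.EqvGen.setoid (TangentCurveJoins I D)

/-- The space of leaves of the foliation defined by `D`. -/
def LeafSpace (D : ∀ x : N, Submodule ℂ (TangentSpace I x)) : Type _ := Quotient (leafSetoid I D)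

/-- The quotient map onto the space of leaves. -/
def leafMap (D : ∀ x : N, Submodule ℂ (TangentSpace I x)) (x : N) : LeafSpace I D :=
  Quotient.mk (leafSetoid I D) x

end General

/-! ### Non-linear connections on a map `f : X → B` -/

section Connections

variable {E H X : Type*} [NormedAddCommGroup E] [NormedSpace ℂ E] [TopologicalSpace H]
  (I : ModelWithCorners ℂ E H) [TopologicalSpace X] [ChartedSpace H X]
  {E' H' B : Type*} [NormedAddCommGroup E'] [NormedSpace ℂ E'] [TopologicalSpace H']
  (I' : ModelWithCorners ℂ E' H') [TopologicalSpace B] [ChartedSpace H' B]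

/-- A fibrewise linear map `f^*(T_B) → T_X`. -/
abbrev BundleMap (f : X → B) := ∀ x : X, TangentSpace I' (f x) →ₗ[ℂ] TangentSpace I x

/-- `f` is a holomorphic submersion. -/
structure IsHolSubmersion (f : X → B) : Prop where
  hol : ContMDiff I I' ω f
  surj : ∀ x, Function.Surjective (mfderiv I I' f x)

/-- A non-linear connection on `f`: a holomorphic bundle map `h : f^*(T_B) → T_X` with
`f_* ∘ h = 1`. Holomorphy means that the lifts of local holomorphic vector fields on `B`
are holomorphic. -/
structure IsConnection [IsManifold I ω X] [IsManifold I' ω B] (f : X → B)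
    (h : BundleMap I I' f) : Prop where
  section_eq : ∀ x u, mfderiv I I' f x (h x u) = u
  hol : ∀ (U : Set B) (u : ∀ b : B, TangentSpace I' b), IsOpen U → HolVF I' U u →
    HolVF I (f ⁻¹' U) (fun x => h x (u (f x)))

/-- The horizontal sub-bundle `im(h)`. -/
def horizontal (f : X → B) (h : BundleMap I I' f) (x : X) : Submodule ℂ (TangentSpace I x) :=
  LinearMap.range (h x)

/-- The connection `h` is flat: `im(h)` is closed under Lie bracket. -/
def IsFlat [IsManifold I ω X] (f : X → B) (h : BundleMap I I' f) : Prop :=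
  IsInvolutive I (horizontal I I' f h)

/-- The vertical tangent space `T_{X/B}` at `x`, the kernel of `f_*`. -/
def vertical (f : X → B) (x : X) : Submodule ℂ (TangentSpace I x) :=
  LinearMap.ker (mfderiv I I' f x).toLinearMap

/-- A field of bilinear forms on the vertical tangent spaces of `f`. -/
abbrev RelForm (f : X → B) := ∀ x : X, LinearMap.BilinForm ℂ (vertical I I' f x)

open Classical in
/-- The value `Ω_x(a, b)` for vertical tangent vectors `a`, `b` (and `0` for other vectors). -/
def relEval {f : X → B} (Ω : RelForm I I' f) (x : X) (a b : TangentSpace I x) : ℂ :=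
  if h : a ∈ vertical I I' f x ∧ b ∈ vertical I I' f x then Ω x ⟨a, h.1⟩ ⟨b, h.2⟩ else 0

/-- `a` is a holomorphic vertical vector field on `U`. -/
def VertVF [IsManifold I ω X] (f : X → B) (U : Set X) (a : ∀ x : X, TangentSpace I x) : Prop :=
  HolVF I U a ∧ ∀ x ∈ U, a x ∈ vertical I I' f x

/-- A relative symplectic form on `f`: a holomorphic relative 2-form which restricts to a
symplectic form (alternating, nondegenerate, closed) on each fibre. -/
structure IsRelSymplectic [IsManifold I ω X] (f : X → B) (Ω : RelForm I I' f) : Prop where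
  alt : ∀ x a, Ω x a a = 0
  nondeg : ∀ x a, (∀ b, Ω x a b = 0) → a = 0
  hol : ∀ (U : Set X) (a b : ∀ x : X, TangentSpace I x), IsOpen U → VertVF I I' f U a →
    VertVF I I' f U b → HolFun I U (fun x => relEval I I' Ω x (a x) (b x))
  closed : ∀ (U : Set X) (a b c : ∀ x : X, TangentSpace I x), IsOpen U →
    VertVF I I' f U a → VertVF I I' f U b → VertVF I I' f U c → ∀ x ∈ U,
      dirDeriv I (fun x => relEval I I' Ω x (b x) (c x)) x (a x)
        - dirDeriv I (fun x => relEval I I' Ω x (a x) (c x)) x (b x)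
        + dirDeriv I (fun x => relEval I I' Ω x (a x) (b x)) x (c x)
        - relEval I I' Ω x (VectorField.mlieBracket I a b x) (c x)
        + relEval I I' Ω x (VectorField.mlieBracket I a c x) (b x)
        - relEval I I' Ω x (VectorField.mlieBracket I b c x) (a x) = 0

/-- The connection `h` preserves the relative form `Ω`: the Lie derivative of `Ω` along the
horizontal lift `h(u)` of any local holomorphic vector field `u` on `B` vanishes. -/
def PreservesRelForm [IsManifold I ω X] [IsManifold I' ω B] (f : X → B) (h : BundleMap I I' f)
    (Ω : RelForm I I' f) : Prop :=
  ∀ (U : Set B) (u : ∀ b : B, TangentSpace I' b) (V : Set X) (a b : ∀ x : X, TangentSpace I x),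
    IsOpen U → HolVF I' U u → IsOpen V → V ⊆ f ⁻¹' U → VertVF I I' f V a → VertVF I I' f V b →
    ∀ x ∈ V,
      dirDeriv I (fun x => relEval I I' Ω x (a x) (b x)) x (h x (u (f x))) =
        relEval I I' Ω x (VectorField.mlieBracket I (fun x => h x (u (f x))) a x) (b x)
        + relEval I I' Ω x (a x) (VectorField.mlieBracket I (fun x => h x (u (f x))) b x)

/-- The map `Ω^♯` from covectors on the fibre to vertical tangent vectors determined by a
nondegenerate relative 2-form, with the sign convention `Ω(b, Ω^♯ α) = α(b)`. -/
def relSharp {f : X → B} (Ω : RelForm I I' f) (x : X) :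
    (vertical I I' f x →ₗ[ℂ] ℂ) →ₗ[ℂ] vertical I I' f x :=
  LinearMap.leftInverse (LinearMap.flip (Ω x))

/-- A time-dependent Hamiltonian system on `f : Y → B`. -/
@[ext]
structure HamiltonianSystem [IsManifold I ω X] [IsManifold I' ω B] (f : X → B) where
  /-- the relative symplectic form -/
  Ω : RelForm I I' f
  /-- the reference connection -/
  k : BundleMap I I' f
  /-- the Hamiltonian form, a section of `f^*(T_B^*)` -/
  ham : ∀ x : X, TangentSpace I' (f x) →ₗ[ℂ] ℂ
  submersion : IsHolSubmersion I I' f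
  relSymplectic : IsRelSymplectic I I' f Ω
  connection : IsConnection I I' f k
  flat : IsFlat I I' f k
  symplectic : PreservesRelForm I I' f k Ω
  ham_hol : ∀ (U : Set B) (u : ∀ b : B, TangentSpace I' b), IsOpen U → HolVF I' U u →
    HolFun I (f ⁻¹' U) (fun x => ham x (u (f x)))

namespace HamiltonianSystem

variable {I I'} [IsManifold I ω X] [IsManifold I' ω B] {f : X → B}

/-- The Hamiltonian function `H_u = (f^*(u), ϖ)` of a vector field `u` on `B`. -/
def hamFun (S : HamiltonianSystem I I' f) (u : ∀ b : B, TangentSpace I' b) (x : X) : ℂ :=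
  S.ham x (u (f x))

/-- The Hamiltonian flow `Ω^♯(dH_u)`, a vertical vector field on `f`. -/
def hamFlow (S : HamiltonianSystem I I' f) (u : ∀ b : B, TangentSpace I' b) (x : X) :
    TangentSpace I x :=
  (relSharp I I' S.Ω x
    ((mfderiv I 𝓘(ℂ, ℂ) (S.hamFun u) x).toLinearMap ∘ₗ (vertical I I' f x).subtype) :
      vertical I I' f x)

/-- `kε` is the connection `k_ε` of the pencil, i.e. `k_ε(u) = k(u) + ε⁻¹ Ω^♯(dH_u)` for all local
holomorphic vector fields `u` on `B`. -/
structure IsPencil (S : HamiltonianSystem I I' f) (ε : ℂ) (kε : BundleMap I I' f) : Prop where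
  connection : IsConnection I I' f kε
  eq : ∀ (U : Set B) (u : ∀ b : B, TangentSpace I' b), IsOpen U → HolVF I' U u →
    ∀ x ∈ f ⁻¹' U, kε x (u (f x)) = S.k x (u (f x)) + ε⁻¹ • S.hamFlow u x

/-- The system is strongly-integrable if the connections `k_ε`, `ε ∈ ℂ^*`, are all flat. -/
def StronglyIntegrable (S : HamiltonianSystem I I' f) : Prop :=
  ∀ ε : ℂ, ε ≠ 0 → ∃ kε : BundleMap I I' f, S.IsPencil ε kε ∧ IsFlat I I' f kε

end HamiltonianSystem

end Connections

/-! ### The tangent bundle `π : X = T_M → M` -/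

section TangentBundle

variable {E M : Type*} [NormedAddCommGroup E] [NormedSpace ℂ E]
  [TopologicalSpace M] [ChartedSpace E M] [IsManifold 𝓘(ℂ, E) ω M]

/-- The total space `X` of the tangent bundle. -/
abbrev TX (E M : Type*) [NormedAddCommGroup E] [NormedSpace ℂ E]
    [TopologicalSpace M] [ChartedSpace E M] [IsManifold 𝓘(ℂ, E) ω M] := TangentBundle 𝓘(ℂ, E) M

/-- The projection `π : X → M`. -/
abbrev proj : TX E M → M := Bundle.TotalSpace.proj

/-- The tangent space to `X` at `x`. -/
abbrev TTX (x : TX E M) := TangentSpace (𝓘(ℂ, E).tangent) x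

/-- The tangent space to `M` at `m`. -/
abbrev TM (E : Type*) {M : Type*} [NormedAddCommGroup E] [NormedSpace ℂ E]
    [TopologicalSpace M] [ChartedSpace E M] (m : M) := TangentSpace 𝓘(ℂ, E) m

/-- The derivative `π_*` at `x`. -/
def projDeriv (x : TX E M) : TTX x →ₗ[ℂ] TM E (proj x) :=
  (mfderiv 𝓘(ℂ, E).tangent 𝓘(ℂ, E) (proj : TX E M → M) x).toLinearMap

/-- The derivative at `u` of the inclusion into `X` of the vector space `T_{M,m}`, which has `E` as
its underlying vector space. -/
def fibreDeriv (m : M) (u : E) : E →ₗ[ℂ] TTX (⟨m, u⟩ : TX E M) :=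
  (mfderiv 𝓘(ℂ, E) 𝓘(ℂ, E).tangent (fun w : E => (⟨m, w⟩ : TX E M)) u).toLinearMap

/-- The canonical vertical lift `v : π^*(T_M) → T_X`: the derivative at the point `x` of the
inclusion into `X` of the vector space `T_{M,π(x)}`. -/
def vlift : BundleMap 𝓘(ℂ, E).tangent 𝓘(ℂ, E) (proj : TX E M → M) :=
  fun x => fibreDeriv (E := E) (proj x) x.2

/-- The identification of vertical tangent vectors at `x` with elements of `T_{M,π(x)}`,
inverse to `v`. -/
def vliftInv (x : TX E M) : TTX x →ₗ[ℂ] TM E (proj x) := LinearMap.leftInverse (vlift x)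

/-- The bundle maps `h_ε = h + ε⁻¹ v`, for `ε ∈ ℂ^*`. -/
def hEps (h : BundleMap 𝓘(ℂ, E).tangent 𝓘(ℂ, E) (proj : TX E M → M)) (ε : ℂ) :
    BundleMap 𝓘(ℂ, E).tangent 𝓘(ℂ, E) (proj : TX E M → M) := fun x => h x + ε⁻¹ • vlift x

/-- The relative form on `π` with `Ω_π(v(a), v(b)) = η(a, b)`. -/
def fibreForm (η : FormField 𝓘(ℂ, E) M) :
    RelForm 𝓘(ℂ, E).tangent 𝓘(ℂ, E) (proj : TX E M → M) := fun x =>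
  (η (proj x)).comp (vliftInv x ∘ₗ Submodule.subtype _) (vliftInv x ∘ₗ Submodule.subtype _)

/-- A pre-Joyce structure on `M`. -/
structure PreJoyceStructure (E M : Type*) [NormedAddCommGroup E] [NormedSpace ℂ E]
    [TopologicalSpace M] [ChartedSpace E M] [IsManifold 𝓘(ℂ, E) ω M] where
  /-- the symplectic form `ω` -/
  symp : FormField 𝓘(ℂ, E) M
  isSymplectic : IsSymplecticForm 𝓘(ℂ, E) symp
  /-- the connection `h` on `π : T_M → M` -/
  h : BundleMap 𝓘(ℂ, E).tangent 𝓘(ℂ, E) (proj : TX E M → M)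
  connection : IsConnection 𝓘(ℂ, E).tangent 𝓘(ℂ, E) proj h
  flat : ∀ ε : ℂ, ε ≠ 0 → IsFlat 𝓘(ℂ, E).tangent 𝓘(ℂ, E) proj (hEps h ε)
  symplectic : ∀ ε : ℂ, ε ≠ 0 →
    PreservesRelForm 𝓘(ℂ, E).tangent 𝓘(ℂ, E) proj (hEps h ε) (fibreForm symp)

/-- `φ` is a frame of holomorphic vector fields over the open set `U`, forming at each point a
basis of the tangent space and a `ℤ`-basis of the subgroup `Λ`. -/
structure IsLatticeFrame (Λ : ∀ m : M, AddSubgroup (TM E m)) (U : Set M)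
    (φ : Fin (Module.finrank ℂ E) → ∀ m : M, TM E m) : Prop where
  isOpen : IsOpen U
  hol : ∀ i, HolVF 𝓘(ℂ, E) U (φ i)
  indep : ∀ m ∈ U, LinearIndependent ℂ (fun i => φ i m)
  span : ∀ m ∈ U, Λ m = AddSubgroup.closure (Set.range (fun i => φ i m))

/-- A period structure on `M`: a lattice `T_M^ℤ ⊂ T_M` and a vector field `Z` with `∇(Z) = id`.
Here `∇` is the flat linear connection whose flat sections are the complex combinations of
local frames `φ_i` of the lattice: `∇_u (∑ z_i φ_i) = ∑ dz_i(u) φ_i`. -/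
structure PeriodStructure (E M : Type*) [NormedAddCommGroup E] [NormedSpace ℂ E]
    [TopologicalSpace M] [ChartedSpace E M] [IsManifold 𝓘(ℂ, E) ω M] where
  /-- the lattice in the tangent space at `m` -/
  lattice : ∀ m : M, AddSubgroup (TM E m)
  exists_frame : ∀ m : M, ∃ U φ, m ∈ U ∧ IsLatticeFrame lattice U φ
  /-- the Euler vector field -/
  Z : ∀ m : M, TM E m
  Z_hol : HolVF 𝓘(ℂ, E) Set.univ Z
  nabla_Z : ∀ U φ, IsLatticeFrame lattice U φ →
    ∀ z : Fin (Module.finrank ℂ E) → M → ℂ, (∀ m ∈ U, Z m = ∑ i, z i m • φ i m) →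
    ∀ m ∈ U, ∀ u : TM E m, ∑ i, dirDeriv 𝓘(ℂ, E) (z i) m u • φ i m = u

/-- `e` is the `∇`-horizontal lift of the vector field `Z` to `X = T_M`: at a point `x` it is the
image of `Z` under the derivative of the `∇`-flat local section of `T_M` through `x`. -/
def PeriodStructure.IsHorizontalLift (P : PeriodStructure E M) (e : ∀ x : TX E M, TTX x) : Prop :=
  ∀ U φ, IsLatticeFrame P.lattice U φ → ∀ (θ : Fin (Module.finrank ℂ E) → ℂ), ∀ m ∈ U,
    e ⟨m, ∑ i, θ i • φ i m⟩ =
      mfderiv 𝓘(ℂ, E) 𝓘(ℂ, E).tangent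
        (fun m' : M => (⟨m', ∑ i, θ i • φ i m'⟩ : TX E M)) m (P.Z m)

/-- A Joyce structure on `M`. -/
structure JoyceStructure (E M : Type*) [NormedAddCommGroup E] [NormedSpace ℂ E]
    [TopologicalSpace M] [ChartedSpace E M] [IsManifold 𝓘(ℂ, E) ω M] extends
    PeriodStructure E M, PreJoyceStructure E M where
  /-- (J1): `(2πi)⁻¹ η` is integral on the dual lattice, where `η(α, β) = β(η^♭ α)` and
  `a = η^♭ α` is the vector with `ω(a, ·) = α`. -/
  integral : ∀ (m : M) (α β : TM E m →ₗ[ℂ] ℂ), (∀ l ∈ lattice m, ∃ n : ℤ, α l = n) →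
    (∀ l ∈ lattice m, ∃ n : ℤ, β l = n) → ∀ a : TM E m, symp m a = α →
    ∃ n : ℤ, (2 * Real.pi * Complex.I)⁻¹ * β a = n
  /-- (J2): `h` is invariant under translation by `2πi` times local sections of the lattice. -/
  translation : ∀ (U : Set M) (l : ∀ m : M, TM E m), IsOpen U → HolVF 𝓘(ℂ, E) U l →
    (∀ m ∈ U, l m ∈ lattice m) → ∀ x : TX E M, proj x ∈ U → ∀ u : TM E (proj x),
      mfderiv 𝓘(ℂ, E).tangent 𝓘(ℂ, E).tangent
        (fun x : TX E M => (⟨x.1, x.2 + (2 * Real.pi * Complex.I : ℂ) • l x.1⟩ : TX E M)) x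
          (h x u) =
        h (⟨x.1, x.2 + (2 * Real.pi * Complex.I : ℂ) • l x.1⟩ : TX E M) u
  /-- (J3): `h([Z, u]) = [e, h(u)]` for the horizontal lift `e` of `Z`. -/
  euler : ∃ e : ∀ x : TX E M, TTX x, toPeriodStructure.IsHorizontalLift e ∧
    ∀ (U : Set M) (u : ∀ m : M, TM E m), IsOpen U → HolVF 𝓘(ℂ, E) U u →
      ∀ x : TX E M, proj x ∈ U →
        h x (VectorField.mlieBracket 𝓘(ℂ, E) Z u (proj x)) =
          VectorField.mlieBracket 𝓘(ℂ, E).tangent e (fun x => h x (u (proj x))) x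
  /-- (J4): `h` is invariant under multiplication by `-1` on the fibres of `π`. -/
  involution : ∀ (x : TX E M) (u : TM E (proj x)),
    mfderiv 𝓘(ℂ, E).tangent 𝓘(ℂ, E).tangent (fun x : TX E M => (⟨x.1, -x.2⟩ : TX E M)) x (h x u) =
      h (⟨x.1, -x.2⟩ : TX E M) u

namespace PreJoyceStructure

variable (J : PreJoyceStructure E M)

/-- The component `a` of a tangent vector `ξ = h(a) + v(b)` to `X`. -/
def hor (x : TX E M) : TTX x →ₗ[ℂ] TM E (proj x) := projDeriv x

/-- The component `b` of a tangent vector `ξ = h(a) + v(b)` to `X`. -/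
def ver (x : TX E M) : TTX x →ₗ[ℂ] TM E (proj x) :=
  vliftInv x ∘ₗ (LinearMap.id - J.h x ∘ₗ projDeriv x)

/-- The metric: `g(h(a), v(b)) = ω(a, b) / 2`, `g(h, h) = 0 = g(v, v)`. -/
def metric (x : TX E M) (ξ ζ : TTX x) : ℂ :=
  (1 / 2) * J.symp (proj x) (hor x ξ) (J.ver x ζ) + (1 / 2) * J.symp (proj x) (hor x ζ) (J.ver x ξ)

/-- The operator `I`: `I ∘ h = i h`, `I ∘ v = -i v`. -/
def opI (x : TX E M) (ξ : TTX x) : TTX x :=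
  Complex.I • J.h x (hor x ξ) - Complex.I • vlift x (J.ver x ξ)

/-- The operator `J`: `J ∘ h = -v`, `J ∘ v = h`. -/
def opJ (x : TX E M) (ξ : TTX x) : TTX x := -vlift x (hor x ξ) + J.h x (J.ver x ξ)

/-- The operator `K`: `K ∘ h = i v`, `K ∘ v = i h`. -/
def opK (x : TX E M) (ξ : TTX x) : TTX x :=
  Complex.I • vlift x (hor x ξ) + Complex.I • J.h x (J.ver x ξ)

/-- The 2-form `Ω_I(ξ, ζ) = g(I ξ, ζ)`. -/
def omegaI (x : TX E M) (ξ ζ : TTX x) : ℂ := J.metric x (J.opI x ξ) ζ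

/-- The 2-form `Ω_-(ξ, ζ) = g((J - iK) ξ, ζ)`, which is the pullback `q_∞^*(Ω_∞)`. -/
def omegaMinus (x : TX E M) (ξ ζ : TTX x) : ℂ :=
  J.metric x (J.opJ x ξ - Complex.I • J.opK x ξ) ζ

/-- The distribution `im(h_ε) ⊂ T_X` for `ε ∈ ℂ^*`. -/
def distr (ε : ℂ) (x : TX E M) : Submodule ℂ (TTX x) :=
  horizontal 𝓘(ℂ, E).tangent 𝓘(ℂ, E) proj (hEps J.h ε) x

/-- The distribution `im(h_∞) = im(h) ⊂ T_X`. -/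
def distrInf (x : TX E M) : Submodule ℂ (TTX x) :=
  horizontal 𝓘(ℂ, E).tangent 𝓘(ℂ, E) proj J.h x

/-- The fibre `Z_∞` of twistor space: the space of leaves of the foliation `im(h_∞)`. -/
def ZInf : Type _ := LeafSpace 𝓘(ℂ, E).tangent J.distrInf

/-- The quotient map `q_∞ : X → Z_∞`. -/
def qInf (x : TX E M) : J.ZInf := leafMap 𝓘(ℂ, E).tangent J.distrInf x

end PreJoyceStructure

end TangentBundle

/-! ### Cotangent bundle structures and the data of the construction -/

/-- The total space `T^*_B` of the cotangent bundle of `B`. -/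
abbrev CotangentBundle (EB B : Type*) [NormedAddCommGroup EB] [NormedSpace ℂ EB]
    [TopologicalSpace B] [ChartedSpace EB B] [IsManifold 𝓘(ℂ, EB) ω B] :=
  Bundle.TotalSpace (EB →L[ℂ] ℂ)
    (fun b : B => TangentSpace 𝓘(ℂ, EB) b →L[ℂ] Bundle.Trivial B ℂ b)

/-- The model with corners of `T^*_B`. -/
abbrev cotModel (EB : Type*) [NormedAddCommGroup EB] [NormedSpace ℂ EB] :=
  𝓘(ℂ, EB).prod 𝓘(ℂ, EB →L[ℂ] ℂ)

section Cotangent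

variable {EB B : Type*} [NormedAddCommGroup EB] [NormedSpace ℂ EB]
    [TopologicalSpace B] [ChartedSpace EB B] [IsManifold 𝓘(ℂ, EB) ω B]

/-- The Liouville 1-form on `T^*_B`: its value at the covector `p` is `ξ ↦ p(ρ_* ξ)`, where `ρ` is
the projection to `B`. -/
def liouville (p : CotangentBundle EB B) : TangentSpace (cotModel EB) p →ₗ[ℂ] ℂ :=
  (p.2 : TangentSpace 𝓘(ℂ, EB) p.1 →L[ℂ] ℂ).toLinearMap ∘ₗ
    (mfderiv (cotModel EB) 𝓘(ℂ, EB)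
      (Bundle.TotalSpace.proj : CotangentBundle EB B → B) p).toLinearMap

variable {E M : Type*} [NormedAddCommGroup E] [NormedSpace ℂ E]
  [TopologicalSpace M] [ChartedSpace E M] [IsManifold 𝓘(ℂ, E) ω M]

/-- The restriction to `M` of the Liouville 1-form along a map `M → T^*_B`. -/
def liouvilleOn (emb : M → CotangentBundle EB B) (m : M) : TM E m →ₗ[ℂ] ℂ :=
  liouville (emb m) ∘ₗ (mfderiv 𝓘(ℂ, E) (cotModel EB) emb m).toLinearMap

/-- A cotangent bundle structure on `(M, η)`: a holomorphic open embedding `M ⊂ T^*_B` such that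
`η` is the restriction of the canonical symplectic form `∑ dt_i ∧ ds_i = -dλ`, where
`λ = ∑ s_i dt_i` is the Liouville form. -/
structure CotangentStructure (EB B : Type*) [NormedAddCommGroup EB] [NormedSpace ℂ EB]
    [TopologicalSpace B] [ChartedSpace EB B] [IsManifold 𝓘(ℂ, EB) ω B]
    (η : FormField 𝓘(ℂ, E) M) where
  /-- the embedding -/
  emb : M → CotangentBundle EB B
  hol : ContMDiff 𝓘(ℂ, E) (cotModel EB) ω emb
  isOpenEmbedding : Topology.IsOpenEmbedding emb
  deriv_bijective : ∀ m, Function.Bijective (mfderiv 𝓘(ℂ, E) (cotModel EB) emb m)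
  canonical : IsExteriorDerivative 𝓘(ℂ, E) (liouvilleOn emb) (fun m => -η m)

/-- The projection `ρ : M → B`. -/
def CotangentStructure.rho {η : FormField 𝓘(ℂ, E) M} (C : CotangentStructure EB B η) (m : M) : B :=
  (C.emb m).1

/-- The tautological section `β` of `ρ^*(T_B^*)`. -/
def CotangentStructure.beta {η : FormField 𝓘(ℂ, E) M} (C : CotangentStructure EB B η) (m : M) :
    TangentSpace 𝓘(ℂ, EB) (C.rho m) →ₗ[ℂ] ℂ :=
  ((C.emb m).2 : TangentSpace 𝓘(ℂ, EB) (C.emb m).1 →L[ℂ] ℂ).toLinearMap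

variable {EY Y : Type*} [NormedAddCommGroup EY] [NormedSpace ℂ EY]
  [TopologicalSpace Y] [ChartedSpace EY Y] [IsManifold 𝓘(ℂ, EY) ω Y]

variable (EY) in
/-- The derivative of `i : Y → X` at `y`. -/
def inclDeriv (i : Y → TX E M) (y : Y) : TangentSpace 𝓘(ℂ, EY) y →ₗ[ℂ] TTX (i y) :=
  (mfderiv 𝓘(ℂ, EY) 𝓘(ℂ, E).tangent i y).toLinearMap

variable (EY) in
/-- `R ⊂ Z_∞` is a Lagrangian submanifold with inverse image `i : Y ↪ X`. In terms of `X`, as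
`q_∞` is the quotient by the foliation `im(h)` and `q_∞^*(Ω_∞) = Ω_-`, this says that
`Y = q_∞⁻¹(R)` is an embedded complex submanifold, that `Ω_-` vanishes on it, and that
`dim R = dim Y - dim M` is half of `dim Z_∞ = dim M`. -/
structure IsLagrangianPreimage (J : PreJoyceStructure E M) (R : Set J.ZInf) (i : Y → TX E M) :
    Prop where
  hol : ContMDiff 𝓘(ℂ, EY) 𝓘(ℂ, E).tangent ω i
  isEmbedding : Topology.IsEmbedding i
  immersive : ∀ y, Function.Injective (inclDeriv EY i y)
  range_eq : Set.range i = J.qInf ⁻¹' R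
  dim : 2 * Module.finrank ℂ EY = 3 * Module.finrank ℂ E
  isotropic : ∀ (y : Y) (a b : TangentSpace 𝓘(ℂ, EY) y), J.omegaMinus (i y)
    (inclDeriv EY i y a) (inclDeriv EY i y b) = 0

/-- The composite `f = ρ ∘ π ∘ i : Y → B`. -/
def baseMap {η : FormField 𝓘(ℂ, E) M} (C : CotangentStructure EB B η) (i : Y → TX E M) (y : Y) :
    B := C.rho (proj (i y))

variable (EY) in
/-- The transversality assumption: the restriction of `q_1 : X → Z_1` to each fibre of `f` is
étale. The derivative of `q_1` at `x` is the projection `T_{X,x} → T_{X,x} / im(h_1)_x`,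
so at each `y ∈ Y` the composite
`ker(f_*) → T_{Y,y} → T_{X,i(y)} → T_{X,i(y)} / im(h_1)_{i(y)}` is an isomorphism. -/
def Transversality (J : PreJoyceStructure E M) (C : CotangentStructure EB B J.symp)
    (i : Y → TX E M) : Prop :=
  ∀ y : Y, Function.Bijective
    ((J.distr 1 (i y)).mkQ ∘ₗ inclDeriv EY i y ∘ₗ
      (vertical 𝓘(ℂ, EY) 𝓘(ℂ, EB) (baseMap C i) y).subtype)

/-- The three conditions which specify the Hamiltonian system on `f : Y → B`. -/
structure IsAssociated (J : PreJoyceStructure E M) (C : CotangentStructure EB B J.symp)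
    (i : Y → TX E M) (S : HamiltonianSystem 𝓘(ℂ, EY) 𝓘(ℂ, EB) (baseMap C i)) : Prop where
  /-- the relative symplectic form is induced by `i^*(2iΩ_I)` -/
  form_eq : ∀ y (a b : vertical 𝓘(ℂ, EY) 𝓘(ℂ, EB) (baseMap C i) y),
    S.Ω y a b = 2 * Complex.I * J.omegaI (i y)
      (inclDeriv EY i y (a : TangentSpace 𝓘(ℂ, EY) y))
      (inclDeriv EY i y (b : TangentSpace 𝓘(ℂ, EY) y))
  /-- `im(k_ε) = T_Y ∩ im(h_ε)` as subspaces of `T_X`, for all `ε ∈ ℂ^*` -/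
  image_eq : ∀ ε : ℂ, ε ≠ 0 → ∃ kε : BundleMap 𝓘(ℂ, EY) 𝓘(ℂ, EB) (baseMap C i),
    S.IsPencil ε kε ∧ ∀ y, (LinearMap.range (kε y)).map (inclDeriv EY i y) =
      LinearMap.range (inclDeriv EY i y) ⊓ J.distr ε (i y)
  /-- the Hamiltonian form is `p^*(β)`, where `p = π ∘ i` -/
  ham_eq : ∀ y, S.ham y = C.beta (proj (i y))

end Cotangent

end JoyceHam

end

/-!
Write `T_X = h(T_M) ⊕ v(T_M)`. The proof rests on a pencil of closed 2-forms on `Y` whose kernels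
are the images of the connections `k_ε`.

On `X` the form `2iΩ_I` is `Φ(ξ, ζ) = -ω(hor ξ, ver ζ) - ω(ver ξ, hor ζ)`. It is closed
(`isClosedForm_twoIOmegaI`): by tensoriality of `d` it suffices to evaluate `dΦ` on lifts `h(u) +
v(w)` of fields which are constant in a chart of `M`. The flatness of `h + t v` for three values
of `t` gives the brackets `[h(u), h(w)] = 0 = [v(u), v(w)]` and `[h(u), v(w)] = v(N(u, w))` with
`N` symmetric, and invariance of the relative form says that `u(ω(w, z)) = ω(N(u, w), z) + ω(w,
N(u, z))`; these identities make all terms of `dΦ` cancel.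

At a point of `Y` let `L` be the set of `l` with `v(l)` tangent to `Y`. As `Y` is a union of
leaves of `im(h)` and is embedded, `h(T_M)` is tangent to `Y` (`mem_range_mfderiv_of_saturated`),
so `T_Y = h(T_M) ⊕ v(L)`. The subspace `L` is isotropic because `Ω_-` vanishes on `Y`, the
subspace `V = ker ρ_*` is isotropic because `ω = -dλ`, and the transversality assumption says
exactly that `T_M = V ⊕ L`; in particular `L` is its own orthogonal complement. It follows that
the closed form `Θ_t = i^*Φ + t p^*ω` is nondegenerate on the fibres of `f` (`pencilForm_nondeg`),
and that its kernel is the space of `h(a) + t v(a)` with `a ∈ L`, which `f_*` maps isomorphically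
to `T_B`, as `ρ_*` does with `L` (`exists_pencil`). With `t = ε⁻¹` this kernel is also `T_Y ∩
im(h_ε)`.

The kernel of a closed form is involutive, and a lift which is the solution of a holomorphic
linear system is holomorphic, so the kernels of `Θ_t` are the images of flat connections `k_t`.
For `t = 0` the equation `dΘ_0 = 0` also says that `k_0` preserves the relative form `Ω` induced
by `Θ_0`. Finally `Ω(b, k_t(u) - k_0(u)) = -t ω(p_* b, p_* k_t(u)) = t dH_u(b)` for vertical `b`
by `ω = -dλ`, that is, `k_t = k_0 + t Ω^♯(dH)` (`smul_hamFlow_eq`).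

For uniqueness, the relative form and the Hamiltonian form are prescribed, and the image of `k_1`
determines `k_1` and hence `k = k_1 - Ω^♯(dH)` (`IsAssociated.unique`).
-/

namespace JoyceHam

open VectorField Bundle Filter

/-! ### Holomorphic vector fields and derivatives in charts -/

section Local

variable {E H N : Type*} [NormedAddCommGroup E] [NormedSpace ℂ E] [TopologicalSpace H]
  {I : ModelWithCorners ℂ E H} [TopologicalSpace N] [ChartedSpace H N]
  {V : Type*} [NormedAddCommGroup V] [NormedSpace ℂ V]

variable (I) in
/-- The vector field `a` is holomorphic at the point `x`. -/
def HolVFAt [IsManifold I ω N] (a : ∀ x : N, TangentSpace I x) (x : N) : Prop :=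
  ContMDiffAt I I.tangent ω (fun y => (⟨y, a y⟩ : TangentBundle I N)) x

variable (I) in
/-- The derivative of a function with values in a vector space `V`. This is `mfderiv`, with values
in `V` itself rather than in its tangent space at `F x`. -/
noncomputable def vDeriv (F : N → V) (x : N) : TangentSpace I x →L[ℂ] V :=
  mfderiv I 𝓘(ℂ, V) F x

variable (I) in
/-- The vector field `a` read in the chart at `x₀`, as a function with values in the model
space. -/
noncomputable def chartField (x₀ : N) (a : ∀ x : N, TangentSpace I x) (y : N) : E :=
  vDeriv I (extChartAt I x₀) y (a y)

theorem isManifold_one [IsManifold I ω N] : IsManifold I 1 N := .of_le (n := ω) (by simp)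

theorem vDeriv_extChartAt_self [IsManifold I ω N] (x : N) (w : TangentSpace I x) :
    vDeriv I (extChartAt I x) x w = w := by
  have : IsManifold I 1 N := isManifold_one
  rw [vDeriv, mfderiv_extChartAt_self]; rfl

theorem trivializationAt_snd_eq [IsManifold I ω N] {x₀ x : N} (hx : x ∈ (chartAt H x₀).source)
    (w : TangentSpace I x) :
    (trivializationAt E (TangentSpace I) x₀ ⟨x, w⟩).2 = vDeriv I (extChartAt I x₀) x w := by
  have : IsManifold I 1 N := isManifold_one
  rw [vDeriv, ← TangentBundle.continuousLinearMapAt_trivializationAt hx]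
  exact (congrFun ((trivializationAt E (TangentSpace I) x₀).coe_linearMapAt_of_mem
    (R := ℂ) (b := x) (by simpa using hx)) w).symm

theorem holVFAt_iff_chartField [IsManifold I ω N] {a : ∀ x : N, TangentSpace I x} {x₀ x : N}
    (hx : x ∈ (chartAt H x₀).source) :
    HolVFAt I a x ↔ ContMDiffAt I 𝓘(ℂ, E) ω (chartField I x₀ a) x := by
  have h1 := (trivializationAt E (TangentSpace I) x₀).contMDiffAt_section_iff
    (IB := I) (n := ω) (s := a) (x₀ := x) (by simpa using hx)
  refine h1.trans (Filter.EventuallyEq.contMDiffAt_iff ?_)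
  filter_upwards [(chartAt H x₀).open_source.mem_nhds hx] with y hy
  exact trivializationAt_snd_eq hy (a y)

theorem vDeriv_congr {F G : N → V} {x : N} (h : F =ᶠ[𝓝 x] G) : vDeriv I F x = vDeriv I G x :=
  h.mfderiv_eq

section Boundaryless

variable [I.Boundaryless]

/-- The tangent space at `x` is identified with `E` by the preferred chart at `x`, so derivatives at
`x` are derivatives in this chart. -/
theorem vDeriv_eq_fderiv_symm {F : N → V} {x : N} (hF : MDifferentiableAt I 𝓘(ℂ, V) F x) :
    vDeriv I F x = fderiv ℂ (F ∘ (extChartAt I x).symm) (extChartAt I x x) := by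
  have : mfderiv I 𝓘(ℂ, V) F x = fderivWithin ℂ (writtenInExtChartAt I 𝓘(ℂ, V) x F)
    (Set.range I) ((extChartAt I x) x) := hF.mfderiv
  rw [I.range_eq_univ, fderivWithin_univ] at this
  exact this

theorem mdifferentiableAt_extChartAt_symm [IsManifold I ω N] {x₀ : N} {e : E}
    (he : e ∈ (extChartAt I x₀).target) :
    MDifferentiableAt 𝓘(ℂ, E) I (extChartAt I x₀).symm e := by
  have : IsManifold I 1 N := isManifold_one
  have h2 := mdifferentiableWithinAt_extChartAt_symm (I := I) he
  rwa [I.range_eq_univ, mdifferentiableWithinAt_univ] at h2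

theorem differentiableAt_comp_symm [IsManifold I ω N]
    {F : N → V} {x₀ x : N} (hx : x ∈ (chartAt H x₀).source)
    (hF : MDifferentiableAt I 𝓘(ℂ, V) F x) :
    DifferentiableAt ℂ (F ∘ (extChartAt I x₀).symm) (extChartAt I x₀ x) := by
  rw [← mdifferentiableAt_iff_differentiableAt]
  refine MDifferentiableAt.comp _ ?_
    (mdifferentiableAt_extChartAt_symm (I := I) (x₀ := x₀) (by simp [hx]))
  rwa [(extChartAt I x₀).left_inv (by simpa using hx)]

theorem contDiffAt_comp_symm {F : N → V} {x₀ x : N} (hx : x ∈ (chartAt H x₀).source)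
    [IsManifold I ω N]
    (hF : ContMDiffAt I 𝓘(ℂ, V) ω F x) :
    ContDiffAt ℂ ω (F ∘ (extChartAt I x₀).symm) (extChartAt I x₀ x) := by
  rw [← contMDiffAt_iff_contDiffAt]
  have h2 : ContMDiffAt 𝓘(ℂ, E) I ω (extChartAt I x₀).symm (extChartAt I x₀ x) :=
    (contMDiffOn_extChartAt_symm (I := I) (n := ω) x₀).contMDiffAt
      ((isOpen_extChartAt_target x₀).mem_nhds (by simp [hx]))
  refine ContMDiffAt.comp _ ?_ h2
  rwa [(extChartAt I x₀).left_inv (by simpa using hx)]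

theorem vDeriv_eq_fderiv_chart [IsManifold I ω N] {F : N → V} {x₀ x : N}
    (hx : x ∈ (chartAt H x₀).source) (hF : MDifferentiableAt I 𝓘(ℂ, V) F x)
    (w : TangentSpace I x) :
    vDeriv I F x w = fderiv ℂ (F ∘ (extChartAt I x₀).symm) (extChartAt I x₀ x)
        (vDeriv I (extChartAt I x₀) x w) := by
  have : IsManifold I 1 N := isManifold_one
  have h1 := differentiableAt_comp_symm hx hF
  have h2 : F =ᶠ[𝓝 x] (F ∘ (extChartAt I x₀).symm) ∘ (extChartAt I x₀) := by
    filter_upwards [(chartAt H x₀).open_source.mem_nhds hx] with y hy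
    simp only [Function.comp]
    rw [(extChartAt I x₀).left_inv (by simpa using hy)]
  rw [vDeriv_congr h2, vDeriv,
    mfderiv_comp x h1.mdifferentiableAt (mdifferentiableAt_extChartAt hx), mfderiv_eq_fderiv]
  rfl

theorem eventually_vDeriv_symm [IsManifold I ω N] {F : N → V} {x : N}
    {a : ∀ x : N, TangentSpace I x} (hF : ContMDiffAt I 𝓘(ℂ, V) ω F x) :
    ∀ᶠ e in 𝓝 (extChartAt I x x), vDeriv I F ((extChartAt I x).symm e) (a _) =
      fderiv ℂ (F ∘ (extChartAt I x).symm) e ((chartField I x a ∘ (extChartAt I x).symm) e) := by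
  have h1 : ∀ᶠ y in 𝓝 x, MDifferentiableAt I 𝓘(ℂ, V) F y :=
    ((contMDiffAt_iff_contMDiffAt_nhds (by simp)).1 hF).mono fun y hy =>
      hy.mdifferentiableAt (by simp)
  have hc : ContinuousAt (extChartAt I x).symm (extChartAt I x x) := continuousAt_extChartAt_symm x
  rw [ContinuousAt, extChartAt_to_inv] at hc
  filter_upwards [hc.eventually h1, extChartAt_target_mem_nhds (I := I) x] with e he het
  have hs : (extChartAt I x).symm e ∈ (chartAt H x).source := by
    simpa using (extChartAt I x).map_target het
  rw [vDeriv_eq_fderiv_chart hs he, (extChartAt I x).right_inv het]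
  rfl

/-- The Lie bracket of vector fields on a manifold is computed in the chart at the point. -/
theorem mlieBracket_eq_lieBracket [IsManifold I ω N] (a b : ∀ x : N, TangentSpace I x) (x : N) :
    mlieBracket I a b x = lieBracket ℂ (chartField I x a ∘ (extChartAt I x).symm)
      (chartField I x b ∘ (extChartAt I x).symm) (extChartAt I x x) := by
  have : IsManifold I 1 N := isManifold_one
  have key : ∀ c : ∀ x : N, TangentSpace I x,
      mpullbackWithin 𝓘(ℂ, E) I (extChartAt I x).symm c (Set.range I)
        =ᶠ[𝓝 (extChartAt I x x)] (chartField I x c ∘ (extChartAt I x).symm) := by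
    intro c
    filter_upwards [extChartAt_target_mem_nhds (I := I) x] with e het
    exact congrFun (congrArg DFunLike.coe (ContinuousLinearMap.inverse_eq
      (mfderivWithin_extChartAt_symm_comp_mfderiv_extChartAt het)
      (mfderiv_extChartAt_comp_mfderivWithin_extChartAt_symm het))) _
  have hinv : ∀ (T : E →L[ℂ] E) (z : E), T = ContinuousLinearMap.id ℂ E → T.inverse z = z := by
    rintro T z rfl
    simp
  rw [← mlieBracketWithin_univ, mlieBracketWithin_apply]
  rw [I.range_eq_univ] at key ⊢
  simp only [Set.preimage_univ, Set.inter_univ]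
  refine (hinv _ _ mfderiv_extChartAt_self).trans ?_
  exact ((key a).lieBracketWithin_vectorField_eq_nhds (key b)).trans (by rw [lieBracketWithin_univ])

theorem contMDiffAt_vDeriv_apply [IsManifold I ω N] {F : N → V} {x : N}
    {a : ∀ x : N, TangentSpace I x} (hF : ContMDiffAt I 𝓘(ℂ, V) ω F x) (ha : HolVFAt I a x) :
    ContMDiffAt I 𝓘(ℂ, V) ω (fun y => vDeriv I F y (a y)) x := by
  have hx := mem_chart_source H x
  have h1 := contDiffAt_comp_symm hx hF
  have h2 := contDiffAt_comp_symm hx ((holVFAt_iff_chartField hx).1 ha)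
  have h3 : ContDiffAt ℂ ω (fun e => fderiv ℂ (F ∘ (extChartAt I x).symm) e
      ((chartField I x a ∘ (extChartAt I x).symm) e)) (extChartAt I x x) :=
    (h1.fderiv_right (by simp)).clm_apply h2
  have h4 := h3.contMDiffAt.comp x (contMDiffAt_extChartAt (I := I) (n := ω) (x := x))
  refine h4.congr_of_eventuallyEq ?_
  have h5 := (continuousAt_extChartAt (I := I) x).eventually (eventually_vDeriv_symm (a := a) hF)
  filter_upwards [h5, (chartAt H x).open_source.mem_nhds hx] with y hy hys
  rw [(extChartAt I x).left_inv (by simpa using hys)] at hy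
  exact hy

/-- The Lie bracket acts on functions as the commutator of the derivatives. -/
theorem vDeriv_mlieBracket [IsManifold I ω N] {F : N → V} {x : N}
    {a b : ∀ x : N, TangentSpace I x}
    (hF : ContMDiffAt I 𝓘(ℂ, V) ω F x) (ha : HolVFAt I a x) (hb : HolVFAt I b x) :
    vDeriv I F x (mlieBracket I a b x) =
      vDeriv I (fun y => vDeriv I F y (b y)) x (a x) -
      vDeriv I (fun y => vDeriv I F y (a y)) x (b x) := by
  have hx := mem_chart_source H x
  have hd : ∀ {c : ∀ x : N, TangentSpace I x}, HolVFAt I c x →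
      ContDiffAt ℂ ω (chartField I x c ∘ (extChartAt I x).symm) (extChartAt I x x) := fun hc =>
    contDiffAt_comp_symm hx ((holVFAt_iff_chartField hx).1 hc)
  have hF' := contDiffAt_comp_symm hx hF
  have hm : ∀ {c : ∀ x : N, TangentSpace I x}, HolVFAt I c x → ∀ w : TangentSpace I x,
      vDeriv I (fun y => vDeriv I F y (c y)) x w =
      fderiv ℂ (fun e => fderiv ℂ (F ∘ (extChartAt I x).symm) e
        ((chartField I x c ∘ (extChartAt I x).symm) e)) (extChartAt I x x) (w : E) := by
    intro c hc w
    have e1 := vDeriv_eq_fderiv_symm ((contMDiffAt_vDeriv_apply hF hc).mdifferentiableAt (by simp))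
    have e2 := Filter.EventuallyEq.fderiv_eq (𝕜 := ℂ) (eventually_vDeriv_symm (a := c) hF)
    exact congrArg (fun T : E →L[ℂ] V => T w) (e1.trans e2)
  have h0 : ∀ c : ∀ x : N, TangentSpace I x,
      (chartField I x c ∘ (extChartAt I x).symm) (extChartAt I x x) = c x := by
    intro c
    simp only [Function.comp, extChartAt_to_inv]
    exact vDeriv_extChartAt_self x (c x)
  have hsym := fderiv_apply_lieBracket hF' (by simp) ((hd hb).differentiableAt (by simp))
    ((hd ha).differentiableAt (by simp))
  rw [h0 a, h0 b] at hsym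
  have e3 := congrArg (fun T : E →L[ℂ] V => T (mlieBracket I a b x))
    (vDeriv_eq_fderiv_symm (hF.mdifferentiableAt (by simp)))
  have e4 := congrArg (fderiv ℂ (F ∘ (extChartAt I x).symm) (extChartAt I x x))
    (mlieBracket_eq_lieBracket a b x)
  exact (e3.trans e4).trans (hsym.trans (congrArg₂ (fun p q : V => p - q)
    (hm hb (a x)).symm (hm ha (b x)).symm))

end Boundaryless
end Local

/-! ### Vector fields along maps, related vector fields and constant fields -/

section Along

variable {E H N : Type*} [NormedAddCommGroup E] [NormedSpace ℂ E] [TopologicalSpace H]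
  {I : ModelWithCorners ℂ E H} [TopologicalSpace N] [ChartedSpace H N]
  {E' H' N' : Type*} [NormedAddCommGroup E'] [NormedSpace ℂ E'] [TopologicalSpace H']
  {I' : ModelWithCorners ℂ E' H'} [TopologicalSpace N'] [ChartedSpace H' N']
  {V : Type*} [NormedAddCommGroup V] [NormedSpace ℂ V]

variable (I I') in
/-- The vector field `w` along the map `g` is holomorphic at the point `x`. -/
def HolAlongAt [IsManifold I' ω N'] (g : N → N') (w : ∀ y : N, TangentSpace I' (g y)) (x : N) :
    Prop :=
  ContMDiffAt I I'.tangent ω (fun y => (⟨g y, w y⟩ : TangentBundle I' N')) x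

theorem holAlongAt_iff [IsManifold I' ω N'] {g : N → N'} {w : ∀ y : N, TangentSpace I' (g y)}
    {x : N} {x₀ : N'} (hx : g x ∈ (chartAt H' x₀).source) :
    HolAlongAt I I' g w x ↔ ContMDiffAt I I' ω g x ∧
      ContMDiffAt I 𝓘(ℂ, E') ω (fun y => vDeriv I' (extChartAt I' x₀) (g y) (w y)) x := by
  have h1 := (trivializationAt E' (TangentSpace I' (M := N')) x₀).contMDiffAt_iff
    (IM := I) (IB := I') (n := ω) (x₀ := x)
    (f := fun y => (⟨g y, w y⟩ : TangentBundle I' N'))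
    ((Trivialization.mem_source _).2 (by simpa using hx))
  refine h1.trans (and_congr_right fun hg => Filter.EventuallyEq.contMDiffAt_iff ?_)
  filter_upwards [hg.continuousAt.preimage_mem_nhds
    ((chartAt H' x₀).open_source.mem_nhds hx)] with y hy
  exact trivializationAt_snd_eq hy (w y)

theorem HolVFAt.congr [IsManifold I ω N] {a b : ∀ y : N, TangentSpace I y} {x : N}
    (h : HolVFAt I a x) (hw : ∀ᶠ y in 𝓝 x, b y = a y) : HolVFAt I b x :=
  h.congr_of_eventuallyEq (hw.mono fun y hy => by simp only [hy])

theorem vDeriv_comp {F : N' → V} {g : N → N'} {x : N}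
    (hF : MDifferentiableAt I' 𝓘(ℂ, V) F (g x)) (hg : MDifferentiableAt I I' g x)
    (w : TangentSpace I x) :
    vDeriv I (F ∘ g) x w = vDeriv I' F (g x) (mfderiv I I' g x w) := by
  rw [vDeriv, mfderiv_comp x hF hg]; rfl

theorem eventually_vDeriv_extChartAt_comp [IsManifold I ω N] [IsManifold I' ω N'] {g : N → N'}
    {x : N} (hg : ContMDiffAt I I' ω g x) :
    ∀ᶠ y in 𝓝 x, ∀ w : TangentSpace I y, vDeriv I (extChartAt I' (g x) ∘ g) y w =
      vDeriv I' (extChartAt I' (g x)) (g y) (mfderiv I I' g y w) := by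
  have : IsManifold I 1 N := isManifold_one
  have : IsManifold I' 1 N' := isManifold_one
  filter_upwards [hg.continuousAt.preimage_mem_nhds
    ((chartAt H' (g x)).open_source.mem_nhds (mem_chart_source H' (g x))),
    (contMDiffAt_iff_contMDiffAt_nhds (by simp)).1 hg] with y hy hgy w
  exact vDeriv_comp (mdifferentiableAt_extChartAt hy) (hgy.mdifferentiableAt (by simp)) w

theorem contMDiffAt_extChartAt_comp [IsManifold I' ω N'] {g : N → N'}
    {x : N} (hg : ContMDiffAt I I' ω g x) :
    ContMDiffAt I 𝓘(ℂ, E') ω (extChartAt I' (g x) ∘ g) x :=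
  (contMDiffAt_extChartAt (I := I') (n := ω) (x := g x)).comp x hg

variable [I.Boundaryless]

theorem HolVFAt.mfderiv [IsManifold I ω N] [IsManifold I' ω N'] {g : N → N'} {x : N}
    {a : ∀ y : N, TangentSpace I y} (hg : ContMDiffAt I I' ω g x) (ha : HolVFAt I a x) :
    HolAlongAt I I' g (fun y => mfderiv I I' g y (a y)) x := by
  rw [holAlongAt_iff (mem_chart_source H' (g x))]
  refine ⟨hg, (contMDiffAt_vDeriv_apply (contMDiffAt_extChartAt_comp hg)
    ha).congr_of_eventuallyEq ?_⟩
  filter_upwards [eventually_vDeriv_extChartAt_comp hg] with y hy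
  exact (hy (a y)).symm

/-- Brackets of related vector fields are related. -/
theorem mfderiv_mlieBracket_of_related [IsManifold I ω N] [IsManifold I' ω N'] [I'.Boundaryless]
    {g : N → N'} {x : N}
    {a b : ∀ y : N, TangentSpace I y} {a' b' : ∀ y : N', TangentSpace I' y}
    (hg : ContMDiffAt I I' ω g x) (ha : HolVFAt I a x) (hb : HolVFAt I b x)
    (ha' : HolVFAt I' a' (g x)) (hb' : HolVFAt I' b' (g x))
    (hra : ∀ᶠ y in 𝓝 x, mfderiv I I' g y (a y) = a' (g y))
    (hrb : ∀ᶠ y in 𝓝 x, mfderiv I I' g y (b y) = b' (g y)) :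
    mfderiv I I' g x (mlieBracket I a b x) = mlieBracket I' a' b' (g x) := by
  have : IsManifold I' 1 N' := isManifold_one
  have hG := contMDiffAt_extChartAt_comp hg
  have hgd := hg.mdifferentiableAt (n := ω) (by simp)
  have key : ∀ {c : ∀ y : N, TangentSpace I y} {c' d' : ∀ y : N', TangentSpace I' y}
      {d : ∀ y : N, TangentSpace I y},
      HolVFAt I' c' (g x) → (∀ᶠ y in 𝓝 x, mfderiv I I' g y (c y) = c' (g y)) →
      (∀ᶠ y in 𝓝 x, mfderiv I I' g y (d y) = d' (g y)) →
      vDeriv I (fun y => vDeriv I (extChartAt I' (g x) ∘ g) y (c y)) x (d x) =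
        vDeriv I' (fun y => vDeriv I' (extChartAt I' (g x)) y (c' y)) (g x) (d' (g x)) := by
    intro c c' d' d hc' hrc hrd
    have h1 : (fun y => vDeriv I (extChartAt I' (g x) ∘ g) y (c y)) =ᶠ[𝓝 x]
        chartField I' (g x) c' ∘ g := by
      filter_upwards [eventually_vDeriv_extChartAt_comp hg, hrc] with y hy hcy
      rw [hy, hcy]; rfl
    rw [vDeriv_congr h1, vDeriv_comp
      (((holVFAt_iff_chartField (mem_chart_source H' (g x))).1 hc').mdifferentiableAt (by simp))
      hgd, hrd.self_of_nhds]
    rfl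
  have h1 := vDeriv_mlieBracket hG ha hb
  rw [key hb' hrb hra, key ha' hra hrb, ← vDeriv_mlieBracket contMDiffAt_extChartAt ha' hb',
    vDeriv_comp (mdifferentiableAt_extChartAt (mem_chart_source H' _)) hgd,
    vDeriv_extChartAt_self, vDeriv_extChartAt_self] at h1
  exact h1

end Along

section Frames

variable {E H N : Type*} [NormedAddCommGroup E] [NormedSpace ℂ E] [TopologicalSpace H]
  {I : ModelWithCorners ℂ E H} [TopologicalSpace N] [ChartedSpace H N]
  [IsManifold I ω N]

variable (I) in
/-- The vector field, defined on the source of the chart at `x₀`, which is constant equal to `e`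
in this chart; it is `0` at other points. -/
noncomputable def constField (x₀ : N) (e : E) (y : N) : TangentSpace I y :=
  (trivializationAt E (TangentSpace I) x₀).symmₗ ℂ y e

theorem constField_eq_symm {x₀ y : N} (hy : y ∈ (chartAt H x₀).source) (e : E) :
    constField I x₀ e y = (trivializationAt E (TangentSpace I) x₀).symm y e :=
  congrFun ((trivializationAt E (TangentSpace I) x₀).coe_symmₗ (R := ℂ) (b := y)
    (by simpa using hy)) e

theorem vDeriv_constField {x₀ y : N} (hy : y ∈ (chartAt H x₀).source) (e : E) :
    vDeriv I (extChartAt I x₀) y (constField I x₀ e y) = e := by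
  rw [← trivializationAt_snd_eq hy, constField_eq_symm hy]
  have := (trivializationAt E (TangentSpace I) x₀).apply_mk_symm (b := y) (by simpa using hy) e
  exact congrArg Prod.snd this

theorem constField_vDeriv {x₀ y : N} (hy : y ∈ (chartAt H x₀).source) (w : TangentSpace I y) :
    constField I x₀ (vDeriv I (extChartAt I x₀) y w) y = w := by
  rw [← trivializationAt_snd_eq hy, constField_eq_symm hy]
  exact (trivializationAt E (TangentSpace I) x₀).symm_apply_apply_mk (b := y)
    (by simpa using hy) w

theorem holVFAt_constField {x₀ y : N} (hy : y ∈ (chartAt H x₀).source) (e : E) :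
    HolVFAt I (constField I x₀ e) y := by
  rw [holVFAt_iff_chartField hy]
  refine (contMDiffAt_const (c := e)).congr_of_eventuallyEq ?_
  filter_upwards [(chartAt H x₀).open_source.mem_nhds hy] with z hz
  exact vDeriv_constField hz e

theorem holVFAt_constField_self (x : N) (w : TangentSpace I x) :
    HolVFAt I (constField I x (w : E)) x :=
  holVFAt_constField (E := E) (mem_chart_source H x) w

theorem constField_self (x : N) (w : TangentSpace I x) : constField I x (w : E) x = w := by
  have := constField_vDeriv (mem_chart_source H x) w
  rwa [vDeriv_extChartAt_self] at this

theorem mlieBracket_constField [I.Boundaryless] {x₀ x : N} (hx : x ∈ (chartAt H x₀).source)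
    (e e' : E) : mlieBracket I (constField I x₀ e) (constField I x₀ e') x = 0 := by
  have h1 := vDeriv_mlieBracket (V := E) (contMDiffAt_extChartAt' hx)
    (holVFAt_constField (I := I) hx e) (holVFAt_constField hx e')
  have h2 : ∀ e : E, ∀ w : TangentSpace I x,
      vDeriv I (fun y => vDeriv I (extChartAt I x₀) y (constField I x₀ e y)) x w = 0 := by
    intro e w
    have : (fun y => vDeriv I (extChartAt I x₀) y (constField I x₀ e y)) =ᶠ[𝓝 x]
        fun _ => e := by
      filter_upwards [(chartAt H x₀).open_source.mem_nhds hx] with y hy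
      exact vDeriv_constField hy e
    rw [vDeriv_congr this, vDeriv, mfderiv_const]; rfl
  rw [h2, h2, sub_zero] at h1
  rw [← constField_vDeriv hx (mlieBracket I _ _ x), h1]
  exact map_zero _

theorem HolVFAt.exists_holVF {a : ∀ y : N, TangentSpace I y} {x : N} (h : HolVFAt I a x) :
    ∃ U : Set N, IsOpen U ∧ x ∈ U ∧ HolVF I U a := by
  have h1 := (contMDiffAt_iff_contMDiffAt_nhds (by simp)).1 h
  obtain ⟨U, hU, hUo, hxU⟩ := eventually_nhds_iff.1 h1
  exact ⟨U, hUo, hxU, fun y hy => (hU y hy).contMDiffWithinAt⟩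

theorem HolVFAt.eventually {a : ∀ y : N, TangentSpace I y} {x : N} (h : HolVFAt I a x) :
    ∀ᶠ y in 𝓝 x, HolVFAt I a y := (contMDiffAt_iff_contMDiffAt_nhds (by simp)).1 h

omit [IsManifold I ω N] in
theorem _root_.JoyceHam.HolVF.holVFAt [IsManifold I ω N] {a : ∀ y : N, TangentSpace I y}
    {U : Set N} {x : N}
    (h : HolVF I U a) (hU : IsOpen U) (hx : x ∈ U) : HolVFAt I a x :=
  ContMDiffOn.contMDiffAt h (hU.mem_nhds hx)

theorem HolVFAt.add {a b : ∀ y : N, TangentSpace I y} {x : N} (ha : HolVFAt I a x)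
    (hb : HolVFAt I b x) : HolVFAt I (fun y => a y + b y) x := by
  have hx := mem_chart_source H x
  rw [holVFAt_iff_chartField hx] at *
  exact (ha.add hb).congr_of_eventuallyEq (.of_forall fun y => map_add _ _ _)

theorem HolVFAt.smul {f : N → ℂ} {b : ∀ y : N, TangentSpace I y} {x : N}
    (hf : ContMDiffAt I 𝓘(ℂ, ℂ) ω f x)
    (hb : HolVFAt I b x) : HolVFAt I (fun y => f y • b y) x := by
  have hx := mem_chart_source H x
  rw [holVFAt_iff_chartField hx] at *
  exact (hf.smul hb).congr_of_eventuallyEq (.of_forall fun y => map_smul _ _ _)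

theorem HolVFAt.const_smul (c : ℂ) {b : ∀ y : N, TangentSpace I y} {x : N}
    (hb : HolVFAt I b x) : HolVFAt I (fun y => c • b y) x :=
  HolVFAt.smul contMDiffAt_const hb

theorem HolVFAt.sub {a b : ∀ y : N, TangentSpace I y} {x : N} (ha : HolVFAt I a x)
    (hb : HolVFAt I b x) : HolVFAt I (fun y => a y - b y) x := by
  have := ha.add (hb.const_smul (-1))
  simpa [sub_eq_add_neg] using this

theorem holVFAt_zero (x : N) : HolVFAt I (fun _ => 0) x := by
  rw [holVFAt_iff_chartField (mem_chart_source H x)]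
  exact (contMDiffAt_const (c := (0 : E))).congr_of_eventuallyEq (.of_forall fun y => map_zero _)

theorem HolVFAt.sum {ι : Type*} (s : Finset ι) {a : ι → ∀ y : N, TangentSpace I y} {x : N}
    (ha : ∀ i ∈ s, HolVFAt I (a i) x) : HolVFAt I (fun y => ∑ i ∈ s, a i y) x := by
  classical
  induction s using Finset.induction_on with
  | empty => simpa using holVFAt_zero x
  | insert j s hj ih =>
    simp only [Finset.sum_insert hj]
    exact (ha j (by simp)).add (ih fun i hi => ha i (by simp [hi]))

end Frames

/-! ### The exterior derivative of a holomorphic 2-form -/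

section Forms

variable {E H N : Type*} [NormedAddCommGroup E] [NormedSpace ℂ E] [TopologicalSpace H]
  {I : ModelWithCorners ℂ E H} [TopologicalSpace N] [ChartedSpace H N]
  {E' H' N' : Type*} [NormedAddCommGroup E'] [NormedSpace ℂ E'] [TopologicalSpace H']
  {I' : ModelWithCorners ℂ E' H'} [TopologicalSpace N'] [ChartedSpace H' N']

variable (I) in
/-- The field of bilinear forms `η` is holomorphic: it takes holomorphic vector fields to
holomorphic functions. -/
def IsHolForm [IsManifold I ω N] (η : FormField I N) : Prop :=
  ∀ (x : N) (a b : ∀ y : N, TangentSpace I y), HolVFAt I a x → HolVFAt I b x →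
    ContMDiffAt I 𝓘(ℂ, ℂ) ω (fun y => η y (a y) (b y)) x

variable (I) in
/-- The exterior derivative of `η`, evaluated on vector fields by the invariant formula. -/
noncomputable def extD [IsManifold I ω N] (η : FormField I N) (a b c : ∀ y : N, TangentSpace I y)
    (x : N) : ℂ :=
  dirDeriv I (fun x => η x (b x) (c x)) x (a x)
    - dirDeriv I (fun x => η x (a x) (c x)) x (b x)
    + dirDeriv I (fun x => η x (a x) (b x)) x (c x)
    - η x (mlieBracket I a b x) (c x)
    + η x (mlieBracket I a c x) (b x)
    - η x (mlieBracket I b c x) (a x)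

variable (I) in
/-- The form `η` is closed. -/
def IsClosedForm [IsManifold I ω N] (η : FormField I N) : Prop :=
  ∀ (x : N) (a b c : ∀ y : N, TangentSpace I y), HolVFAt I a x → HolVFAt I b x → HolVFAt I c x →
    extD I η a b c x = 0

/-- The pullback of a field of bilinear forms. -/
noncomputable def pullbackForm (g : N → N') (η : FormField I' N') : FormField I N := fun y =>
  (η (g y)).comp (mfderiv I I' g y).toLinearMap (mfderiv I I' g y).toLinearMap

theorem form_swap {η : FormField I N} (halt : ∀ x a, η x a a = 0) (x : N) (a b : TangentSpace I x) :
    η x a b = -η x b a := by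
  have h1 := halt x (a + b)
  simp only [map_add, LinearMap.add_apply, halt] at h1
  linear_combination h1

theorem pullbackForm_apply (g : N → N') (η : FormField I' N') (y : N) (a b : TangentSpace I y) :
    pullbackForm g η y a b = η (g y) (mfderiv I I' g y a) (mfderiv I I' g y b) := rfl

theorem IsSymplecticForm.isHolForm [IsManifold I ω N] {η : FormField I N}
    (h : IsSymplecticForm I η) : IsHolForm I η := by
  intro x a b ha hb
  obtain ⟨U, hU, hxU, haU⟩ := ha.exists_holVF
  obtain ⟨U', hU', hxU', hbU⟩ := hb.exists_holVF
  exact ContMDiffOn.contMDiffAt (h.hol (U ∩ U') a b (hU.inter hU')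
    (haU.mono Set.inter_subset_left) (hbU.mono Set.inter_subset_right))
    ((hU.inter hU').mem_nhds ⟨hxU, hxU'⟩)

theorem IsSymplecticForm.isClosedForm [IsManifold I ω N] {η : FormField I N}
    (h : IsSymplecticForm I η) : IsClosedForm I η := by
  intro x a b c ha hb hc
  obtain ⟨U, hU, hxU, haU⟩ := ha.exists_holVF
  obtain ⟨U', hU', hxU', hbU⟩ := hb.exists_holVF
  obtain ⟨U'', hU'', hxU'', hcU⟩ := hc.exists_holVF
  exact h.closed (U ∩ U' ∩ U'') a b c ((hU.inter hU').inter hU'')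
    (haU.mono fun y hy => hy.1.1) (hbU.mono fun y hy => hy.1.2) (hcU.mono fun y hy => hy.2)
    x ⟨⟨hxU, hxU'⟩, hxU''⟩

variable [FiniteDimensional ℂ E]

omit [FiniteDimensional ℂ E] in
theorem constField_eq_sum [IsManifold I ω N] {ι : Type*} [Fintype ι] (B : Module.Basis ι ℂ E)
    (x₀ : N) (u : E) (y : N) :
    constField I x₀ u y = ∑ i, B.repr u i • constField I x₀ (B i) y := by
  refine (congrArg ((trivializationAt E (TangentSpace I) x₀).symmₗ ℂ y)
    (B.sum_repr u).symm).trans ?_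
  simp only [map_sum, map_smul]
  rfl

variable (I) in
/-- The matrix of `η` in the chart at `x₀`, as a function with values in the bilinear forms on the
model space. It is assembled from the values of `η` on constant fields, and does not depend on the
basis (`coordForm_apply`). -/
noncomputable def coordForm [IsManifold I ω N] (η : FormField I N) (x₀ y : N) :
    E →L[ℂ] E →L[ℂ] ℂ :=
  ∑ i, ∑ j, η y (constField I x₀ (Module.finBasis ℂ E i) y)
      (constField I x₀ (Module.finBasis ℂ E j) y) •
    ((Module.finBasis ℂ E).coord i).toContinuousLinearMap.smulRight
      ((Module.finBasis ℂ E).coord j).toContinuousLinearMap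

theorem coordForm_apply [IsManifold I ω N] (η : FormField I N) (x₀ y : N) (u v : E) :
    coordForm I η x₀ y u v = η y (constField I x₀ u y) (constField I x₀ v y) := by
  rw [constField_eq_sum (Module.finBasis ℂ E) x₀ u y,
    constField_eq_sum (Module.finBasis ℂ E) x₀ v y]
  simp only [coordForm, _root_.sum_apply, _root_.smul_apply, map_sum,
    LinearMap.sum_apply, map_smul, LinearMap.smul_apply, smul_eq_mul,
    ContinuousLinearMap.smulRight_apply, LinearMap.coe_toContinuousLinearMap',
    Module.Basis.coord_apply, Finset.mul_sum]
  rw [Finset.sum_comm]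
  refine Finset.sum_congr rfl fun i _ => Finset.sum_congr rfl fun j _ => ?_
  ring

theorem coordForm_vDeriv [IsManifold I ω N] (η : FormField I N) {x₀ y : N}
    (hy : y ∈ (chartAt H x₀).source) (u v : TangentSpace I y) :
    coordForm I η x₀ y (vDeriv I (extChartAt I x₀) y u) (vDeriv I (extChartAt I x₀) y v) =
      η y u v := by
  rw [coordForm_apply, constField_vDeriv hy, constField_vDeriv hy]

theorem IsHolForm.contMDiffAt_coordForm [IsManifold I ω N] {η : FormField I N}
    (hη : IsHolForm I η) {x₀ y : N} (hy : y ∈ (chartAt H x₀).source) :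
    ContMDiffAt I 𝓘(ℂ, E →L[ℂ] E →L[ℂ] ℂ) ω (coordForm I η x₀) y := by
  unfold coordForm
  refine contMDiffAt_finsetSum fun i _ => contMDiffAt_finsetSum fun j _ => ?_
  exact (hη y _ _ (holVFAt_constField hy _) (holVFAt_constField hy _)).smul contMDiffAt_const

/-- A holomorphic form takes holomorphic vector fields along a map to holomorphic functions. -/
theorem IsHolForm.contMDiffAt_along [IsManifold I ω N] {η : FormField I N}
    (hη : IsHolForm I η) {g : N' → N} {x : N'} {a b : ∀ y : N', TangentSpace I (g y)}
    (ha : HolAlongAt I' I g a x) (hb : HolAlongAt I' I g b x) :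
    ContMDiffAt I' 𝓘(ℂ, ℂ) ω (fun y => η (g y) (a y) (b y)) x := by
  have hx := mem_chart_source H (g x)
  obtain ⟨hg, ha⟩ := (holAlongAt_iff hx).1 ha
  obtain ⟨-, hb⟩ := (holAlongAt_iff hx).1 hb
  have h1 := (hη.contMDiffAt_coordForm hx).comp x hg
  refine ((h1.clm_apply ha).clm_apply hb).congr_of_eventuallyEq ?_
  filter_upwards [hg.continuousAt.preimage_mem_nhds
    ((chartAt H (g x)).open_source.mem_nhds hx)] with y hy
  exact (coordForm_vDeriv η hy _ _).symm

theorem IsHolForm.pullback [IsManifold I ω N] [IsManifold I' ω N'] [I'.Boundaryless]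
    {η : FormField I N} (hη : IsHolForm I η) {g : N' → N} (hg : ContMDiff I' I ω g) :
    IsHolForm I' (pullbackForm (I := I') g η) := fun x _ _ ha hb =>
  hη.contMDiffAt_along (ha.mfderiv (hg x)) (hb.mfderiv (hg x))

/-- The exterior derivative of `η` at `x₀`, evaluated on tangent vectors: the alternating sum of
derivatives of the matrix of `η` in the preferred chart at `x₀`. -/
noncomputable def ptExtD [IsManifold I ω N] (η : FormField I N) (x₀ : N)
    (u v w : TangentSpace I x₀) : ℂ :=
  vDeriv I (coordForm I η x₀) x₀ u v w - vDeriv I (coordForm I η x₀) x₀ v u w +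
    vDeriv I (coordForm I η x₀) x₀ w u v

omit [FiniteDimensional ℂ E] in
theorem vDeriv_bilin_apply [IsManifold I' ω N'] [I'.Boundaryless]
    {A : N' → E →L[ℂ] E →L[ℂ] ℂ} {p q : N' → E} {x : N'}
    (hA : MDifferentiableAt I' 𝓘(ℂ, E →L[ℂ] E →L[ℂ] ℂ) A x)
    (hp : MDifferentiableAt I' 𝓘(ℂ, E) p x) (hq : MDifferentiableAt I' 𝓘(ℂ, E) q x)
    (w : TangentSpace I' x) :
    vDeriv I' (fun y => A y (p y) (q y)) x w =
      vDeriv I' A x w (p x) (q x) + A x (vDeriv I' p x w) (q x) + A x (p x) (vDeriv I' q x w) := by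
  have hx := mem_chart_source H' x
  have h0 : ∀ {V : Type _} (F : N' → V), (F ∘ (extChartAt I' x).symm) (extChartAt I' x x) = F x :=
    fun F => by simp
  have h := (((differentiableAt_comp_symm (I := I') hx hA).hasFDerivAt.clm_apply
    (differentiableAt_comp_symm (I := I') hx hp).hasFDerivAt).clm_apply
    (differentiableAt_comp_symm (I := I') hx hq).hasFDerivAt).fderiv
  rw [vDeriv_eq_fderiv_symm hA, vDeriv_eq_fderiv_symm hp, vDeriv_eq_fderiv_symm hq,
    vDeriv_eq_fderiv_symm ((hA.clm_apply hp).clm_apply hq)]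
  refine (congrArg (fun T : E' →L[ℂ] ℂ => T w) h).trans ?_
  rw [h0, h0, h0]
  have key : ∀ r s t : ℂ, r + (s + t) = t + s + r := fun _ _ _ => by ring
  exact key (A x (p x) (fderiv ℂ (q ∘ (extChartAt I' x).symm) (extChartAt I' x x) w))
    (A x (fderiv ℂ (p ∘ (extChartAt I' x).symm) (extChartAt I' x x) w) (q x))
    (fderiv ℂ (A ∘ (extChartAt I' x).symm) (extChartAt I' x x) w (p x) (q x))

variable [I.Boundaryless] [I'.Boundaryless]

omit [I.Boundaryless] in
/-- The exterior derivative commutes with pullback. The right hand side depends only on the values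
of the vector fields at `x`, so the case `g = id` gives the tensoriality of the exterior derivative. -/
theorem extD_pullbackForm [IsManifold I ω N] [IsManifold I' ω N'] {η : FormField I N}
    (hη : IsHolForm I η) (halt : ∀ x a, η x a a = 0) {g : N' → N} {x : N'}
    (hg : ContMDiffAt I' I ω g x) {a b c : ∀ y : N', TangentSpace I' y}
    (ha : HolVFAt I' a x) (hb : HolVFAt I' b x) (hc : HolVFAt I' c x) :
    extD I' (pullbackForm (I := I') g η) a b c x =
      ptExtD η (g x) (mfderiv I' I g x (a x)) (mfderiv I' I g x (b x))
        (mfderiv I' I g x (c x)) := by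
  have hx := mem_chart_source H (g x)
  have hgd := hg.mdifferentiableAt (n := ω) (by simp)
  have hG := contMDiffAt_extChartAt_comp hg
  have hT := (hη.contMDiffAt_coordForm hx).comp x hg
  have hTd := hT.mdifferentiableAt (n := ω) (by simp)
  set T : N' → E →L[ℂ] E →L[ℂ] ℂ := coordForm I η (g x) ∘ g with hTdef
  set G : N' → E := extChartAt I (g x) ∘ g with hGdef
  have hself : ∀ w : TangentSpace I' x, vDeriv I' G x w = mfderiv I' I g x w := fun w => by
    have : IsManifold I 1 N := isManifold_one
    rw [hGdef, vDeriv_comp (mdifferentiableAt_extChartAt hx) hgd, vDeriv_extChartAt_self]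
  have hTx : ∀ w : TangentSpace I' x,
      vDeriv I' T x w = vDeriv I (coordForm I η (g x)) (g x) (mfderiv I' I g x w) := fun w =>
    vDeriv_comp ((hη.contMDiffAt_coordForm hx).mdifferentiableAt (by simp)) hgd w
  have hev : ∀ᶠ y in 𝓝 x, ∀ p q : TangentSpace I' y,
      pullbackForm (I := I') g η y p q = T y (vDeriv I' G y p) (vDeriv I' G y q) := by
    filter_upwards [hg.continuousAt.preimage_mem_nhds ((chartAt H (g x)).open_source.mem_nhds hx),
      eventually_vDeriv_extChartAt_comp hg] with y hy hGy p q
    rw [hGy, hGy, pullbackForm_apply]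
    exact (coordForm_vDeriv η hy _ _).symm
  have hvd : ∀ {p : ∀ y : N', TangentSpace I' y}, HolVFAt I' p x →
      MDifferentiableAt I' 𝓘(ℂ, E) (fun y => vDeriv I' G y (p y)) x := fun hp =>
    (contMDiffAt_vDeriv_apply hG hp).mdifferentiableAt (by simp)
  -- Leibniz rule for `g^*η(p, q)`, read in the chart at `g x`; the terms with derivatives of the
  -- vector fields are the ones cancelled by the brackets.
  have hder : ∀ {p q : ∀ y : N', TangentSpace I' y}, HolVFAt I' p x → HolVFAt I' q x →
      ∀ w : TangentSpace I' x,
      dirDeriv I' (fun y => pullbackForm (I := I') g η y (p y) (q y)) x w =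
        vDeriv I' T x w (vDeriv I' G x (p x)) (vDeriv I' G x (q x)) +
        T x (vDeriv I' (fun y => vDeriv I' G y (p y)) x w) (vDeriv I' G x (q x)) +
        T x (vDeriv I' G x (p x)) (vDeriv I' (fun y => vDeriv I' G y (q y)) x w) := by
    intro p q hp hq w
    have h1 : (fun y => pullbackForm (I := I') g η y (p y) (q y)) =ᶠ[𝓝 x]
        fun y => T y (vDeriv I' G y (p y)) (vDeriv I' G y (q y)) :=
      hev.mono fun y hy => hy _ _
    have h2 : dirDeriv I' (fun y => pullbackForm (I := I') g η y (p y) (q y)) x w =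
      vDeriv I' (fun y => pullbackForm (I := I') g η y (p y) (q y)) x w := rfl
    rw [h2, vDeriv_congr h1, vDeriv_bilin_apply hTd (hvd hp) (hvd hq)]
  have hTalt : ∀ u : E, T x u u = 0 := fun u => by
    rw [hTdef, Function.comp, coordForm_apply, halt]
  have hTswap : ∀ u v : E, T x u v = - T x v u := fun u v => by
    have h1 := hTalt (u + v)
    simp only [map_add, _root_.add_apply, hTalt] at h1
    linear_combination h1
  have hR : ptExtD η (g x) (mfderiv I' I g x (a x)) (mfderiv I' I g x (b x))
      (mfderiv I' I g x (c x)) =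
      vDeriv I' T x (a x) (vDeriv I' G x (b x)) (vDeriv I' G x (c x)) -
      vDeriv I' T x (b x) (vDeriv I' G x (a x)) (vDeriv I' G x (c x)) +
      vDeriv I' T x (c x) (vDeriv I' G x (a x)) (vDeriv I' G x (b x)) := by
    rw [hself, hself, hself, hTx, hTx, hTx]
    rfl
  rw [extD, hder hb hc, hder ha hc, hder ha hb, hev.self_of_nhds, hev.self_of_nhds,
    hev.self_of_nhds, vDeriv_mlieBracket hG ha hb, vDeriv_mlieBracket hG ha hc,
    vDeriv_mlieBracket hG hb hc, hR]
  simp only [map_sub, _root_.sub_apply]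
  rw [hTswap (vDeriv I' G x (b x)) (vDeriv I' (fun y => vDeriv I' G y (c y)) x (a x)),
    hTswap (vDeriv I' G x (a x)) (vDeriv I' (fun y => vDeriv I' G y (b y)) x (c x)),
    hTswap (vDeriv I' G x (a x)) (vDeriv I' (fun y => vDeriv I' G y (c y)) x (b x))]
  ring

omit [FiniteDimensional ℂ E] [I.Boundaryless] in
theorem pullbackForm_id [IsManifold I ω N] (η : FormField I N) :
    pullbackForm (I := I) id η = η := by
  funext x
  refine LinearMap.ext₂ fun a b => ?_
  rw [pullbackForm_apply, mfderiv_id]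
  rfl

/-- The exterior derivative is tensorial. -/
theorem extD_eq_ptExtD [IsManifold I ω N] {η : FormField I N}
    (hη : IsHolForm I η) (halt : ∀ x a, η x a a = 0) {x : N}
    {a b c : ∀ y : N, TangentSpace I y}
    (ha : HolVFAt I a x) (hb : HolVFAt I b x) (hc : HolVFAt I c x) :
    extD I η a b c x = ptExtD η x (a x) (b x) (c x) := by
  have := extD_pullbackForm hη halt (g := id) (x := x) contMDiffAt_id ha hb hc
  rw [pullbackForm_id, mfderiv_id] at this
  exact this

theorem IsClosedForm.ptExtD_eq_zero [IsManifold I ω N] {η : FormField I N}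
    (hη : IsHolForm I η) (halt : ∀ x a, η x a a = 0) (hcl : IsClosedForm I η) (x : N)
    (u v w : TangentSpace I x) : ptExtD η x u v w = 0 := by
  have hc : ∀ u : TangentSpace I x, HolVFAt I (constField I x (u : E)) x :=
    holVFAt_constField_self x
  have := hcl x _ _ _ (hc u) (hc v) (hc w)
  rwa [extD_eq_ptExtD hη halt (hc u) (hc v) (hc w), constField_self, constField_self,
    constField_self] at this

theorem IsClosedForm.pullback [IsManifold I ω N] [IsManifold I' ω N'] {η : FormField I N}
    (hη : IsHolForm I η) (halt : ∀ x a, η x a a = 0) (hcl : IsClosedForm I η) {g : N' → N}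
    (hg : ContMDiff I' I ω g) : IsClosedForm I' (pullbackForm (I := I') g η) := by
  intro x a b c ha hb hc
  rw [extD_pullbackForm hη halt (hg x) ha hb hc, hcl.ptExtD_eq_zero hη halt]

omit [FiniteDimensional ℂ E] [I.Boundaryless] in
/-- The kernel of a closed form is involutive. -/
theorem IsClosedForm.isInvolutive_ker [IsManifold I ω N] {η : FormField I N}
    (hcl : IsClosedForm I η) (halt : ∀ x a, η x a a = 0)
    {D : ∀ x : N, Submodule ℂ (TangentSpace I x)}
    (hD : ∀ x a, a ∈ D x ↔ ∀ b, η x a b = 0) : IsInvolutive I D := by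
  intro U a b hU ha hb haD hbD x hx
  rw [hD]
  intro w
  set c := constField I x (w : E)
  have hc : HolVFAt I c x := holVFAt_constField_self x w
  have h := hcl x a b c (ha.holVFAt hU hx) (hb.holVFAt hU hx) hc
  have hd : ∀ {f : N → ℂ}, (∀ y ∈ U, f y = 0) → ∀ u : TangentSpace I x,
      dirDeriv I f x u = 0 := by
    intro f hf u
    have h1 : f =ᶠ[𝓝 x] fun _ => 0 := by
      filter_upwards [hU.mem_nhds hx] with y hy using hf y hy
    have h2 : vDeriv I f x u = 0 := by
      rw [vDeriv_congr h1, vDeriv, mfderiv_const]; rfl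
    exact h2
  have ha0 : ∀ y ∈ U, ∀ v, η y (a y) v = 0 := fun y hy => (hD y _).1 (haD y hy)
  have hb0 : ∀ y ∈ U, ∀ v, η y (b y) v = 0 := fun y hy => (hD y _).1 (hbD y hy)
  rw [extD, hd fun y hy => hb0 y hy _, hd fun y hy => ha0 y hy _, hd fun y hy => ha0 y hy _,
    form_swap halt x _ (b x), hb0 x hx, form_swap halt x _ (a x), ha0 x hx] at h
  have hcx : c x = w := constField_self x w
  rw [hcx] at h
  linear_combination -h

end Forms

/-! ### Holomorphic solutions of linear systems for vector fields -/

section Solve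

variable {E H N : Type*} [NormedAddCommGroup E] [NormedSpace ℂ E] [TopologicalSpace H]
  {I : ModelWithCorners ℂ E H} [TopologicalSpace N] [ChartedSpace H N]
  {E' H' N' : Type*} [NormedAddCommGroup E'] [NormedSpace ℂ E'] [TopologicalSpace H']
  {I' : ModelWithCorners ℂ E' H'} [TopologicalSpace N'] [ChartedSpace H' N']
  {F : Type*} [NormedAddCommGroup F] [NormedSpace ℂ F]
  [IsManifold I ω N] [IsManifold I' ω N']

/-- The lift of a holomorphic vector field along `f` by a connection on `f` is holomorphic. -/
theorem IsConnection.holVFAt [FiniteDimensional ℂ E'] {f : N → N'} {h : BundleMap I I' f}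
    (hh : IsConnection I I' f h) {w : ∀ y : N, TangentSpace I' (f y)} {x : N}
    (hw : HolAlongAt I I' f w x) : HolVFAt I (fun y => h y (w y)) x := by
  have hx := mem_chart_source H' (f x)
  obtain ⟨hf, hw⟩ := (holAlongAt_iff hx).1 hw
  have hmem : f ⁻¹' (chartAt H' (f x)).source ∈ 𝓝 x :=
    hf.continuousAt.preimage_mem_nhds ((chartAt H' (f x)).open_source.mem_nhds hx)
  set B := Module.finBasis ℂ E'
  have h1 : ∀ i, HolVFAt I (fun y => h y (constField I' (f x) (B i) (f y))) x := fun i =>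
    ContMDiffOn.contMDiffAt (hh.hol _ _ (chartAt H' (f x)).open_source
      fun z hz => (holVFAt_constField hz (B i)).contMDiffWithinAt) hmem
  have h2 : ∀ i, ContMDiffAt I 𝓘(ℂ, ℂ) ω
      (fun y => B.repr (vDeriv I' (extChartAt I' (f x)) (f y) (w y)) i) x := fun i =>
    ((B.coord i).toContinuousLinearMap.contDiff.contMDiff.contMDiffAt).comp x hw
  refine (HolVFAt.sum Finset.univ fun i _ => (h1 i).smul (h2 i)).congr ?_
  filter_upwards [hmem] with y hy
  have h3 := constField_vDeriv (I := I') (x₀ := f x) hy (w y)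
  conv_lhs => rw [← h3, constField_eq_sum B]
  simp

/-- A linear system for a tangent vector, which depends holomorphically on the point and is
uniquely solvable at `x`, is uniquely solvable near `x`, and its solution is holomorphic. -/
theorem exists_holVFAt_solution [FiniteDimensional ℂ E]
    (T : ∀ y : N, TangentSpace I y →ₗ[ℂ] F) {x : N}
    (hT : ∀ e : E, ContMDiffAt I 𝓘(ℂ, F) ω (fun y => T y (constField I x e y)) x)
    (hbij : Function.Bijective (T x)) {w : N → F} (hw : ContMDiffAt I 𝓘(ℂ, F) ω w x) :
    (∀ᶠ y in 𝓝 x, Function.Injective (T y)) ∧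
      ∃ ξ : ∀ y : N, TangentSpace I y, HolVFAt I ξ x ∧ ∀ᶠ y in 𝓝 x, T y (ξ y) = w y := by
  set B := Module.finBasis ℂ E
  set A : N → E →L[ℂ] F := fun y => ∑ i, (B.coord i).toContinuousLinearMap.smulRight
    (T y (constField I x (B i) y)) with hA
  have hAapp : ∀ y e, A y e = T y (constField I x e y) := by
    intro y e
    rw [constField_eq_sum B]
    simp [hA]
  have hAhol : ContMDiffAt I 𝓘(ℂ, E →L[ℂ] F) ω A x :=
    contMDiffAt_finsetSum fun i _ =>
      ((ContinuousLinearMap.smulRightL ℂ E F (B.coord i).toContinuousLinearMap).contDiff.contMDiff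
        |>.contMDiffAt).comp x (hT (B i))
  have hAx : ∀ e : E, A x e = T x e := fun e => by
    rw [hAapp]; exact congrArg (T x) (constField_self x e)
  have hAbij : Function.Bijective (A x : E →ₗ[ℂ] F) := by
    have : (A x : E → F) = T x := funext hAx
    exact this ▸ hbij
  have : FiniteDimensional ℂ F := (LinearEquiv.ofBijective _ hAbij).finiteDimensional
  set e₀ : E ≃L[ℂ] F := (LinearEquiv.ofBijective _ hAbij).toContinuousLinearEquiv
  have he₀ : (e₀ : E →L[ℂ] F) = A x := by ext e; rfl
  have hev : ∀ᶠ y in 𝓝 x, ∃ e : E ≃L[ℂ] F, (e : E →L[ℂ] F) = A y := by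
    have h1 := e₀.nhds
    rw [he₀] at h1
    exact hAhol.continuousAt.preimage_mem_nhds h1
  have : CompleteSpace E := FiniteDimensional.complete ℂ E
  have hinv : ContMDiffAt I 𝓘(ℂ, F →L[ℂ] E) ω (fun y => (A y).inverse) x := by
    have h1 := contDiffAt_map_inverse (𝕜 := ℂ) (n := ω) e₀
    rw [he₀] at h1
    exact h1.contMDiffAt.comp x hAhol
  refine ⟨?_, fun y => constField I x ((A y).inverse (w y)) y, ?_, ?_⟩
  · filter_upwards [hev, (chartAt H x).open_source.mem_nhds (mem_chart_source H x)]
      with y ⟨e, he⟩ hy u v huv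
    rw [← constField_vDeriv hy u, ← constField_vDeriv hy v, ← hAapp, ← hAapp, ← he] at huv
    have h2 := e.injective huv
    rw [← constField_vDeriv hy u, ← constField_vDeriv hy v, h2]
  · rw [holVFAt_iff_chartField (mem_chart_source H x)]
    refine (hinv.clm_apply hw).congr_of_eventuallyEq ?_
    filter_upwards [(chartAt H x).open_source.mem_nhds (mem_chart_source H x)] with y hy
    exact vDeriv_constField hy _
  · filter_upwards [hev] with y ⟨e, he⟩
    rw [← hAapp, ← he]
    simp

variable [I.Boundaryless] [I'.Boundaryless]

omit [I'.Boundaryless] in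
theorem contMDiffAt_vDeriv_constField {V : Type*} [NormedAddCommGroup V] [NormedSpace ℂ V]
    {G : N → V} {x : N} (hG : ContMDiffAt I 𝓘(ℂ, V) ω G x) (e : E) :
    ContMDiffAt I 𝓘(ℂ, V) ω (fun y => vDeriv I G y (constField I x e y)) x :=
  contMDiffAt_vDeriv_apply hG (holVFAt_constField (mem_chart_source H x) e)

omit [I'.Boundaryless] in
/-- A holomorphic vector field along a submersion `g` lifts locally to a holomorphic vector field,
with prescribed value at a point. -/
theorem exists_holVFAt_lift [FiniteDimensional ℂ E] {g : N → N'} {x : N}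
    (hg : ContMDiffAt I I' ω g x) (hsurj : Function.Surjective (mfderiv I I' g x))
    {w : ∀ y : N, TangentSpace I' (g y)} (hw : HolAlongAt I I' g w x) (ξ₀ : TangentSpace I x)
    (hξ₀ : mfderiv I I' g x ξ₀ = w x) :
    ∃ ξ : ∀ y : N, TangentSpace I y, HolVFAt I ξ x ∧ ξ x = ξ₀ ∧
      ∀ᶠ y in 𝓝 x, mfderiv I I' g y (ξ y) = w y := by
  have : IsManifold I' 1 N' := isManifold_one
  have hgx := mem_chart_source H' (g x)
  set G : N → E' := extChartAt I' (g x) ∘ g with hGdef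
  have hG : ContMDiffAt I 𝓘(ℂ, E') ω G x := contMDiffAt_extChartAt_comp hg
  have hGx : ∀ v : TangentSpace I x, vDeriv I G x v = mfderiv I I' g x v := fun v => by
    rw [hGdef, vDeriv_comp (mdifferentiableAt_extChartAt hgx) (hg.mdifferentiableAt (by simp)),
      vDeriv_extChartAt_self]
  let D : E →L[ℂ] E' := vDeriv I G x
  set K : Submodule ℂ E := D.toLinearMap.ker
  obtain ⟨P, hP⟩ := K.subtype.exists_leftInverse_of_injective (Submodule.ker_subtype K)
  have hPK : ∀ k : K, P k = k := fun k => LinearMap.congr_fun hP k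
  -- The lift is made unique by requiring its component `P` along the kernel `K` of `g_*` to be
  -- constant in the chart.
  set T : ∀ y : N, TangentSpace I y →ₗ[ℂ] E' × K := fun y =>
    (vDeriv I G y).toLinearMap.prod (P ∘ₗ (vDeriv I (extChartAt I x) y).toLinearMap) with hT
  have hTx : ∀ v : TangentSpace I x, T x v = (vDeriv I G x v, P (v : E)) := fun v => by
    have := vDeriv_extChartAt_self x v
    exact Prod.ext rfl (congrArg P this)
  have hhol : ∀ e : E, ContMDiffAt I 𝓘(ℂ, E' × K) ω (fun y => T y (constField I x e y)) x := by
    intro e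
    exact (contMDiffAt_vDeriv_constField hG e).prodMk_space
      ((P.toContinuousLinearMap.contDiff.contMDiff.contMDiffAt).comp x
        (contMDiffAt_vDeriv_constField contMDiffAt_extChartAt e))
  have hbij : Function.Bijective (T x) := by
    constructor
    · refine (injective_iff_map_eq_zero _).2 fun v hv => ?_
      rw [hTx] at hv
      have h1 : (v : E) ∈ K := congrArg Prod.fst hv
      have h2 := congrArg Prod.snd hv
      have h3 := hPK ⟨v, h1⟩
      exact congrArg Subtype.val (h3.symm.trans h2)
    · rintro ⟨u, k⟩
      obtain ⟨v, hv⟩ := hsurj u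
      refine ⟨v + (show TangentSpace I x from ((k - P (v : E) : K) : E)), ?_⟩
      have h1 : vDeriv I G x ((k - P (v : E) : K) : E) = 0 := (k - P (v : E) : K).2
      refine (hTx _).trans (Prod.ext ?_ ?_)
      · refine (map_add (vDeriv I G x) _ _).trans ?_
        rw [h1, hGx, hv, add_zero]
      · refine (map_add P _ _).trans ?_
        rw [hPK]; abel
  have hwT : ContMDiffAt I 𝓘(ℂ, E' × K) ω
      (fun y => (vDeriv I' (extChartAt I' (g x)) (g y) (w y), P (ξ₀ : E))) x :=
    ((holAlongAt_iff hgx).1 hw).2.prodMk_space contMDiffAt_const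
  obtain ⟨hinj, ξ, hξ, hξT⟩ := exists_holVFAt_solution T hhol hbij hwT
  refine ⟨ξ, hξ, ?_, ?_⟩
  · refine hinj.self_of_nhds ?_
    rw [hξT.self_of_nhds, hTx, hGx, hξ₀, vDeriv_extChartAt_self]
  · filter_upwards [hξT, eventually_vDeriv_extChartAt_comp hg,
      hg.continuousAt.preimage_mem_nhds ((chartAt H' (g x)).open_source.mem_nhds hgx)]
      with y hy hGy hys
    have h1 := congrArg Prod.fst hy
    have h2 : vDeriv I' (extChartAt I' (g x)) (g y) (mfderiv I I' g y (ξ y)) =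
        vDeriv I' (extChartAt I' (g x)) (g y) (w y) := (hGy (ξ y)).symm.trans h1
    rw [← constField_vDeriv (I := I') hys (w y), ← h2, constField_vDeriv hys]

omit [I'.Boundaryless] in
/-- Let `Θ` be a holomorphic form, nondegenerate on the kernel of the derivative of a submersion
`f`. A lift of a holomorphic vector field along `f` which lies in the kernel of `Θ` is
holomorphic. -/
theorem holVFAt_of_mem_ker [FiniteDimensional ℂ E] {Θ : FormField I N} (hΘ : IsHolForm I Θ)
    {f : N → N'} {x : N} (hf : ContMDiffAt I I' ω f x)
    (hsurj : Function.Surjective (mfderiv I I' f x))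
    (hnd : ∀ a, mfderiv I I' f x a = 0 → (∀ b, mfderiv I I' f x b = 0 → Θ x a b = 0) → a = 0)
    {w : ∀ y : N, TangentSpace I' (f y)} (hw : HolAlongAt I I' f w x)
    {κ : ∀ y : N, TangentSpace I y} (hκ : ∀ᶠ y in 𝓝 x, mfderiv I I' f y (κ y) = w y)
    (hκΘ : ∀ᶠ y in 𝓝 x, ∀ b, Θ y (κ y) b = 0) : HolVFAt I κ x := by
  have : IsManifold I' 1 N' := isManifold_one
  have hfx := mem_chart_source H' (f x)
  set G : N → E' := extChartAt I' (f x) ∘ f with hGdef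
  have hG : ContMDiffAt I 𝓘(ℂ, E') ω G x := contMDiffAt_extChartAt_comp hf
  have hGx : ∀ v : TangentSpace I x, vDeriv I G x v = mfderiv I I' f x v := fun v => by
    rw [hGdef, vDeriv_comp (mdifferentiableAt_extChartAt hfx) (hf.mdifferentiableAt (by simp)),
      vDeriv_extChartAt_self]
  let D : E →L[ℂ] E' := vDeriv I G x
  set K : Submodule ℂ E := D.toLinearMap.ker
  have hΘx := hΘ.contMDiffAt_coordForm (mem_chart_source H x)
  set R : (E →L[ℂ] ℂ) →L[ℂ] (K →L[ℂ] ℂ) :=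
    (ContinuousLinearMap.compL ℂ K E ℂ).flip K.subtypeL with hR
  -- The field `κ` solves the linear system `f_* κ = w`, `Θ(κ, ·)|_K = 0`, where `K` is the vertical
  -- tangent space at `x`, moved to nearby points by the chart.
  set T : ∀ y : N, TangentSpace I y →ₗ[ℂ] E' × (K →L[ℂ] ℂ) := fun y =>
    (vDeriv I G y).toLinearMap.prod ((R ∘L coordForm I Θ x y ∘L
      vDeriv I (extChartAt I x) y).toLinearMap) with hT
  have hT1 : ∀ y (v : TangentSpace I y), (T y v).1 = vDeriv I G y v := fun _ _ => rfl
  have hT2 : ∀ y (v : TangentSpace I y) (k : K), (T y v).2 k =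
      coordForm I Θ x y (vDeriv I (extChartAt I x) y v) k := fun _ _ _ => rfl
  have hT2x : ∀ (v : TangentSpace I x) (k : K), (T x v).2 k = Θ x v (k : E) := fun v k =>
    (congrArg (coordForm I Θ x x (vDeriv I (extChartAt I x) x v))
      (vDeriv_extChartAt_self (I := I) x (k : E)).symm).trans
      (coordForm_vDeriv Θ (mem_chart_source H x) v (k : E))
  have hhol : ∀ e : E, ContMDiffAt I 𝓘(ℂ, E' × (K →L[ℂ] ℂ)) ω
      (fun y => T y (constField I x e y)) x := by
    intro e
    refine (contMDiffAt_vDeriv_constField hG e).prodMk_space ?_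
    have h1 := (hΘx.clm_apply
      (contMDiffAt_vDeriv_constField (contMDiffAt_extChartAt (n := ω)) e)).clm_comp
      (contMDiffAt_const (c := K.subtypeL))
    exact h1
  have hbij : Function.Bijective (T x) := by
    have hinjx : Function.Injective (T x) := by
      refine (injective_iff_map_eq_zero _).2 fun v hv => hnd v ?_ fun b hb => ?_
      · rw [← hGx]; exact congrArg Prod.fst hv
      · have h1 : (b : E) ∈ K := (hGx b).trans hb
        rw [← hT2x v ⟨b, h1⟩, hv]; rfl
    refine ⟨hinjx, ?_⟩
    rintro ⟨u, φ⟩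
    obtain ⟨v, hv⟩ := hsurj u
    set S : K →ₗ[ℂ] (K →L[ℂ] ℂ) := LinearMap.snd ℂ E' _ ∘ₗ T x ∘ₗ K.subtype with hS
    have hSinj : Function.Injective S := by
      refine (injective_iff_map_eq_zero _).2 fun k hk => ?_
      have h1 : T x (k : E) = 0 := Prod.ext k.2 hk
      exact Subtype.ext ((injective_iff_map_eq_zero (T x)).1 hinjx _ h1)
    have hSsurj : Function.Surjective S := by
      have hdim : Module.finrank ℂ K = Module.finrank ℂ (K →L[ℂ] ℂ) := by
        rw [← (LinearMap.toContinuousLinearMap (𝕜 := ℂ) (E := K) (F' := ℂ)).finrank_eq]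
        exact (Subspace.dual_finrank_eq (K := ℂ) (V := K)).symm
      exact (LinearMap.injective_iff_surjective_of_finrank_eq_finrank hdim).1 hSinj
    obtain ⟨k, hk⟩ := hSsurj (φ - (T x v).2)
    refine ⟨v + (show TangentSpace I x from (k : E)), ?_⟩
    rw [map_add]
    refine Prod.ext ?_ ?_
    · have h1 : (T x (k : E)).1 = 0 := k.2
      refine (congrArg₂ (· + ·) ((hGx v).trans hv) h1).trans (add_zero _)
    · exact (congrArg ((T x v).2 + ·) hk).trans (by abel)
  have hwT : ContMDiffAt I 𝓘(ℂ, E' × (K →L[ℂ] ℂ)) ω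
      (fun y => (vDeriv I' (extChartAt I' (f x)) (f y) (w y), (0 : K →L[ℂ] ℂ))) x :=
    ((holAlongAt_iff hfx).1 hw).2.prodMk_space contMDiffAt_const
  obtain ⟨hinj, ξ, hξ, hξT⟩ := exists_holVFAt_solution T hhol hbij hwT
  refine hξ.congr ?_
  filter_upwards [hinj, hξT, hκ, hκΘ, eventually_vDeriv_extChartAt_comp hf,
    (chartAt H x).open_source.mem_nhds (mem_chart_source H x)]
    with y hiy hξy hκy hκΘy hGy hy
  refine hiy ?_
  rw [hξy]
  refine Prod.ext ?_ ?_
  · rw [hT1, hGdef, hGy, hκy]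
  · ext k
    rw [hT2, ← vDeriv_constField (I := I) hy (k : E), coordForm_vDeriv Θ hy, hκΘy]
    rfl

end Solve

/-! ### Brackets, involutive distributions and the vertical lift -/

theorem vDeriv_clm_comp {E H N V W : Type*} [NormedAddCommGroup E] [NormedSpace ℂ E]
    [TopologicalSpace H] {I : ModelWithCorners ℂ E H} [TopologicalSpace N] [ChartedSpace H N]
    [NormedAddCommGroup V] [NormedSpace ℂ V] [NormedAddCommGroup W] [NormedSpace ℂ W]
    (L : V →L[ℂ] W) {F : N → V} {x : N} (hF : MDifferentiableAt I 𝓘(ℂ, V) F x)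
    (w : TangentSpace I x) : vDeriv I (fun y => L (F y)) x w = L (vDeriv I F x w) := by
  have h1 := vDeriv_comp (V := W) (F := L) L.differentiableAt.mdifferentiableAt hF w
  have h2 : vDeriv 𝓘(ℂ, V) L (F x) = L := (mfderiv_eq_fderiv).trans L.fderiv
  exact h1.trans (congrArg (fun T : V →L[ℂ] W => T (vDeriv I F x w)) h2)

section Brackets

variable {E H N : Type*} [NormedAddCommGroup E] [NormedSpace ℂ E] [TopologicalSpace H]
  {I : ModelWithCorners ℂ E H} [TopologicalSpace N] [ChartedSpace H N]
  {E' H' N' : Type*} [NormedAddCommGroup E'] [NormedSpace ℂ E'] [TopologicalSpace H']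
  {I' : ModelWithCorners ℂ E' H'} [TopologicalSpace N'] [ChartedSpace H' N']
  [IsManifold I ω N] [IsManifold I' ω N']

theorem mlieBracket_add_left_of_holVFAt [CompleteSpace E]
    {a b c : ∀ y : N, TangentSpace I y} {x : N}
    (ha : HolVFAt I a x) (hb : HolVFAt I b x) :
    mlieBracket I (fun y => a y + b y) c x = mlieBracket I a c x + mlieBracket I b c x := by
  have : IsManifold I 1 N := isManifold_one
  have : IsManifold I 2 N := .of_le (n := ω) (by simp)
  exact mlieBracket_add_left (ContMDiffAt.mdifferentiableAt ha (by simp))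
    (ContMDiffAt.mdifferentiableAt hb (by simp))

theorem mlieBracket_add_right_of_holVFAt [CompleteSpace E]
    {a b c : ∀ y : N, TangentSpace I y} {x : N}
    (ha : HolVFAt I a x) (hb : HolVFAt I b x) :
    mlieBracket I c (fun y => a y + b y) x = mlieBracket I c a x + mlieBracket I c b x := by
  have : IsManifold I 1 N := isManifold_one
  have : IsManifold I 2 N := .of_le (n := ω) (by simp)
  exact mlieBracket_add_right (ContMDiffAt.mdifferentiableAt ha (by simp))
    (ContMDiffAt.mdifferentiableAt hb (by simp))

theorem mlieBracket_smul_left_of_holVFAt [CompleteSpace E] (t : ℂ)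
    {a c : ∀ y : N, TangentSpace I y} {x : N}
    (ha : HolVFAt I a x) :
    mlieBracket I (fun y => t • a y) c x = t • mlieBracket I a c x := by
  have : IsManifold I 1 N := isManifold_one
  exact mlieBracket_const_smul_left (ContMDiffAt.mdifferentiableAt ha (by simp))

theorem mlieBracket_smul_right_of_holVFAt [CompleteSpace E] (t : ℂ)
    {a c : ∀ y : N, TangentSpace I y} {x : N}
    (ha : HolVFAt I a x) :
    mlieBracket I c (fun y => t • a y) x = t • mlieBracket I c a x := by
  have : IsManifold I 1 N := isManifold_one
  exact mlieBracket_const_smul_right (ContMDiffAt.mdifferentiableAt ha (by simp))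

theorem IsInvolutive.mlieBracket_mem {D : ∀ x : N, Submodule ℂ (TangentSpace I x)}
    (hD : IsInvolutive I D) {a b : ∀ y : N, TangentSpace I y} {x : N}
    (ha : HolVFAt I a x) (hb : HolVFAt I b x) (haD : ∀ᶠ y in 𝓝 x, a y ∈ D y)
    (hbD : ∀ᶠ y in 𝓝 x, b y ∈ D y) : mlieBracket I a b x ∈ D x := by
  obtain ⟨U, hU, hUo, hxU⟩ := eventually_nhds_iff.1
    (ha.eventually.and (hb.eventually.and (haD.and hbD)))
  exact hD U a b hUo (fun y hy => (hU y hy).1.contMDiffWithinAt)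
    (fun y hy => (hU y hy).2.1.contMDiffWithinAt) (fun y hy => (hU y hy).2.2.1)
    (fun y hy => (hU y hy).2.2.2) x hxU

omit [IsManifold I ω N] in
theorem HolVFAt.comp_holAlongAt {a : ∀ y : N', TangentSpace I' y} {g : N → N'} {x : N}
    (ha : HolVFAt I' a (g x)) (hg : ContMDiffAt I I' ω g x) :
    HolAlongAt I I' g (fun y => a (g y)) x :=
  ContMDiffAt.comp x ha hg

end Brackets

section TotalSpace

variable {E M : Type*} [NormedAddCommGroup E] [NormedSpace ℂ E]
  [TopologicalSpace M] [ChartedSpace E M] [IsManifold 𝓘(ℂ, E) ω M]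

theorem contMDiff_proj_TX : ContMDiff 𝓘(ℂ, E).tangent 𝓘(ℂ, E) ω (proj : TX E M → M) :=
  contMDiff_proj _

/-- The chart of `X` at `x₀` is the chart of `M`, with its derivative on the fibres. -/
theorem extChartAt_TX (x₀ x : TX E M) (hx : proj x ∈ (chartAt E (proj x₀)).source) :
    extChartAt 𝓘(ℂ, E).tangent x₀ x =
      (extChartAt 𝓘(ℂ, E) (proj x₀) (proj x),
        vDeriv 𝓘(ℂ, E) (extChartAt 𝓘(ℂ, E) (proj x₀)) (proj x) x.2) := by
  rw [FiberBundle.extChartAt]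
  refine Prod.ext ?_ ?_
  · have := (trivializationAt E (TangentSpace 𝓘(ℂ, E)) (proj x₀)).coe_fst'
      (x := x) (by simpa using hx)
    exact congrArg (extChartAt 𝓘(ℂ, E) (proj x₀)) this
  · exact trivializationAt_snd_eq hx x.2

theorem contMDiff_fibreInclusion (m : M) :
    ContMDiff 𝓘(ℂ, E) 𝓘(ℂ, E).tangent ω (fun w : E => (⟨m, w⟩ : TX E M)) := by
  intro u
  refine contMDiffAt_totalSpace.2 ⟨contMDiffAt_const, ?_⟩
  let D : E →L[ℂ] E := vDeriv 𝓘(ℂ, E) (extChartAt 𝓘(ℂ, E) m) m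
  refine D.contDiff.contMDiff.contMDiffAt.congr_of_eventuallyEq (.of_forall fun w => ?_)
  exact trivializationAt_snd_eq (mem_chart_source E m) (x := m) w

/-- The vertical lift read in a chart. -/
theorem vDeriv_vlift (x₀ x : TX E M) (hx : proj x ∈ (chartAt E (proj x₀)).source)
    (w : TM E (proj x)) :
    vDeriv 𝓘(ℂ, E).tangent (extChartAt 𝓘(ℂ, E).tangent x₀) x (vlift x w) =
      (0, vDeriv 𝓘(ℂ, E) (extChartAt 𝓘(ℂ, E) (proj x₀)) (proj x) w) := by
  have : IsManifold 𝓘(ℂ, E).tangent 1 (TX E M) := isManifold_one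
  have h1 := vDeriv_comp (I := 𝓘(ℂ, E)) (I' := 𝓘(ℂ, E).tangent)
    (F := extChartAt 𝓘(ℂ, E).tangent x₀) (g := fun w : E => (⟨proj x, w⟩ : TX E M)) (x := x.2)
    (mdifferentiableAt_extChartAt (by simpa [TangentBundle.mem_chart_source_iff] using hx))
    ((contMDiff_fibreInclusion (proj x)).contMDiffAt.mdifferentiableAt (by simp)) w
  refine h1.symm.trans ?_
  let D : E →L[ℂ] E := vDeriv 𝓘(ℂ, E) (extChartAt 𝓘(ℂ, E) (proj x₀)) (proj x)
  have h2 : extChartAt 𝓘(ℂ, E).tangent x₀ ∘ (fun w : E => (⟨proj x, w⟩ : TX E M)) =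
      fun w : E => (extChartAt 𝓘(ℂ, E) (proj x₀) (proj x), D w) :=
    funext fun w => extChartAt_TX x₀ ⟨proj x, w⟩ hx
  have h3 : HasFDerivAt (fun w : E => (extChartAt 𝓘(ℂ, E) (proj x₀) (proj x), D w))
      ((0 : E →L[ℂ] E).prod D) x.2 := (hasFDerivAt_const _ _).prodMk D.hasFDerivAt
  rw [h2]
  have h4 : vDeriv 𝓘(ℂ, E) (fun w : E => (extChartAt 𝓘(ℂ, E) (proj x₀) (proj x), D w))
      (x.2 : E) = (0 : E →L[ℂ] E).prod D := (mfderiv_eq_fderiv).trans h3.fderiv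
  exact congrArg (fun T : E →L[ℂ] E × E => T w) h4

/-- The first component of a tangent vector to `X` read in a chart. -/
theorem vDeriv_fst_eq (x₀ x : TX E M) (hx : proj x ∈ (chartAt E (proj x₀)).source)
    (ξ : TTX x) :
    (vDeriv 𝓘(ℂ, E).tangent (extChartAt 𝓘(ℂ, E).tangent x₀) x ξ).1 =
      vDeriv 𝓘(ℂ, E) (extChartAt 𝓘(ℂ, E) (proj x₀)) (proj x) (projDeriv x ξ) := by
  have : IsManifold 𝓘(ℂ, E).tangent 1 (TX E M) := isManifold_one
  have : IsManifold 𝓘(ℂ, E) 1 M := isManifold_one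
  have hx' : x ∈ (chartAt (ModelProd E E) x₀).source := by
    simpa [TangentBundle.mem_chart_source_iff] using hx
  have h1 := vDeriv_clm_comp (I := 𝓘(ℂ, E).tangent) (ContinuousLinearMap.fst ℂ E E)
    (F := extChartAt 𝓘(ℂ, E).tangent x₀) (mdifferentiableAt_extChartAt hx') ξ
  have hp : MDifferentiableAt 𝓘(ℂ, E).tangent 𝓘(ℂ, E) (proj : TX E M → M) x :=
    contMDiff_proj_TX.contMDiffAt.mdifferentiableAt (by simp)
  have h2 := vDeriv_comp (F := extChartAt 𝓘(ℂ, E) (proj x₀))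
    (mdifferentiableAt_extChartAt hx) hp ξ
  have h3 : (fun y : TX E M => ContinuousLinearMap.fst ℂ E E (extChartAt 𝓘(ℂ, E).tangent x₀ y))
      =ᶠ[𝓝 x] extChartAt 𝓘(ℂ, E) (proj x₀) ∘ proj := by
    filter_upwards [hp.continuousAt.preimage_mem_nhds
      ((chartAt E (proj x₀)).open_source.mem_nhds hx)] with y hy
    exact congrArg Prod.fst (extChartAt_TX x₀ y hy)
  rw [vDeriv_congr h3] at h1
  exact h1.symm.trans h2

theorem projDeriv_vlift (x : TX E M) (w : TM E (proj x)) : projDeriv x (vlift x w) = 0 := by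
  have h1 := vDeriv_fst_eq x x (mem_chart_source E _) (vlift x w)
  rw [vDeriv_vlift x x (mem_chart_source E _)] at h1
  exact (vDeriv_extChartAt_self (I := 𝓘(ℂ, E)) (proj x) (projDeriv x (vlift x w))).symm.trans
    h1.symm

theorem vlift_injective (x : TX E M) : Function.Injective (vlift x) := by
  intro a b hab
  have h1 := congrArg (vDeriv 𝓘(ℂ, E).tangent (extChartAt 𝓘(ℂ, E).tangent x) x) hab
  rw [vDeriv_vlift x x (mem_chart_source E _), vDeriv_vlift x x (mem_chart_source E _),
    vDeriv_extChartAt_self, vDeriv_extChartAt_self] at h1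
  exact congrArg Prod.snd h1

theorem exists_vlift_eq (x : TX E M) {ξ : TTX x} (hξ : projDeriv x ξ = 0) :
    ∃ w, vlift x w = ξ := by
  have h1 := vDeriv_fst_eq x x (mem_chart_source E _) ξ
  rw [hξ, map_zero, vDeriv_extChartAt_self] at h1
  have h2 := vDeriv_vlift x x (mem_chart_source E _) (ξ : E × E).2
  rw [vDeriv_extChartAt_self] at h2
  refine ⟨(ξ : E × E).2, h2.trans (Prod.ext h1.symm ?_)⟩
  exact vDeriv_extChartAt_self (proj x) _

theorem vliftInv_vlift (x : TX E M) (w : TM E (proj x)) : vliftInv x (vlift x w) = w :=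
  LinearMap.leftInverse_apply_of_inj (LinearMap.ker_eq_bot.2 (vlift_injective x)) w

theorem vlift_vliftInv (x : TX E M) {ξ : TTX x} (hξ : projDeriv x ξ = 0) :
    vlift x (vliftInv x ξ) = ξ := by
  obtain ⟨w, rfl⟩ := exists_vlift_eq x hξ
  rw [vliftInv_vlift]

end TotalSpace

/-! ### The closed form `2iΩ_I` on `X` -/

section Splitting

variable {E M : Type*} [NormedAddCommGroup E] [NormedSpace ℂ E]
  [TopologicalSpace M] [ChartedSpace E M] [IsManifold 𝓘(ℂ, E) ω M]

/-- The vertical lift is holomorphic. -/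
theorem HolAlongAt.holVFAt_vlift {w : ∀ y : TX E M, TM E (proj y)} {x : TX E M}
    (hw : HolAlongAt 𝓘(ℂ, E).tangent 𝓘(ℂ, E) proj w x) :
    HolVFAt 𝓘(ℂ, E).tangent (fun y => vlift y (w y)) x := by
  have hx := mem_chart_source E (proj x)
  obtain ⟨hp, hw⟩ := (holAlongAt_iff hx).1 hw
  rw [holVFAt_iff_chartField (mem_chart_source (ModelProd E E) x)]
  refine ((contMDiffAt_const (c := (0 : E))).prodMk_space hw).congr_of_eventuallyEq ?_
  filter_upwards [hp.continuousAt.preimage_mem_nhds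
    ((chartAt E (proj x)).open_source.mem_nhds hx)] with y hy
  exact vDeriv_vlift x y hy (w y)

/-- The inverse of the vertical lift is holomorphic. -/
theorem HolAlongAt.of_holVFAt_vlift {w : ∀ y : TX E M, TM E (proj y)} {x : TX E M}
    (hw : HolVFAt 𝓘(ℂ, E).tangent (fun y => vlift y (w y)) x) :
    HolAlongAt 𝓘(ℂ, E).tangent 𝓘(ℂ, E) proj w x := by
  have hx := mem_chart_source E (proj x)
  have hp : ContMDiffAt 𝓘(ℂ, E).tangent 𝓘(ℂ, E) ω (proj : TX E M → M) x := contMDiff_proj_TX x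
  refine (holAlongAt_iff hx).2 ⟨hp, ?_⟩
  rw [holVFAt_iff_chartField (mem_chart_source (ModelProd E E) x)] at hw
  have h1 := (ContinuousLinearMap.snd ℂ E E).contDiff.contMDiff.contMDiffAt.comp (n := ω) x hw
  refine h1.congr_of_eventuallyEq ?_
  filter_upwards [hp.continuousAt.preimage_mem_nhds
    ((chartAt E (proj x)).open_source.mem_nhds hx)] with y hy
  exact (congrArg Prod.snd (vDeriv_vlift x y hy (w y))).symm

namespace PreJoyceStructure

variable (J : PreJoyceStructure E M)

theorem hor_h (x : TX E M) (a : TM E (proj x)) : hor x (J.h x a) = a := J.connection.section_eq x a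

theorem hor_vlift (x : TX E M) (a : TM E (proj x)) : hor x (vlift x a) = 0 := projDeriv_vlift x a

theorem ver_h (x : TX E M) (a : TM E (proj x)) : J.ver x (J.h x a) = 0 := by
  have h1 : projDeriv x (J.h x a) = a := J.hor_h x a
  simp [ver, h1]

theorem ver_vlift (x : TX E M) (a : TM E (proj x)) : J.ver x (vlift x a) = a := by
  simp [ver, projDeriv_vlift, vliftInv_vlift]

theorem vlift_ver (x : TX E M) (ξ : TTX x) : vlift x (J.ver x ξ) = ξ - J.h x (hor x ξ) := by
  refine vlift_vliftInv x ?_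
  have := J.hor_h x (projDeriv x ξ)
  simp only [hor] at this
  simp [this]

theorem h_hor_add_vlift_ver (x : TX E M) (ξ : TTX x) :
    J.h x (hor x ξ) + vlift x (J.ver x ξ) = ξ := by
  rw [vlift_ver]; abel

/-- The 2-form `2iΩ_I` on `X`, in terms of the components of tangent vectors. -/
noncomputable def twoIOmegaI : FormField 𝓘(ℂ, E).tangent (TX E M) := fun x =>
  -((J.symp (proj x)).compl₁₂ (hor x) (J.ver x) + (J.symp (proj x)).compl₁₂ (J.ver x) (hor x))

theorem twoIOmegaI_apply (x : TX E M) (ξ ζ : TTX x) : J.twoIOmegaI x ξ ζ =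
    -(J.symp (proj x) (hor x ξ) (J.ver x ζ) + J.symp (proj x) (J.ver x ξ) (hor x ζ)) := rfl

theorem symp_swap (m : M) (a b : TM E m) : J.symp m a b = -J.symp m b a :=
  form_swap J.isSymplectic.alt m a b

theorem twoIOmegaI_eq (x : TX E M) (ξ ζ : TTX x) :
    J.twoIOmegaI x ξ ζ = 2 * Complex.I * J.omegaI x ξ ζ := by
  simp only [omegaI, metric, opI, map_sub, map_smul, hor_h, hor_vlift, ver_h, ver_vlift,
    twoIOmegaI_apply, smul_zero, sub_zero, zero_sub, map_neg, LinearMap.smul_apply, smul_eq_mul]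
  rw [J.symp_swap _ (J.ver x ξ)]
  linear_combination (J.symp (proj x) (hor x ξ) (J.ver x ζ) -
    J.symp (proj x) (hor x ζ) (J.ver x ξ)) * (-1 : ℂ) * Complex.I_mul_I

theorem omegaMinus_eq (x : TX E M) (ξ ζ : TTX x) :
    J.omegaMinus x ξ ζ = J.symp (proj x) (J.ver x ξ) (J.ver x ζ) := by
  simp only [omegaMinus, metric, opJ, opK, map_sub, map_smul, map_add, map_neg, hor_h, hor_vlift,
    ver_h, ver_vlift, smul_zero, add_zero, neg_zero, zero_add, smul_add, smul_smul,
    LinearMap.smul_apply, LinearMap.sub_apply, smul_eq_mul, Complex.I_mul_I]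
  rw [J.symp_swap _ (hor x ζ) (hor x ξ)]
  ring

theorem twoIOmegaI_alt (x : TX E M) (ξ : TTX x) : J.twoIOmegaI x ξ ξ = 0 := by
  rw [twoIOmegaI_apply, J.symp_swap _ (J.ver x ξ)]
  ring

variable {J} [FiniteDimensional ℂ E]

omit [FiniteDimensional ℂ E] in
theorem holAlongAt_hor {x : TX E M} {ξ : ∀ y : TX E M, TTX y}
    (hξ : HolVFAt 𝓘(ℂ, E).tangent ξ x) :
    HolAlongAt 𝓘(ℂ, E).tangent 𝓘(ℂ, E) proj (fun y => hor y (ξ y)) x :=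
  hξ.mfderiv (contMDiff_proj_TX x)

variable (J) in
theorem holAlongAt_ver {x : TX E M} {ξ : ∀ y : TX E M, TTX y}
    (hξ : HolVFAt 𝓘(ℂ, E).tangent ξ x) :
    HolAlongAt 𝓘(ℂ, E).tangent 𝓘(ℂ, E) proj (fun y => J.ver y (ξ y)) x := by
  refine HolAlongAt.of_holVFAt_vlift ?_
  simp only [vlift_ver]
  exact hξ.sub (J.connection.holVFAt (holAlongAt_hor hξ))

variable (J) in
theorem isHolForm_twoIOmegaI : IsHolForm 𝓘(ℂ, E).tangent J.twoIOmegaI := fun _ _ _ ha hb =>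
  ((J.isSymplectic.isHolForm.contMDiffAt_along (holAlongAt_hor ha) (J.holAlongAt_ver hb)).add
    (J.isSymplectic.isHolForm.contMDiffAt_along (J.holAlongAt_ver ha) (holAlongAt_hor hb))).neg

section Brackets

variable {U W Z : ∀ m : M, TM E m} {x : TX E M}

omit [FiniteDimensional ℂ E] in
theorem holVFAt_vlift_proj (hU : HolVFAt 𝓘(ℂ, E) U (proj x)) :
    HolVFAt 𝓘(ℂ, E).tangent (fun y => vlift y (U (proj y))) x :=
  (hU.comp_holAlongAt (contMDiff_proj_TX x)).holVFAt_vlift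

variable (J) in
theorem holVFAt_h_proj (hU : HolVFAt 𝓘(ℂ, E) U (proj x)) :
    HolVFAt 𝓘(ℂ, E).tangent (fun y => J.h y (U (proj y))) x :=
  J.connection.holVFAt (hU.comp_holAlongAt (contMDiff_proj_TX x))

variable (J) in
/-- The lifts by `h_ε`, `ε⁻¹ = t`, of commuting vector fields commute: their bracket is in `im(h_ε)`
by flatness, and it is annihilated by `π_*`. -/
theorem mlieBracket_hEps_eq_zero (hU : HolVFAt 𝓘(ℂ, E) U (proj x))
    (hW : HolVFAt 𝓘(ℂ, E) W (proj x)) (h0 : mlieBracket 𝓘(ℂ, E) U W (proj x) = 0)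
    {t : ℂ} (ht : t ≠ 0) :
    mlieBracket 𝓘(ℂ, E).tangent (fun y => J.h y (U (proj y)) + t • vlift y (U (proj y)))
      (fun y => J.h y (W (proj y)) + t • vlift y (W (proj y))) x = 0 := by
  have hol : ∀ {U : ∀ m : M, TM E m}, HolVFAt 𝓘(ℂ, E) U (proj x) →
      HolVFAt 𝓘(ℂ, E).tangent (fun y => J.h y (U (proj y)) + t • vlift y (U (proj y))) x :=
    fun hU => (J.holVFAt_h_proj hU).add ((holVFAt_vlift_proj hU).const_smul t)
  have hpr : ∀ (y : TX E M) (u : TM E (proj y)), hor y (J.h y u + t • vlift y u) = u := by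
    intro y u
    simp [hor_h, hor_vlift]
  have h1 := mfderiv_mlieBracket_of_related (contMDiff_proj_TX x) (hol hU) (hol hW) hU hW
    (.of_forall fun y => hpr y _) (.of_forall fun y => hpr y _)
  have h2 : ∀ (y : TX E M) (u : TM E (proj y)),
      J.h y u + t • vlift y u = hEps J.h t⁻¹ y u := by
    intro y u
    simp [hEps]
  have h3 := (J.flat t⁻¹ (inv_ne_zero ht)).mlieBracket_mem (hol hU) (hol hW)
    (.of_forall fun y => ⟨U (proj y), (h2 y _).symm⟩)
    (.of_forall fun y => ⟨W (proj y), (h2 y _).symm⟩)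
  obtain ⟨u, hu⟩ := h3
  rw [← hu, ← h2] at h1 ⊢
  have h4 := (hpr x u).symm.trans (h1.trans h0)
  rw [h4, map_zero, map_zero, smul_zero, add_zero]

variable (J) in
/-- For commuting `U` and `W` the coefficients of the powers of `t` in
`[h(U) + t v(U), h(W) + t v(W)] = 0` vanish. -/
theorem mlieBracket_lifts (hU : HolVFAt 𝓘(ℂ, E) U (proj x))
    (hW : HolVFAt 𝓘(ℂ, E) W (proj x)) (h0 : mlieBracket 𝓘(ℂ, E) U W (proj x) = 0) :
    mlieBracket 𝓘(ℂ, E).tangent (fun y => J.h y (U (proj y))) (fun y => J.h y (W (proj y))) x = 0 ∧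
    mlieBracket 𝓘(ℂ, E).tangent (fun y => J.h y (U (proj y)))
        (fun y => vlift y (W (proj y))) x +
      mlieBracket 𝓘(ℂ, E).tangent (fun y => vlift y (U (proj y)))
        (fun y => J.h y (W (proj y))) x = 0 ∧
    mlieBracket 𝓘(ℂ, E).tangent (fun y => vlift y (U (proj y)))
      (fun y => vlift y (W (proj y))) x = 0 := by
  have hHU := J.holVFAt_h_proj hU
  have hHW := J.holVFAt_h_proj hW
  have hVU := holVFAt_vlift_proj hU
  have hVW := holVFAt_vlift_proj hW
  have key : ∀ t : ℂ, t ≠ 0 → _ := fun t ht => J.mlieBracket_hEps_eq_zero hU hW h0 ht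
  have : FiniteDimensional ℂ (E × E) := inferInstance
  have : CompleteSpace (E × E) := FiniteDimensional.complete ℂ _
  set A := mlieBracket 𝓘(ℂ, E).tangent (fun y => J.h y (U (proj y)))
    (fun y => J.h y (W (proj y))) x
  set B₁ := mlieBracket 𝓘(ℂ, E).tangent (fun y => J.h y (U (proj y)))
    (fun y => vlift y (W (proj y))) x
  set B₂ := mlieBracket 𝓘(ℂ, E).tangent (fun y => vlift y (U (proj y)))
    (fun y => J.h y (W (proj y))) x
  set C := mlieBracket 𝓘(ℂ, E).tangent (fun y => vlift y (U (proj y)))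
    (fun y => vlift y (W (proj y))) x
  have key' : ∀ t : ℂ, t ≠ 0 → A + t • (B₁ + B₂) + (t * t) • C = 0 := by
    intro t ht
    have := key t ht
    rw [mlieBracket_add_left_of_holVFAt hHU (hVU.const_smul t),
      mlieBracket_add_right_of_holVFAt hHW (hVW.const_smul t),
      mlieBracket_add_right_of_holVFAt hHW (hVW.const_smul t),
      mlieBracket_smul_left_of_holVFAt t hVU, mlieBracket_smul_left_of_holVFAt t hVU,
      mlieBracket_smul_right_of_holVFAt t hVW, mlieBracket_smul_right_of_holVFAt t hVW] at this
    rw [← this]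
    module
  -- A polynomial of degree `2` in `t` with three zeros has zero coefficients.
  have k1 := key' 1 one_ne_zero
  have k2 := key' (-1) (by norm_num)
  have k3 := key' 2 two_ne_zero
  have hC : C = 0 := by
    have : (3 : ℂ) • C = 0 := by
      linear_combination (norm := module) k3 + ((1 : ℂ)/2) • k2 - ((3 : ℂ)/2) • k1
    exact (smul_eq_zero.1 this).resolve_left (by norm_num)
  have hB : B₁ + B₂ = 0 := by
    have : (2 : ℂ) • (B₁ + B₂) = 0 := by
      linear_combination (norm := module) k1 - k2
    exact (smul_eq_zero.1 this).resolve_left (by norm_num)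
  rw [hB, hC] at k1
  exact ⟨by simpa using k1, hB, hC⟩

/-- The component `N(U, W)` of the bracket `[h(U), v(W)]`, which is vertical when `U` and `W`
commute. -/
noncomputable def bracketVer (J : PreJoyceStructure E M) (x : TX E M) (U W : ∀ m : M, TM E m) :
    TM E (proj x) :=
  vliftInv x (mlieBracket 𝓘(ℂ, E).tangent (fun y => J.h y (U (proj y)))
    (fun y => vlift y (W (proj y))) x)

theorem vlift_bracketVer (hU : HolVFAt 𝓘(ℂ, E) U (proj x))
    (hW : HolVFAt 𝓘(ℂ, E) W (proj x)) :
    vlift x (J.bracketVer x U W) = mlieBracket 𝓘(ℂ, E).tangent (fun y => J.h y (U (proj y)))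
      (fun y => vlift y (W (proj y))) x := by
  refine vlift_vliftInv x ?_
  have := mfderiv_mlieBracket_of_related (contMDiff_proj_TX x) (J.holVFAt_h_proj hU)
    (holVFAt_vlift_proj hW) hU (holVFAt_zero _)
    (.of_forall fun y => J.hor_h y _) (.of_forall fun y => hor_vlift y _)
  refine this.trans ?_
  exact congrFun mlieBracket_zero_right (proj x)

/-- The coefficient of `t` in the flatness condition says that `N(U, W)` is symmetric. -/
theorem bracketVer_comm (hU : HolVFAt 𝓘(ℂ, E) U (proj x))
    (hW : HolVFAt 𝓘(ℂ, E) W (proj x)) (h0 : mlieBracket 𝓘(ℂ, E) U W (proj x) = 0) :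
    J.bracketVer x U W = J.bracketVer x W U := by
  refine vlift_injective x ?_
  rw [vlift_bracketVer hU hW, vlift_bracketVer hW hU]
  have h1 : mlieBracket 𝓘(ℂ, E).tangent (fun y => J.h y (W (proj y)))
      (fun y => vlift y (U (proj y))) x = -mlieBracket 𝓘(ℂ, E).tangent
        (fun y => vlift y (U (proj y))) (fun y => J.h y (W (proj y))) x :=
    mlieBracket_swap_apply
  exact (eq_neg_of_add_eq_zero_left (J.mlieBracket_lifts hU hW h0).2.1).trans h1.symm

omit [FiniteDimensional ℂ E] in
theorem mem_vertical_proj {x : TX E M} {ξ : TTX x} :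
    ξ ∈ vertical 𝓘(ℂ, E).tangent 𝓘(ℂ, E) proj x ↔ hor x ξ = 0 := Iff.rfl

omit [FiniteDimensional ℂ E] in
theorem relEval_fibreForm (η : FormField 𝓘(ℂ, E) M) {x : TX E M} {ξ ζ : TTX x}
    (hξ : hor x ξ = 0) (hζ : hor x ζ = 0) :
    relEval 𝓘(ℂ, E).tangent 𝓘(ℂ, E) (fibreForm η) x ξ ζ =
      η (proj x) (vliftInv x ξ) (vliftInv x ζ) := by
  rw [relEval, dif_pos ⟨mem_vertical_proj.2 hξ, mem_vertical_proj.2 hζ⟩]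
  rfl

omit [FiniteDimensional ℂ E] in
theorem relEval_fibreForm_vlift (η : FormField 𝓘(ℂ, E) M) (x : TX E M) (a b : TM E (proj x)) :
    relEval 𝓘(ℂ, E).tangent 𝓘(ℂ, E) (fibreForm η) x (vlift x a) (vlift x b) =
      η (proj x) a b := by
  rw [relEval_fibreForm η (hor_vlift x a) (hor_vlift x b), vliftInv_vlift, vliftInv_vlift]

theorem mlieBracket_hEps_one (hU : HolVFAt 𝓘(ℂ, E) U (proj x))
    (hW : HolVFAt 𝓘(ℂ, E) W (proj x)) (hUW : mlieBracket 𝓘(ℂ, E) U W (proj x) = 0) :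
    mlieBracket 𝓘(ℂ, E).tangent (fun y => hEps J.h 1 y (U (proj y)))
      (fun y => vlift y (W (proj y))) x = vlift x (J.bracketVer x U W) := by
  have : FiniteDimensional ℂ (E × E) := inferInstance
  have : CompleteSpace (E × E) := FiniteDimensional.complete ℂ _
  have h1 : (fun y => hEps J.h 1 y (U (proj y))) =
      fun y => J.h y (U (proj y)) + vlift y (U (proj y)) := by
    funext y
    simp [hEps]
  rw [h1, mlieBracket_add_left_of_holVFAt (J.holVFAt_h_proj hU) (holVFAt_vlift_proj hU),
    (J.mlieBracket_lifts hU hW hUW).2.2, add_zero, vlift_bracketVer hU hW]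

omit [FiniteDimensional ℂ E] in
theorem dirDeriv_comp_proj {F : M → ℂ} (hF : MDifferentiableAt 𝓘(ℂ, E) 𝓘(ℂ, ℂ) F (proj x))
    (ξ : TTX x) : dirDeriv 𝓘(ℂ, E).tangent (fun y : TX E M => F (proj y)) x ξ =
      dirDeriv 𝓘(ℂ, E) F (proj x) (hor x ξ) :=
  vDeriv_comp (F := F) hF ((contMDiff_proj_TX x).mdifferentiableAt (by simp)) ξ

/-- The condition that `h_1` preserves the relative symplectic form, in terms of commuting vector
fields: `U(ω(W, Z)) = ω(N(U, W), Z) + ω(W, N(U, Z))`. -/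
theorem dirDeriv_symp (J : PreJoyceStructure E M) (hU : HolVFAt 𝓘(ℂ, E) U (proj x))
    (hW : HolVFAt 𝓘(ℂ, E) W (proj x)) (hZ : HolVFAt 𝓘(ℂ, E) Z (proj x))
    (hUW : mlieBracket 𝓘(ℂ, E) U W (proj x) = 0) (hUZ : mlieBracket 𝓘(ℂ, E) U Z (proj x) = 0) :
    dirDeriv 𝓘(ℂ, E) (fun m => J.symp m (W m) (Z m)) (proj x) (U (proj x)) =
      J.symp (proj x) (J.bracketVer x U W) (Z (proj x)) +
        J.symp (proj x) (W (proj x)) (J.bracketVer x U Z) := by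
  obtain ⟨S, hS, hSo, hxS⟩ := eventually_nhds_iff.1
    (hU.eventually.and (hW.eventually.and hZ.eventually))
  have hp : Continuous (proj : TX E M → M) := contMDiff_proj_TX.continuous
  have h1 := J.symplectic 1 one_ne_zero S U (proj ⁻¹' S) (fun y => vlift y (W (proj y)))
    (fun y => vlift y (Z (proj y))) hSo (fun m hm => (hS m hm).1.contMDiffWithinAt)
    (hSo.preimage hp) le_rfl
    ⟨fun y hy => (holVFAt_vlift_proj (hS _ hy).2.1).contMDiffWithinAt,
      fun y _ => hor_vlift y _⟩
    ⟨fun y hy => (holVFAt_vlift_proj (hS _ hy).2.2).contMDiffWithinAt,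
      fun y _ => hor_vlift y _⟩ x hxS
  simp only [relEval_fibreForm_vlift] at h1
  rw [mlieBracket_hEps_one hU hW hUW, mlieBracket_hEps_one hU hZ hUZ, relEval_fibreForm_vlift,
    relEval_fibreForm_vlift, dirDeriv_comp_proj (F := fun m => J.symp m (W m) (Z m))
      ((J.isSymplectic.isHolForm _ _ _ hW hZ).mdifferentiableAt (by simp))] at h1
  have h2 : hor x (hEps J.h 1 x (U (proj x))) = U (proj x) := by
    simp [hEps, hor_h, hor_vlift]
  rwa [h2] at h1

end Brackets

omit [FiniteDimensional ℂ E] [IsManifold 𝓘(ℂ, E) ω M] in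
theorem dirDeriv_neg_add {F G : M → ℂ} {m : M} (hF : MDifferentiableAt 𝓘(ℂ, E) 𝓘(ℂ, ℂ) F m)
    (hG : MDifferentiableAt 𝓘(ℂ, E) 𝓘(ℂ, ℂ) G m) (u : TM E m) :
    dirDeriv 𝓘(ℂ, E) (fun m => -(F m + G m)) m u =
      -(dirDeriv 𝓘(ℂ, E) F m u + dirDeriv 𝓘(ℂ, E) G m u) :=
  congrArg (fun T : E →L[ℂ] ℂ => T u) (hF.hasMFDerivAt.add hG.hasMFDerivAt).neg.mfderiv

/-- The form `2iΩ_I` is closed. On lifts of constant fields its exterior derivative is a combination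
of terms `ω(N(·, ·), ·)`, which cancel because `N` is symmetric and `ω` is alternating. -/
theorem isClosedForm_twoIOmegaI (J : PreJoyceStructure E M) :
    IsClosedForm 𝓘(ℂ, E).tangent J.twoIOmegaI := by
  have : FiniteDimensional ℂ (E × E) := inferInstance
  have : CompleteSpace (E × E) := FiniteDimensional.complete ℂ _
  intro x a b c ha hb hc
  -- By tensoriality it is enough to consider lifts of fields which are constant in a chart.
  set K : TM E (proj x) → ∀ m : M, TM E m := fun u => constField 𝓘(ℂ, E) (proj x) (u : E) with hK
  have hKh : ∀ u, HolVFAt 𝓘(ℂ, E) (K u) (proj x) := fun u => holVFAt_constField_self _ u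
  have hKx : ∀ u, K u (proj x) = u := fun u => constField_self _ u
  have hKK : ∀ u w, mlieBracket 𝓘(ℂ, E) (K u) (K w) (proj x) = 0 := fun u w =>
    mlieBracket_constField (E := E) (mem_chart_source E (proj x)) u w
  set A : TTX x → ∀ y : TX E M, TTX y := fun ξ y =>
    J.h y (K (hor x ξ) (proj y)) + vlift y (K (J.ver x ξ) (proj y)) with hA
  have hAh : ∀ ξ, HolVFAt 𝓘(ℂ, E).tangent (A ξ) x := fun ξ =>
    (J.holVFAt_h_proj (hKh _)).add (holVFAt_vlift_proj (hKh _))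
  have hAx : ∀ ξ, A ξ x = ξ := fun ξ => by
    simp only [hA, hKx]
    exact J.h_hor_add_vlift_ver x ξ
  have hhor : ∀ ξ y, hor y (A ξ y) = K (hor x ξ) (proj y) := fun ξ y => by
    simp [hA, hor_h, hor_vlift]
  have hver : ∀ ξ y, J.ver y (A ξ y) = K (J.ver x ξ) (proj y) := fun ξ y => by
    simp [hA, ver_h, ver_vlift]
  rw [extD_eq_ptExtD J.isHolForm_twoIOmegaI J.twoIOmegaI_alt ha hb hc, ← hAx (a x), ← hAx (b x),
    ← hAx (c x), ← extD_eq_ptExtD J.isHolForm_twoIOmegaI J.twoIOmegaI_alt (hAh _) (hAh _) (hAh _)]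
  generalize a x = ξ₁
  generalize b x = ξ₂
  generalize c x = ξ₃
  set n : TM E (proj x) → TM E (proj x) → TM E (proj x) := fun u w =>
    J.bracketVer x (K u) (K w) with hn
  have hnc : ∀ u w, n u w = n w u := fun u w => bracketVer_comm (hKh u) (hKh w) (hKK u w)
  have hbr : ∀ ξ ζ, mlieBracket 𝓘(ℂ, E).tangent (A ξ) (A ζ) x =
      vlift x (n (hor x ξ) (J.ver x ζ) - n (hor x ζ) (J.ver x ξ)) := by
    intro ξ ζ
    have e1 := J.mlieBracket_lifts (hKh (hor x ξ)) (hKh (hor x ζ)) (hKK _ _)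
    have e2 := J.mlieBracket_lifts (hKh (J.ver x ξ)) (hKh (J.ver x ζ)) (hKK _ _)
    have v1 := vlift_bracketVer (J := J) (hKh (hor x ξ)) (hKh (J.ver x ζ))
    have v2 := vlift_bracketVer (J := J) (hKh (hor x ζ)) (hKh (J.ver x ξ))
    have v3 := mlieBracket_swap_apply (I := 𝓘(ℂ, E).tangent) (M := TX E M) (x := x)
      (V := fun y => vlift y (K (J.ver x ξ) (proj y)))
      (W := fun y => J.h y (K (hor x ζ) (proj y)))
    have e4 : vlift x (n (hor x ξ) (J.ver x ζ) - n (hor x ζ) (J.ver x ξ)) =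
        vlift x (J.bracketVer x (K (hor x ξ)) (K (J.ver x ζ))) -
          vlift x (J.bracketVer x (K (hor x ζ)) (K (J.ver x ξ))) := map_sub _ _ _
    have H := fun u => J.holVFAt_h_proj (hKh u)
    have V := fun u => holVFAt_vlift_proj (hKh u)
    rw [hA, mlieBracket_add_left_of_holVFAt (H _) (V _),
      mlieBracket_add_right_of_holVFAt (H _) (V _), mlieBracket_add_right_of_holVFAt (H _) (V _),
      e1.1, e2.2.2, e4, v1, v2, v3, zero_add, add_zero, sub_eq_add_neg]
  have hd : ∀ u w z, dirDeriv 𝓘(ℂ, E) (fun m => J.symp m (K w m) (K z m)) (proj x) u =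
      J.symp (proj x) (n u w) z + J.symp (proj x) w (n u z) := by
    intro u w z
    have := dirDeriv_symp J (hKh u) (hKh w) (hKh z) (hKK _ _) (hKK _ _)
    simpa only [hKx] using this
  have hD : ∀ ξ ζ χ : TTX x,
      dirDeriv 𝓘(ℂ, E).tangent (fun y => J.twoIOmegaI y (A ζ y) (A χ y)) x (A ξ x) =
        -(J.symp (proj x) (n (hor x ξ) (hor x ζ)) (J.ver x χ) +
          J.symp (proj x) (hor x ζ) (n (hor x ξ) (J.ver x χ)) +
          (J.symp (proj x) (n (hor x ξ) (J.ver x ζ)) (hor x χ) +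
          J.symp (proj x) (J.ver x ζ) (n (hor x ξ) (hor x χ)))) := by
    intro ξ ζ χ
    have hF := fun w z => (J.isSymplectic.isHolForm _ _ _ (hKh w) (hKh z)).mdifferentiableAt
      (n := ω) (by simp)
    simp only [twoIOmegaI_apply, hhor, hver]
    have e1 := dirDeriv_comp_proj (x := x) (F := fun m =>
      -(J.symp m (K (hor x ζ) m) (K (J.ver x χ) m) + J.symp m (K (J.ver x ζ) m) (K (hor x χ) m)))
      ((hF _ _).add (hF _ _)).neg (A ξ x)
    refine e1.trans ?_
    rw [dirDeriv_neg_add (hF _ _) (hF _ _), hhor, hd, hd]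
    simp only [hKx]
  simp only [extD, hD]
  simp only [hbr, twoIOmegaI_apply, hhor, hver, hKx, hor_vlift, ver_vlift, map_sub,
    LinearMap.sub_apply, map_zero, LinearMap.zero_apply]
  rw [hnc (hor x ξ₂) (hor x ξ₁), hnc (hor x ξ₃) (hor x ξ₁), hnc (hor x ξ₃) (hor x ξ₂),
    J.symp_swap _ (hor x ξ₂) (n (hor x ξ₁) (J.ver x ξ₃)),
    J.symp_swap _ (J.ver x ξ₂) (n (hor x ξ₁) (hor x ξ₃)),
    J.symp_swap _ (hor x ξ₁) (n (hor x ξ₂) (J.ver x ξ₃)),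
    J.symp_swap _ (hor x ξ₁) (n (hor x ξ₃) (J.ver x ξ₂))]
  ring

end PreJoyceStructure

end Splitting

/-! ### Submanifolds which are unions of leaves -/

section Saturation

/-- The velocity of a curve in the image of an immersion, which leaves the point `G a` along images
of points tending to `a`, is in the image of the derivative. -/
theorem mem_range_of_hasDerivAt {V W : Type*} [NormedAddCommGroup V] [NormedSpace ℂ V]
    [FiniteDimensional ℂ V] [NormedAddCommGroup W] [NormedSpace ℂ W] [FiniteDimensional ℂ W]
    {G : V → W} {A : V →L[ℂ] W} {a : V} (hG : HasFDerivAt G A a) (hA : Function.Injective A)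
    {α : ℝ → W} {v : W} (hα : HasDerivAt α v 0) (h0 : α 0 = G a) {p : ℝ → V}
    (hp : Tendsto p (𝓝[>] 0) (𝓝 a)) (hpα : ∀ᶠ s in 𝓝[>] 0, G (p s) = α s) :
    v ∈ LinearMap.range A.toLinearMap := by
  by_contra hv
  -- A linear functional `P` which vanishes on the image of `A` but not at `v` would grow linearly
  -- along `α`, whereas `P (G (p s) - G a)` is `o(p s - a)`, hence `o(s)`.
  obtain ⟨P, hPv, hPA⟩ := Submodule.exists_le_ker_of_notMem hv
  obtain ⟨C, -, hC⟩ := A.toLinearMap.exists_antilipschitzWith (LinearMap.ker_eq_bot.2 hA)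
  have hO : (fun z => z - a) =O[𝓝 a] fun z => A (z - a) :=
    Asymptotics.IsBigO.of_bound C (.of_forall fun z => by
      have := hC.le_mul_dist (z - a) 0
      rwa [map_zero, dist_zero_right, dist_zero_right] at this)
  have hE : Asymptotics.IsEquivalent (𝓝 a) (fun z => G z - G a) fun z => A (z - a) :=
    hG.isLittleO.trans_isBigO hO
  have h1 := (hG.isLittleO.trans_isBigO (hO.trans hE.isBigO_symm)).comp_tendsto hp
  have h2 : (fun s => α s - α 0 - s • v) =o[𝓝[>] 0] fun s : ℝ => s := by
    have := hα.isLittleO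
    simp only [sub_zero] at this
    exact this.mono nhdsWithin_le_nhds
  have h3 : (fun s => α s - α 0) =O[𝓝[>] 0] fun s : ℝ => s := by
    have := hα.hasFDerivAt.isBigO_sub
    simp only [sub_zero] at this
    exact this.mono nhdsWithin_le_nhds
  have h4 : (fun s => α s - α 0 - A (p s - a)) =o[𝓝[>] 0] fun s : ℝ => s := by
    refine (h1.congr' (hpα.mono fun s hs => ?_) (hpα.mono fun s hs => ?_)).trans_isBigO h3
    · simp only [Function.comp, hs, h0]
    · simp only [Function.comp, hs, h0]
  have h5 : (fun s : ℝ => s • P v) =o[𝓝[>] 0] fun s : ℝ => s := by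
    have := ((LinearMap.toContinuousLinearMap P).isBigO_comp _ (𝓝[>] 0)).trans_isLittleO
      (h4.sub h2)
    refine this.congr_left fun s => ?_
    have h6 : P (A (p s - a)) = 0 := hPA ⟨p s - a, rfl⟩
    have h7 : P (s • v) = s • P v := (P.restrictScalars ℝ).map_smul s v
    simp only [LinearMap.coe_toContinuousLinearMap', sub_sub_sub_cancel_left, map_sub P, h6, h7,
      sub_zero]
  have h8 := h5.def (half_pos (norm_pos_iff.2 hPv))
  obtain ⟨s, hs, hs0⟩ := (h8.and self_mem_nhdsWithin).exists
  have hs0' : 0 < ‖s‖ := norm_pos_iff.2 (ne_of_gt hs0)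
  rw [norm_smul] at hs
  nlinarith [mul_pos hs0' (norm_pos_iff.2 hPv)]

variable {E H N : Type*} [NormedAddCommGroup E] [NormedSpace ℂ E] [TopologicalSpace H]
  {I : ModelWithCorners ℂ E H} [TopologicalSpace N] [ChartedSpace H N]
  {E' H' N' : Type*} [NormedAddCommGroup E'] [NormedSpace ℂ E'] [TopologicalSpace H']
  {I' : ModelWithCorners ℂ E' H'} [TopologicalSpace N'] [ChartedSpace H' N']
  [IsManifold I ω N] [IsManifold I' ω N'] [I.Boundaryless] [I'.Boundaryless]

/-- A holomorphic vector field has an integral curve through any point, in real time. -/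
theorem exists_integralCurve [CompleteSpace E] {ξ : ∀ y : N, TangentSpace I y} {x : N}
    (hξ : HolVFAt I ξ x) :
    ∃ γ : ℝ → N, γ 0 = x ∧ HasDerivAt (fun t => extChartAt I x (γ t)) (ξ x : E) 0 ∧
      ∀ᶠ t in 𝓝 0, HasVelocityAt I γ t (ξ (γ t)) := by
  have hx := mem_chart_source H x
  set φ := extChartAt I x with hφ
  have hf : ContDiffAt ℝ 1 (chartField I x ξ ∘ φ.symm) (φ x) :=
    ((contDiffAt_comp_symm hx ((holVFAt_iff_chartField hx).1 hξ)).of_le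
      (by simp)).restrict_scalars ℝ
  obtain ⟨α, hα0, ε, hε, hα⟩ :=
    hf.exists_forall_mem_closedBall_exists_eq_forall_mem_Ioo_hasDerivAt₀ 0
  have hα' : ∀ᶠ t in 𝓝 (0 : ℝ), HasDerivAt α ((chartField I x ξ ∘ φ.symm) (α t)) t := by
    filter_upwards [Ioo_mem_nhds (show 0 - ε < 0 by linarith) (show 0 < 0 + ε by linarith)]
      with t ht using hα t ht
  have hαc : ContinuousAt α 0 := hα'.self_of_nhds.continuousAt
  have hT : ∀ᶠ t in 𝓝 (0 : ℝ), α t ∈ φ.target :=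
    hαc.eventually_mem ((isOpen_extChartAt_target x).mem_nhds
      (by rw [hα0]; exact mem_extChartAt_target x))
  refine ⟨fun t => φ.symm (α t), ?_, ?_, ?_⟩
  · simp only [hα0]
    exact extChartAt_to_inv x
  · have h1 := hα'.self_of_nhds
    have h2 : (chartField I x ξ ∘ φ.symm) (α 0) = ξ x := by
      rw [hα0]
      simp only [Function.comp, hφ, extChartAt_to_inv]
      exact vDeriv_extChartAt_self x (ξ x)
    rw [h2] at h1
    exact h1.congr_of_eventuallyEq (hT.mono fun t ht => φ.right_inv ht)
  · filter_upwards [hα', hT, hT.eventually_nhds] with t ht htT htT'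
    have hsrc : φ.symm (α t) ∈ (chartAt H x).source := by
      have := φ.map_target htT
      rwa [hφ, extChartAt_source] at this
    have hcont : ContinuousAt φ.symm (α t) :=
      (continuousOn_extChartAt_symm x).continuousAt ((isOpen_extChartAt_target x).mem_nhds htT)
    refine ⟨ContinuousAt.comp (f := α) hcont ht.continuousAt, ?_⟩
    have : IsManifold I 1 N := isManifold_one
    set z := φ.symm (α t) with hz
    have hFz : MDifferentiableAt I 𝓘(ℂ, E) (extChartAt I z) z :=
      mdifferentiableAt_extChartAt (mem_chart_source H z)
    have e1 := vDeriv_eq_fderiv_chart hsrc hFz (ξ z)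
    have e2 : extChartAt I x z = α t := φ.right_inv htT
    have e3 := (differentiableAt_comp_symm hsrc hFz).hasFDerivAt
    rw [e2] at e1 e3
    have e4 : HasDerivAt (fun s => (extChartAt I z ∘ φ.symm) (α s))
        (fderiv ℂ (extChartAt I z ∘ φ.symm) (α t) (chartField I x ξ z)) t :=
      (e3.restrictScalars ℝ).comp_hasDerivAt t ht
    have e5 : fderiv ℂ (extChartAt I z ∘ φ.symm) (α t) (chartField I x ξ z) = (ξ z : E) :=
      e1.symm.trans (vDeriv_extChartAt_self z (ξ z))
    rw [e5] at e4
    exact e4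

/-- If the image of an embedded submanifold is a union of leaves of the distribution `D`, the
submanifold is tangent to `D`. -/
theorem mem_range_mfderiv_of_saturated [FiniteDimensional ℂ E] [FiniteDimensional ℂ E']
    {D : ∀ x : N, Submodule ℂ (TangentSpace I x)} {i : N' → N} (hi : ContMDiff I' I ω i)
    (hemb : Topology.IsEmbedding i) {y : N'} (himm : Function.Injective (mfderiv I' I i y))
    (hsat : ∀ x', TangentCurveJoins I D (i y) x' → x' ∈ Set.range i)
    {ξ : ∀ x : N, TangentSpace I x} (hξ : HolVFAt I ξ (i y)) (hξD : ∀ x, ξ x ∈ D x) :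
    ∃ η, mfderiv I' I i y η = ξ (i y) := by
  have : CompleteSpace E := FiniteDimensional.complete ℂ E
  obtain ⟨γ, hγ0, hγ1, hγ⟩ := exists_integralCurve hξ
  obtain ⟨δ, hδ, hγδ⟩ := Metric.eventually_nhds_iff.1 hγ
  -- The integral curve stays in the leaf, hence in the image of `i`, and as `i` is an embedding its
  -- preimage tends to `y`.
  have hmem : ∀ s : ℝ, ∃ η : N', 0 < s → s < δ → i η = γ s := by
    intro s
    by_cases hs : 0 < s ∧ s < δ
    · obtain ⟨η, hη⟩ := hsat (γ s) ⟨γ, 0, s, hs.1.le, hγ0, rfl, fun t ht =>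
        ⟨ξ (γ t), hξD _, hγδ (by
          rw [Real.dist_eq, sub_zero, abs_of_nonneg ht.1]; exact ht.2.trans_lt hs.2)⟩⟩
      exact ⟨η, fun _ _ => hη⟩
    · exact ⟨y, fun h1 h2 => absurd ⟨h1, h2⟩ hs⟩
  choose η hη using hmem
  have hev : ∀ᶠ s in 𝓝[>] (0 : ℝ), i (η s) = γ s := by
    filter_upwards [Ioo_mem_nhdsGT hδ] with s hs using hη s hs.1 hs.2
  have hγc : ContinuousAt γ 0 := hγ.self_of_nhds.1
  have hηt : Tendsto η (𝓝[>] 0) (𝓝 y) := by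
    rw [hemb.tendsto_nhds_iff]
    have h1 : Tendsto γ (𝓝[>] 0) (𝓝 (i y)) := by
      rw [← hγ0]
      exact hγc.tendsto.mono_left nhdsWithin_le_nhds
    exact h1.congr' (hev.mono fun s hs => hs.symm)
  have hy := mem_chart_source H' y
  set ψ := extChartAt I' y with hψ
  set F : N' → E := extChartAt I (i y) ∘ i with hF
  have hFd : MDifferentiableAt I' 𝓘(ℂ, E) F y :=
    (contMDiffAt_extChartAt_comp (hi y)).mdifferentiableAt (by simp)
  have hG := (differentiableAt_comp_symm hy hFd).hasFDerivAt
  have : IsManifold I 1 N := isManifold_one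
  have hA : ∀ u : TangentSpace I' y,
      fderiv ℂ (F ∘ ψ.symm) (ψ y) (u : E') = mfderiv I' I i y u := by
    intro u
    have e1 := vDeriv_eq_fderiv_chart hy hFd u
    rw [vDeriv_extChartAt_self] at e1
    have e2 := vDeriv_comp (F := extChartAt I (i y)) (g := i)
      (mdifferentiableAt_extChartAt (mem_chart_source H (i y)))
      ((hi y).mdifferentiableAt (by simp)) u
    exact e1.symm.trans (e2.trans (vDeriv_extChartAt_self _ _))
  have hp : Tendsto (fun s => ψ (η s)) (𝓝[>] 0) (𝓝 (ψ y)) :=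
    (continuousAt_extChartAt y).tendsto.comp hηt
  have hsrc : ∀ᶠ s in 𝓝[>] (0 : ℝ), η s ∈ ψ.source :=
    hηt.eventually_mem (extChartAt_source_mem_nhds y)
  have key := mem_range_of_hasDerivAt hG (fun u u' h => himm
    ((hA u).symm.trans (h.trans (hA u')))) hγ1
    (by simp only [Function.comp, hF, extChartAt_to_inv, hγ0]) hp
    (by
      filter_upwards [hev, hsrc] with s hs hs'
      have e : ψ.symm (ψ (η s)) = η s := ψ.left_inv hs'
      exact congrArg (extChartAt I (i y)) ((congrArg i e).trans hs))
  obtain ⟨u, hu⟩ := key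
  exact ⟨u, (hA u).symm.trans hu⟩

end Saturation

/-! ### The cotangent bundle structure -/

section CotangentProj

variable {EB B : Type*} [NormedAddCommGroup EB] [NormedSpace ℂ EB]
    [TopologicalSpace B] [ChartedSpace EB B] [IsManifold 𝓘(ℂ, EB) ω B]

/-- The projection `T^*_B → B` is a submersion: there is a local section through any point. -/
theorem mfderiv_cotangent_proj_surjective (p : CotangentBundle EB B) :
    Function.Surjective (mfderiv (cotModel EB) 𝓘(ℂ, EB)
      (Bundle.TotalSpace.proj : CotangentBundle EB B → B) p) := by
  set e := trivializationAt (EB →L[ℂ] ℂ)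
    (fun b : B => TangentSpace 𝓘(ℂ, EB) b →L[ℂ] Bundle.Trivial B ℂ b) p.1 with he
  have hp : p.1 ∈ e.baseSet := FiberBundle.mem_baseSet_trivializationAt' p.1
  set s : B → CotangentBundle EB B := fun b => ⟨b, e.symm b (e p).2⟩ with hs
  have hsp : s p.1 = p := by
    have := e.symm_apply_apply_mk hp p.2
    exact congrArg (fun q => (⟨p.1, q⟩ : CotangentBundle EB B)) this
  have hsh : ContMDiffAt 𝓘(ℂ, EB) (cotModel EB) ω s p.1 := by
    refine contMDiffAt_totalSpace.2 ⟨contMDiffAt_id, ?_⟩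
    refine (contMDiffAt_const (c := (e p).2)).congr_of_eventuallyEq ?_
    filter_upwards [e.open_baseSet.mem_nhds hp] with b hb
    have := congrArg Prod.snd (e.apply_mk_symm hb (e p).2)
    exact this
  have key : Function.Surjective (mfderiv (cotModel EB) 𝓘(ℂ, EB)
      (Bundle.TotalSpace.proj : CotangentBundle EB B → B) (s p.1)) := by
    intro w
    refine ⟨mfderiv 𝓘(ℂ, EB) (cotModel EB) s p.1 w, ?_⟩
    have h1 : MDifferentiableAt (cotModel EB) 𝓘(ℂ, EB)
        (Bundle.TotalSpace.proj : CotangentBundle EB B → B) (s p.1) :=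
      ((contMDiff_proj (n := ω) _).contMDiffAt).mdifferentiableAt (by simp)
    have h2 := mfderiv_comp p.1 h1 (hsh.mdifferentiableAt (by simp))
    have h3 : (Bundle.TotalSpace.proj : CotangentBundle EB B → B) ∘ s = id := rfl
    rw [h3] at h2
    exact (congrArg (fun T : EB →L[ℂ] EB => T w) (h2.symm.trans mfderiv_id))
  rwa [hsp] at key

end CotangentProj

section Cotangent

variable {EB B : Type*} [NormedAddCommGroup EB] [NormedSpace ℂ EB]
    [TopologicalSpace B] [ChartedSpace EB B] [IsManifold 𝓘(ℂ, EB) ω B]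
  {E M : Type*} [NormedAddCommGroup E] [NormedSpace ℂ E]
  [TopologicalSpace M] [ChartedSpace E M] [IsManifold 𝓘(ℂ, E) ω M]

namespace CotangentStructure

variable {η : FormField 𝓘(ℂ, E) M} (C : CotangentStructure EB B η)

theorem contMDiff_rho : ContMDiff 𝓘(ℂ, E) 𝓘(ℂ, EB) ω C.rho :=
  (contMDiff_proj _).comp C.hol

theorem mfderiv_rho_apply (m : M) (ξ : TM E m) :
    mfderiv 𝓘(ℂ, E) 𝓘(ℂ, EB) C.rho m ξ =
      mfderiv (cotModel EB) 𝓘(ℂ, EB) (Bundle.TotalSpace.proj : CotangentBundle EB B → B) (C.emb m)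
        (mfderiv 𝓘(ℂ, E) (cotModel EB) C.emb m ξ) := by
  have h1 : MDifferentiableAt (cotModel EB) 𝓘(ℂ, EB)
      (Bundle.TotalSpace.proj : CotangentBundle EB B → B) (C.emb m) :=
    ((contMDiff_proj (n := ω) _).contMDiffAt).mdifferentiableAt (by simp)
  have h2 : MDifferentiableAt 𝓘(ℂ, E) (cotModel EB) C.emb m :=
    C.hol.contMDiffAt.mdifferentiableAt (by simp)
  exact congrArg (fun T : E →L[ℂ] EB => T ξ) (mfderiv_comp m h1 h2)

theorem mfderiv_rho_surjective (m : M) :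
    Function.Surjective (mfderiv 𝓘(ℂ, E) 𝓘(ℂ, EB) C.rho m) := by
  intro w
  obtain ⟨p, hp⟩ := mfderiv_cotangent_proj_surjective (C.emb m) w
  obtain ⟨ξ, hξ⟩ := (C.deriv_bijective m).2 p
  exact ⟨ξ, by rw [mfderiv_rho_apply, hξ]; exact hp⟩

theorem liouvilleOn_apply (m : M) (ξ : TM E m) :
    liouvilleOn C.emb m ξ = C.beta m (mfderiv 𝓘(ℂ, E) 𝓘(ℂ, EB) C.rho m ξ) := by
  rw [mfderiv_rho_apply]
  rfl

/-- The function `(ρ^*(u), β)` on `M` is holomorphic for a holomorphic vector field `u`. -/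
theorem contMDiffAt_beta {m : M} {u : ∀ b : B, TangentSpace 𝓘(ℂ, EB) b}
    (hu : HolVFAt 𝓘(ℂ, EB) u (C.rho m)) :
    ContMDiffAt 𝓘(ℂ, E) 𝓘(ℂ, ℂ) ω (fun m => C.beta m (u (C.rho m))) m := by
  have h1 : ContMDiffAt 𝓘(ℂ, E) (cotModel EB) ω
    (fun m => (⟨C.rho m, (C.emb m).2⟩ : CotangentBundle EB B)) m := C.hol m
  have h2 : ContMDiffAt 𝓘(ℂ, E) 𝓘(ℂ, EB).tangent ω
    (fun m => (⟨C.rho m, u (C.rho m)⟩ : TangentBundle 𝓘(ℂ, EB) B)) m :=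
    hu.comp_holAlongAt (C.contMDiff_rho m)
  have h3 := ContMDiffAt.clm_bundle_apply (E₁ := fun b : B => TangentSpace 𝓘(ℂ, EB) b)
    (E₂ := Bundle.Trivial B ℂ) h1 h2
  exact (contMDiffAt_totalSpace.1 h3).2

variable [FiniteDimensional ℂ E]

/-- The pairing of a vertical vector `a` with a lift of `u(ρ(m))` is minus the derivative of
`(ρ^*(u), β)` along `a`. This is `ω = -dλ`, evaluated on a vertical extension of `a` and an
extension `c'` of `c` which lifts `u`: then `λ(c') = (ρ^*(u), β)`, and the other terms vanish. -/
theorem symp_eq_neg_dirDeriv {m : M} {u : ∀ b : B, TangentSpace 𝓘(ℂ, EB) b}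
    (hu : HolVFAt 𝓘(ℂ, EB) u (C.rho m)) {a c : TM E m}
    (ha : mfderiv 𝓘(ℂ, E) 𝓘(ℂ, EB) C.rho m a = 0)
    (hc : mfderiv 𝓘(ℂ, E) 𝓘(ℂ, EB) C.rho m c = u (C.rho m)) :
    η m a c = -dirDeriv 𝓘(ℂ, E) (fun m => C.beta m (u (C.rho m))) m a := by
  obtain ⟨c', hc'h, hc'm, hc'⟩ := exists_holVFAt_lift (C.contMDiff_rho m)
    (C.mfderiv_rho_surjective m) (hu.comp_holAlongAt (C.contMDiff_rho m)) c hc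
  obtain ⟨a', ha'h, ha'm, ha'⟩ := exists_holVFAt_lift (C.contMDiff_rho m)
    (C.mfderiv_rho_surjective m)
    ((holVFAt_zero (I := 𝓘(ℂ, EB)) _).comp_holAlongAt (C.contMDiff_rho m)) a ha
  obtain ⟨U, hU, hUo, hmU⟩ := eventually_nhds_iff.1 (ha'h.eventually.and hc'h.eventually)
  have h1 := C.canonical U a' c' hUo (fun y hy => (hU y hy).1.contMDiffWithinAt)
    (fun y hy => (hU y hy).2.contMDiffWithinAt) m hmU
  have h2 : dirDeriv 𝓘(ℂ, E) (fun x => liouvilleOn C.emb x (c' x)) m (a' m) =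
      dirDeriv 𝓘(ℂ, E) (fun m => C.beta m (u (C.rho m))) m (a' m) := by
    refine congrArg (fun T : E →L[ℂ] ℂ => T (a' m)) (vDeriv_congr ?_)
    filter_upwards [hc'] with y hy
    rw [liouvilleOn_apply, hy]
  have h3 : dirDeriv 𝓘(ℂ, E) (fun x => liouvilleOn C.emb x (a' x)) m (c' m) = 0 := by
    have e1 : (fun x => liouvilleOn C.emb x (a' x)) =ᶠ[𝓝 m] fun _ => 0 := by
      filter_upwards [ha'] with y hy
      rw [liouvilleOn_apply, hy, map_zero]
    refine (congrArg (fun T : E →L[ℂ] ℂ => T (c' m)) (vDeriv_congr e1)).trans ?_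
    exact congrArg (fun T : E →L[ℂ] ℂ => T (c' m)) mfderiv_const
  have h4 : liouvilleOn C.emb m (mlieBracket 𝓘(ℂ, E) a' c' m) = 0 := by
    rw [liouvilleOn_apply, mfderiv_mlieBracket_of_related (C.contMDiff_rho m) ha'h hc'h
      (holVFAt_zero _) hu ha' hc']
    have : mlieBracket 𝓘(ℂ, EB) (fun _ => 0) u (C.rho m) = 0 :=
      congrFun mlieBracket_zero_left (C.rho m)
    rw [this, map_zero]
  rw [h2, h3, h4, ha'm, hc'm] at h1
  have h5 : -η m a c = dirDeriv 𝓘(ℂ, E) (fun m => C.beta m (u (C.rho m))) m a - 0 - 0 := h1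
  linear_combination -h5

/-- The fibres of `ρ` are Lagrangian, in particular isotropic. -/
theorem symp_eq_zero_of_vertical {m : M} {a c : TM E m}
    (ha : mfderiv 𝓘(ℂ, E) 𝓘(ℂ, EB) C.rho m a = 0)
    (hc : mfderiv 𝓘(ℂ, E) 𝓘(ℂ, EB) C.rho m c = 0) : η m a c = 0 := by
  rw [C.symp_eq_neg_dirDeriv (u := fun _ => 0) (holVFAt_zero _) ha hc, neg_eq_zero]
  simp only [map_zero]
  exact congrArg (fun T : E →L[ℂ] ℂ => T a) mfderiv_const

end CotangentStructure

end Cotangent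

/-! ### Connections defined by the kernel of a closed form -/

section FormConnection

variable {E H N : Type*} [NormedAddCommGroup E] [NormedSpace ℂ E] [TopologicalSpace H]
  {I : ModelWithCorners ℂ E H} [TopologicalSpace N] [ChartedSpace H N]
  {E' H' B : Type*} [NormedAddCommGroup E'] [NormedSpace ℂ E'] [TopologicalSpace H']
  {I' : ModelWithCorners ℂ E' H'} [TopologicalSpace B] [ChartedSpace H' B]
  {f : N → B} {Θ : FormField I N}

variable (I' f) in
/-- The relative form induced by a form on the total space of `f`. -/
noncomputable def relForm (Θ : FormField I N) : RelForm I I' f := fun y =>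
  (Θ y).domRestrict₁₂ (vertical I I' f y) (vertical I I' f y)

theorem mem_vertical {y : N} {a : TangentSpace I y} :
    a ∈ vertical I I' f y ↔ mfderiv I I' f y a = 0 := Iff.rfl

theorem relEval_relForm {y : N} {a b : TangentSpace I y} (ha : a ∈ vertical I I' f y)
    (hb : b ∈ vertical I I' f y) : relEval I I' (relForm I' f Θ) y a b = Θ y a b := by
  rw [relEval, dif_pos ⟨ha, hb⟩]
  rfl

variable [IsManifold I ω N] [IsManifold I' ω B] [I.Boundaryless] [I'.Boundaryless]

theorem mlieBracket_mem_vertical (hf : ContMDiff I I' ω f) {a b : ∀ y : N, TangentSpace I y} {x : N}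
    {u : ∀ b : B, TangentSpace I' b} (hu : HolVFAt I' u (f x))
    (ha : HolVFAt I a x) (hb : HolVFAt I b x) (hau : ∀ᶠ y in 𝓝 x, mfderiv I I' f y (a y) = u (f y))
    (hbv : ∀ᶠ y in 𝓝 x, b y ∈ vertical I I' f y) :
    mlieBracket I a b x ∈ vertical I I' f x := by
  rw [mem_vertical, mfderiv_mlieBracket_of_related (hf x) ha hb hu (holVFAt_zero _) hau hbv]
  exact congrFun mlieBracket_zero_right (f x)

theorem VertVF.mlieBracket_mem {U : Set N} (hU : IsOpen U) (hf : ContMDiff I I' ω f)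
    {a b : ∀ y : N, TangentSpace I y} (ha : VertVF I I' f U a) (hb : VertVF I I' f U b) {x : N}
    (hx : x ∈ U) : mlieBracket I a b x ∈ vertical I I' f x :=
  mlieBracket_mem_vertical hf (holVFAt_zero _) (ha.1.holVFAt hU hx) (hb.1.holVFAt hU hx)
    (by filter_upwards [hU.mem_nhds hx] with y hy using ha.2 y hy)
    (by filter_upwards [hU.mem_nhds hx] with y hy using hb.2 y hy)

omit [IsManifold I ω N] [IsManifold I' ω B] [I.Boundaryless] [I'.Boundaryless] in
theorem dirDeriv_relEval_relForm {U : Set N} (hU : IsOpen U) {a b : ∀ y : N, TangentSpace I y}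
    (ha : ∀ y ∈ U, a y ∈ vertical I I' f y) (hb : ∀ y ∈ U, b y ∈ vertical I I' f y) {x : N}
    (hx : x ∈ U) (w : TangentSpace I x) :
    dirDeriv I (fun y => relEval I I' (relForm I' f Θ) y (a y) (b y)) x w =
      dirDeriv I (fun y => Θ y (a y) (b y)) x w := by
  refine congrArg (fun T : E →L[ℂ] ℂ => T w) (vDeriv_congr ?_)
  filter_upwards [hU.mem_nhds hx] with y hy using relEval_relForm (ha y hy) (hb y hy)

/-- A closed form which is nondegenerate on the fibres of `f` induces a relative symplectic form. -/
theorem isRelSymplectic_relForm (hf : ContMDiff I I' ω f) (hΘ : IsHolForm I Θ)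
    (halt : ∀ x a, Θ x a a = 0) (hcl : IsClosedForm I Θ)
    (hnd : ∀ y, ∀ a ∈ vertical I I' f y, (∀ b ∈ vertical I I' f y, Θ y a b = 0) → a = 0) :
    IsRelSymplectic I I' f (relForm I' f Θ) where
  alt x a := halt x a
  nondeg x a h := Subtype.ext (hnd x a a.2 fun b hb => h ⟨b, hb⟩)
  hol U a b hU ha hb := by
    have h1 : ContMDiffOn I 𝓘(ℂ, ℂ) ω (fun y => Θ y (a y) (b y)) U := fun y hy =>
      (hΘ y a b (ha.1.holVFAt hU hy) (hb.1.holVFAt hU hy)).contMDiffWithinAt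
    exact h1.congr fun y hy => relEval_relForm (ha.2 y hy) (hb.2 y hy)
  closed U a b c hU ha hb hc x hx := by
    rw [dirDeriv_relEval_relForm hU hb.2 hc.2 hx, dirDeriv_relEval_relForm hU ha.2 hc.2 hx,
      dirDeriv_relEval_relForm hU ha.2 hb.2 hx,
      relEval_relForm (ha.mlieBracket_mem hU hf hb hx) (hc.2 x hx),
      relEval_relForm (ha.mlieBracket_mem hU hf hc hx) (hb.2 x hx),
      relEval_relForm (hb.mlieBracket_mem hU hf hc hx) (ha.2 x hx)]
    exact hcl x a b c (ha.1.holVFAt hU hx) (hb.1.holVFAt hU hx) (hc.1.holVFAt hU hx)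

variable {k : BundleMap I I' f}

omit [IsManifold I ω N] [IsManifold I' ω B] [I.Boundaryless] [I'.Boundaryless] in
/-- If the lifts `k(u)` are in the kernel of a form which is nondegenerate on the fibres, they span
this kernel. -/
theorem mem_horizontal_iff_of_ker
    (hnd : ∀ y, ∀ a ∈ vertical I I' f y, (∀ b ∈ vertical I I' f y, Θ y a b = 0) → a = 0)
    (hk : ∀ y u, mfderiv I I' f y (k y u) = u) (hkΘ : ∀ y u b, Θ y (k y u) b = 0)
    (y : N) (a : TangentSpace I y) : a ∈ horizontal I I' f k y ↔ ∀ b, Θ y a b = 0 := by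
  constructor
  · rintro ⟨u, rfl⟩ b
    exact hkΘ y u b
  · intro ha
    refine ⟨mfderiv I I' f y a, ?_⟩
    have h1 : a - k y (mfderiv I I' f y a) ∈ vertical I I' f y := by
      rw [mem_vertical, map_sub, hk, sub_self]
    have h2 := hnd y _ h1 fun b _ => by
      rw [map_sub, LinearMap.sub_apply, ha, hkΘ, sub_zero]
    exact (sub_eq_zero.1 h2).symm

omit [I'.Boundaryless] in
/-- The kernel of a form which is nondegenerate on the fibres is the image of a holomorphic
connection. -/
theorem isConnection_of_ker [FiniteDimensional ℂ E] (hf : IsHolSubmersion I I' f)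
    (hΘ : IsHolForm I Θ)
    (hnd : ∀ y, ∀ a ∈ vertical I I' f y, (∀ b ∈ vertical I I' f y, Θ y a b = 0) → a = 0)
    (hk : ∀ y u, mfderiv I I' f y (k y u) = u) (hkΘ : ∀ y u b, Θ y (k y u) b = 0) :
    IsConnection I I' f k where
  section_eq := hk
  hol U u hU hu := fun y hy => by
    have h1 : HolVFAt I (fun x => k x (u (f x))) y :=
      holVFAt_of_mem_ker hΘ (hf.hol y) (hf.surj y) (hnd y)
        ((hu.holVFAt hU hy).comp_holAlongAt (hf.hol y)) (.of_forall fun z => hk z _)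
        (.of_forall fun z => hkΘ z _)
    exact h1.contMDiffWithinAt

omit [I'.Boundaryless] [IsManifold I' ω B] [I.Boundaryless] in
theorem isFlat_of_ker (halt : ∀ x a, Θ x a a = 0) (hcl : IsClosedForm I Θ)
    (hnd : ∀ y, ∀ a ∈ vertical I I' f y, (∀ b ∈ vertical I I' f y, Θ y a b = 0) → a = 0)
    (hk : ∀ y u, mfderiv I I' f y (k y u) = u) (hkΘ : ∀ y u b, Θ y (k y u) b = 0) :
    IsFlat I I' f k :=
  hcl.isInvolutive_ker halt (mem_horizontal_iff_of_ker hnd hk hkΘ)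

/-- The connection whose image is the kernel of a closed form preserves the relative form: evaluate
`dΘ = 0` on the lift of a vector field and two vertical vector fields. -/
theorem preservesRelForm_of_ker (hf : ContMDiff I I' ω f) (hkc : IsConnection I I' f k)
    (halt : ∀ x a, Θ x a a = 0) (hcl : IsClosedForm I Θ)
    (hkΘ : ∀ y u b, Θ y (k y u) b = 0) : PreservesRelForm I I' f k (relForm I' f Θ) := by
  intro U u V a b hU hu hV hVU ha hb x hx
  set κ : ∀ y : N, TangentSpace I y := fun y => k y (u (f y)) with hκ
  have hux : HolVFAt I' u (f x) := hu.holVFAt hU (hVU hx)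
  have hκh : HolVFAt I κ x :=
    (hkc.hol U u hU hu).holVFAt (hU.preimage hf.continuous) (hVU hx)
  have hκu : ∀ᶠ y in 𝓝 x, mfderiv I I' f y (κ y) = u (f y) :=
    .of_forall fun y => hkc.section_eq y _
  have hah := ha.1.holVFAt hV hx
  have hbh := hb.1.holVFAt hV hx
  have hva : ∀ᶠ y in 𝓝 x, a y ∈ vertical I I' f y := by
    filter_upwards [hV.mem_nhds hx] with y hy using ha.2 y hy
  have hvb : ∀ᶠ y in 𝓝 x, b y ∈ vertical I I' f y := by
    filter_upwards [hV.mem_nhds hx] with y hy using hb.2 y hy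
  have h := hcl x κ a b hκh hah hbh
  have h0 : ∀ (c : ∀ y : N, TangentSpace I y) (w : TangentSpace I x),
      dirDeriv I (fun y => Θ y (κ y) (c y)) x w = 0 := by
    intro c w
    have e1 : (fun y => Θ y (κ y) (c y)) = fun _ => 0 := funext fun y => hkΘ y _ _
    rw [e1]
    exact congrArg (fun T : E →L[ℂ] ℂ => T w) mfderiv_const
  rw [extD, h0, h0, form_swap halt x _ (κ x), hkΘ] at h
  rw [dirDeriv_relEval_relForm hV ha.2 hb.2 hx,
    relEval_relForm (mlieBracket_mem_vertical hf hux hκh hah hκu hva) (hb.2 x hx),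
    relEval_relForm (ha.2 x hx) (mlieBracket_mem_vertical hf hux hκh hbh hκu hvb),
    form_swap halt x (a x)]
  linear_combination h

end FormConnection

/-! ### Linear algebra on the preimage of a Lagrangian submanifold -/

section Uniqueness

variable {E H X : Type*} [NormedAddCommGroup E] [NormedSpace ℂ E] [TopologicalSpace H]
  {I : ModelWithCorners ℂ E H} [TopologicalSpace X] [ChartedSpace H X]
  {E' H' B : Type*} [NormedAddCommGroup E'] [NormedSpace ℂ E'] [TopologicalSpace H']
  {I' : ModelWithCorners ℂ E' H'} [TopologicalSpace B] [ChartedSpace H' B]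
  [IsManifold I ω X] [IsManifold I' ω B] {f : X → B}

theorem IsConnection.eq_of_range_eq {h h' : BundleMap I I' f} (hh : IsConnection I I' f h)
    (hh' : IsConnection I I' f h') (hr : ∀ x, LinearMap.range (h x) = LinearMap.range (h' x)) :
    h = h' := by
  funext x
  refine LinearMap.ext fun u => ?_
  obtain ⟨w, hw⟩ : h x u ∈ LinearMap.range (h' x) := hr x ▸ ⟨u, rfl⟩
  have h1 : w = u := by rw [← hh'.section_eq x w, hw, hh.section_eq]
  rw [← hw, h1]

/-- The relative form, the Hamiltonian form and one connection of the pencil determine a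
time-dependent Hamiltonian system. -/
theorem HamiltonianSystem.eq_of_isPencil {S S' : HamiltonianSystem I I' f} (hΩ : S.Ω = S'.Ω)
    (hham : S.ham = S'.ham) {ε : ℂ} {k : BundleMap I I' f} (hk : S.IsPencil ε k)
    (hk' : S'.IsPencil ε k) : S = S' := by
  refine HamiltonianSystem.ext hΩ ?_ hham
  funext x
  refine LinearMap.ext fun u => ?_
  obtain ⟨U, hU, hxU, hu⟩ := (holVFAt_constField_self (I := I') (f x) u).exists_holVF
  have h1 := hk.eq U _ hU hu x hxU
  have h2 := hk'.eq U _ hU hu x hxU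
  have h3 : S.hamFlow (constField I' (f x) (u : E')) x =
      S'.hamFlow (constField I' (f x) (u : E')) x := by
    have h4 : S.hamFun (constField I' (f x) (u : E')) =
        S'.hamFun (constField I' (f x) (u : E')) := by
      unfold HamiltonianSystem.hamFun
      rw [hham]
    unfold HamiltonianSystem.hamFlow
    rw [hΩ, h4]
  rw [h1, h3, constField_self] at h2
  exact add_right_cancel h2

omit [IsManifold I ω X] [IsManifold I' ω B] in
/-- To recognise `Ω^♯(α)` it suffices to pair with vertical vectors. -/
theorem relSharp_eq {Ω : RelForm I I' f} {x : X} (halt : ∀ a, Ω x a a = 0)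
    (hnd : ∀ a, (∀ b, Ω x a b = 0) → a = 0) {α : vertical I I' f x →ₗ[ℂ] ℂ}
    {d : vertical I I' f x} (hd : ∀ b, Ω x b d = α b) : relSharp I I' Ω x α = d := by
  have h1 : LinearMap.flip (Ω x) d = α := LinearMap.ext fun b => hd b
  rw [← h1]
  refine LinearMap.leftInverse_apply_of_inj
    (LinearMap.ker_eq_bot'.2 fun a ha => hnd a fun b => ?_) d
  have h2 := halt (a + b)
  have h3 : Ω x b a = 0 := LinearMap.congr_fun ha b
  simp only [map_add, LinearMap.add_apply, halt, h3] at h2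
  simpa using h2

end Uniqueness

section Data

variable {EB B : Type*} [NormedAddCommGroup EB] [NormedSpace ℂ EB]
  [TopologicalSpace B] [ChartedSpace EB B] [IsManifold 𝓘(ℂ, EB) ω B]
  {E M : Type*} [NormedAddCommGroup E] [NormedSpace ℂ E]
  [TopologicalSpace M] [ChartedSpace E M] [IsManifold 𝓘(ℂ, E) ω M]
  {EY Y : Type*} [NormedAddCommGroup EY] [NormedSpace ℂ EY]
  [TopologicalSpace Y] [ChartedSpace EY Y] [IsManifold 𝓘(ℂ, EY) ω Y]
  {J : PreJoyceStructure E M} {C : CotangentStructure EB B J.symp} {i : Y → TX E M}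

open PreJoyceStructure

theorem IsAssociated.unique {S S' : HamiltonianSystem 𝓘(ℂ, EY) 𝓘(ℂ, EB) (baseMap C i)}
    (himm : ∀ y, Function.Injective (inclDeriv EY i y))
    (hS : IsAssociated J C i S) (hS' : IsAssociated J C i S') : S = S' := by
  obtain ⟨k, hk, hkr⟩ := hS.image_eq 1 one_ne_zero
  obtain ⟨k', hk', hkr'⟩ := hS'.image_eq 1 one_ne_zero
  have h1 : k = k' := hk.connection.eq_of_range_eq hk'.connection fun y =>
    Submodule.map_injective_of_injective (himm y) ((hkr y).trans (hkr' y).symm)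
  refine HamiltonianSystem.eq_of_isPencil ?_ ?_ hk (h1 ▸ hk')
  · funext y
    exact LinearMap.ext₂ fun a b => (hS.form_eq y a b).trans (hS'.form_eq y a b).symm
  · funext y
    exact (hS.ham_eq y).trans (hS'.ham_eq y).symm

variable (J EY i) in
/-- The component `a` of a tangent vector to `Y` with image `h(a) + v(l)` in `T_X`. -/
noncomputable def horY (y : Y) : TangentSpace 𝓘(ℂ, EY) y →ₗ[ℂ] TM E (proj (i y)) :=
  hor (i y) ∘ₗ inclDeriv EY i y

variable (J EY i) in
/-- The component `l` of a tangent vector to `Y` with image `h(a) + v(l)` in `T_X`. -/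
noncomputable def verY (y : Y) : TangentSpace 𝓘(ℂ, EY) y →ₗ[ℂ] TM E (proj (i y)) :=
  J.ver (i y) ∘ₗ inclDeriv EY i y

variable (EY i) in
/-- The vectors `l` in `T_M` with `v(l)` tangent to `Y`; this is the tangent space to the Lagrangian
`R`, when `T_{Z_∞}` is identified with `T_X / im(h) = T_M`. -/
noncomputable def lagr (y : Y) : Submodule ℂ (TM E (proj (i y))) :=
  (LinearMap.range (inclDeriv EY i y)).comap (vlift (i y))

omit [IsManifold 𝓘(ℂ, EY) ω Y] in
theorem inclDeriv_eq (y : Y) (η : TangentSpace 𝓘(ℂ, EY) y) :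
    inclDeriv EY i y η = J.h (i y) (horY EY i y η) + vlift (i y) (verY EY J i y η) :=
  (J.h_hor_add_vlift_ver (i y) _).symm

section Lagrangian

variable [FiniteDimensional ℂ E] [FiniteDimensional ℂ EY] {R : Set J.ZInf}

/-- The submanifold `q_∞⁻¹(R)` is tangent to `im(h)`. -/
theorem IsLagrangianPreimage.exists_inclDeriv_eq_h (hR : IsLagrangianPreimage EY J R i) (y : Y)
    (a : TM E (proj (i y))) : ∃ η, inclDeriv EY i y η = J.h (i y) a := by
  have h1 := mem_range_mfderiv_of_saturated (D := J.distrInf) hR.hol hR.isEmbedding (hR.immersive y)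
    (fun x' hx' => ?_)
    (J.holVFAt_h_proj (x := i y) (holVFAt_constField_self (I := 𝓘(ℂ, E)) (proj (i y)) a))
    (fun x => ⟨_, rfl⟩)
  · rw [constField_self] at h1
    exact h1
  · have h2 : J.qInf (i y) = J.qInf x' := Quotient.sound (Relation.EqvGen.rel _ _ hx')
    rw [hR.range_eq]
    have h3 : i y ∈ J.qInf ⁻¹' R := hR.range_eq ▸ ⟨y, rfl⟩
    change J.qInf x' ∈ R
    rw [← h2]
    exact h3

theorem IsLagrangianPreimage.verY_mem (hR : IsLagrangianPreimage EY J R i) (y : Y)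
    (η : TangentSpace 𝓘(ℂ, EY) y) : verY EY J i y η ∈ lagr EY i y := by
  obtain ⟨ζ, hζ⟩ := hR.exists_inclDeriv_eq_h y (horY EY i y η)
  refine ⟨η - ζ, ?_⟩
  rw [map_sub, hζ, inclDeriv_eq (J := J), add_sub_cancel_left]

theorem IsLagrangianPreimage.exists_tangent (hR : IsLagrangianPreimage EY J R i) (y : Y)
    (a : TM E (proj (i y))) {l : TM E (proj (i y))} (hl : l ∈ lagr EY i y) :
    ∃ η, horY EY i y η = a ∧ verY EY J i y η = l := by
  obtain ⟨ζ, hζ⟩ := hR.exists_inclDeriv_eq_h y a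
  obtain ⟨χ, hχ⟩ := hl
  refine ⟨ζ + χ, ?_, ?_⟩
  · simp only [horY, LinearMap.comp_apply, map_add, hζ, hχ, hor_h, hor_vlift, add_zero]
  · simp only [verY, LinearMap.comp_apply, map_add, hζ, hχ, ver_h, ver_vlift, zero_add]

omit [FiniteDimensional ℂ E] [FiniteDimensional ℂ EY] [IsManifold 𝓘(ℂ, EY) ω Y] in
theorem IsLagrangianPreimage.eq_zero (hR : IsLagrangianPreimage EY J R i) {y : Y}
    {η : TangentSpace 𝓘(ℂ, EY) y} (h1 : horY EY i y η = 0) (h2 : verY EY J i y η = 0) : η = 0 := by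
  refine hR.immersive y ?_
  rw [inclDeriv_eq (J := J), h1, h2, map_zero, map_zero, map_zero, add_zero]

omit [FiniteDimensional ℂ E] [FiniteDimensional ℂ EY] [IsManifold 𝓘(ℂ, EY) ω Y] in
theorem IsLagrangianPreimage.symp_eq_zero (hR : IsLagrangianPreimage EY J R i) {y : Y}
    {l l' : TM E (proj (i y))} (hl : l ∈ lagr EY i y) (hl' : l' ∈ lagr EY i y) :
    J.symp (proj (i y)) l l' = 0 := by
  obtain ⟨η, hη⟩ := hl
  obtain ⟨η', hη'⟩ := hl'
  have := hR.isotropic y η η'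
  rwa [hη, hη', omegaMinus_eq, ver_vlift, ver_vlift] at this

omit [FiniteDimensional ℂ E] [FiniteDimensional ℂ EY] [IsManifold 𝓘(ℂ, EY) ω Y] in
theorem mfderiv_baseMap (hR : IsLagrangianPreimage EY J R i) (y : Y)
    (η : TangentSpace 𝓘(ℂ, EY) y) : mfderiv 𝓘(ℂ, EY) 𝓘(ℂ, EB) (baseMap C i) y η =
      mfderiv 𝓘(ℂ, E) 𝓘(ℂ, EB) C.rho (proj (i y)) (horY EY i y η) := by
  have h1 : MDifferentiableAt 𝓘(ℂ, EY) 𝓘(ℂ, E).tangent i y :=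
    hR.hol.contMDiffAt.mdifferentiableAt (by simp)
  have h2 : MDifferentiableAt 𝓘(ℂ, E).tangent 𝓘(ℂ, E) (proj : TX E M → M) (i y) :=
    contMDiff_proj_TX.contMDiffAt.mdifferentiableAt (by simp)
  have h3 : MDifferentiableAt 𝓘(ℂ, E) 𝓘(ℂ, EB) C.rho (proj (i y)) :=
    C.contMDiff_rho.contMDiffAt.mdifferentiableAt (by simp)
  have e1 := mfderiv_comp y h3 (h2.comp y h1)
  have e2 := mfderiv_comp y h2 h1
  exact (congrArg (fun T : EY →L[ℂ] EB => T η) e1).trans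
    (congrArg (fun T : EY →L[ℂ] E => mfderiv 𝓘(ℂ, E) 𝓘(ℂ, EB) C.rho (proj (i y)) (T η)) e2)

omit [FiniteDimensional ℂ E] [FiniteDimensional ℂ EY] [IsManifold 𝓘(ℂ, EY) ω Y] in
theorem mem_vertical_baseMap (hR : IsLagrangianPreimage EY J R i) {y : Y}
    {η : TangentSpace 𝓘(ℂ, EY) y} : η ∈ vertical 𝓘(ℂ, EY) 𝓘(ℂ, EB) (baseMap C i) y ↔
      mfderiv 𝓘(ℂ, E) 𝓘(ℂ, EB) C.rho (proj (i y)) (horY EY i y η) = 0 :=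
  ⟨fun h => (mfderiv_baseMap hR y η).symm.trans h, fun h => (mfderiv_baseMap hR y η).trans h⟩

omit [FiniteDimensional ℂ E] [FiniteDimensional ℂ EY] [IsManifold 𝓘(ℂ, EY) ω Y] in
theorem contMDiff_baseMap (hR : IsLagrangianPreimage EY J R i) :
    ContMDiff 𝓘(ℂ, EY) 𝓘(ℂ, EB) ω (baseMap C i) :=
  C.contMDiff_rho.comp (contMDiff_proj_TX.comp hR.hol)

theorem isHolSubmersion_baseMap (hR : IsLagrangianPreimage EY J R i) :
    IsHolSubmersion 𝓘(ℂ, EY) 𝓘(ℂ, EB) (baseMap C i) where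
  hol := contMDiff_baseMap hR
  surj y w := by
    obtain ⟨a, ha⟩ := C.mfderiv_rho_surjective (proj (i y)) w
    obtain ⟨η, hη, -⟩ := hR.exists_tangent y a (Submodule.zero_mem (lagr EY i y))
    exact ⟨η, by rw [mfderiv_baseMap hR, hη, ha]⟩

omit [FiniteDimensional ℂ E] in
theorem mem_distr {ε : ℂ} {x : TX E M} {ξ : TTX x} :
    ξ ∈ J.distr ε x ↔ J.ver x ξ = ε⁻¹ • hor x ξ := by
  have h1 : ∀ a, hEps J.h ε x a = J.h x a + ε⁻¹ • vlift x a := fun a => rfl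
  constructor
  · rintro ⟨a, rfl⟩
    rw [h1]
    simp only [map_add, map_smul, ver_h, ver_vlift, hor_h, hor_vlift, zero_add, smul_zero, add_zero]
  · intro h
    refine ⟨hor x ξ, (h1 _).trans ?_⟩
    rw [← map_smul, ← h]
    exact J.h_hor_add_vlift_ver x ξ

omit [FiniteDimensional ℂ E] [FiniteDimensional ℂ EY] [IsManifold 𝓘(ℂ, EY) ω Y] in
theorem mem_distr_inclDeriv {ε : ℂ} {y : Y} {η : TangentSpace 𝓘(ℂ, EY) y} :
    inclDeriv EY i y η ∈ J.distr ε (i y) ↔ verY EY J i y η = ε⁻¹ • horY EY i y η := mem_distr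

/-- The transversality assumption, in terms of the tangent spaces `ker ρ_*` and `L` to the fibres
of `ρ` and to `R`: these span `T_M`. -/
theorem Transversality.exists_eq_add (hstar : Transversality EY J C i)
    (hR : IsLagrangianPreimage EY J R i) (y : Y) (w : TM E (proj (i y))) :
    ∃ a l, mfderiv 𝓘(ℂ, E) 𝓘(ℂ, EB) C.rho (proj (i y)) a = 0 ∧ l ∈ lagr EY i y ∧ w = a + l := by
  obtain ⟨η, hη⟩ := (hstar y).2 ((J.distr 1 (i y)).mkQ (vlift (i y) w))
  have h1 : inclDeriv EY i y η - vlift (i y) w ∈ J.distr 1 (i y) :=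
    (Submodule.Quotient.eq _).1 hη
  rw [mem_distr, map_sub, map_sub, ver_vlift, hor_vlift, inv_one, one_smul, sub_zero] at h1
  refine ⟨-horY EY i y η, verY EY J i y η, ?_, hR.verY_mem y _, ?_⟩
  · rw [map_neg, (mem_vertical_baseMap hR).1 η.2, neg_zero]
  · have h2 : verY EY J i y η - w = horY EY i y η := h1
    rw [← h2]
    abel

/-- The transversality assumption, in terms of the tangent spaces `ker ρ_*` and `L` to the fibres
of `ρ` and to `R`: these intersect trivially. -/
theorem Transversality.eq_zero (hstar : Transversality EY J C i)
    (hR : IsLagrangianPreimage EY J R i) {y : Y} {a : TM E (proj (i y))}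
    (ha : mfderiv 𝓘(ℂ, E) 𝓘(ℂ, EB) C.rho (proj (i y)) a = 0) (hl : a ∈ lagr EY i y) : a = 0 := by
  obtain ⟨η, hη, hη'⟩ := hR.exists_tangent y a hl
  have h1 : η ∈ vertical 𝓘(ℂ, EY) 𝓘(ℂ, EB) (baseMap C i) y := by
    rw [mem_vertical_baseMap hR, hη, ha]
  have h2 : inclDeriv EY i y η ∈ J.distr 1 (i y) := by
    rw [mem_distr_inclDeriv, hη, hη', inv_one, one_smul]
  have h3 : (⟨η, h1⟩ : vertical 𝓘(ℂ, EY) 𝓘(ℂ, EB) (baseMap C i) y) = 0 := by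
    refine (hstar y).1 ?_
    rw [map_zero]
    exact (Submodule.Quotient.mk_eq_zero _).2 h2
  have h4 : η = 0 := congrArg Subtype.val h3
  rw [← hη, h4, map_zero]

end Lagrangian

end Data

/-! ### The pencil of closed forms on `Y` -/

section Combination

variable {E H N : Type*} [NormedAddCommGroup E] [NormedSpace ℂ E] [TopologicalSpace H]
  {I : ModelWithCorners ℂ E H} [TopologicalSpace N] [ChartedSpace H N] [IsManifold I ω N]
  {η η' : FormField I N}

theorem IsHolForm.add_smul (hη : IsHolForm I η) (hη' : IsHolForm I η') (t : ℂ) :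
    IsHolForm I (fun y => η y + t • η' y) := fun x a b ha hb =>
  (hη x a b ha hb).add ((contMDiffAt_const (I := I) (I' := 𝓘(ℂ, ℂ)) (M := N) (n := ω) (x := x)
    (c := t)).smul (hη' x a b ha hb))

theorem IsClosedForm.add_smul (hη : IsHolForm I η) (hη' : IsHolForm I η') (hcl : IsClosedForm I η)
    (hcl' : IsClosedForm I η') (t : ℂ) : IsClosedForm I (fun y => η y + t • η' y) := by
  intro x a b c ha hb hc
  have hd : ∀ {a b : ∀ y : N, TangentSpace I y}, HolVFAt I a x → HolVFAt I b x →
      ∀ w : TangentSpace I x,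
      dirDeriv I (fun y => (η y + t • η' y) (a y) (b y)) x w =
        dirDeriv I (fun y => η y (a y) (b y)) x w +
          t * dirDeriv I (fun y => η' y (a y) (b y)) x w := by
    intro a b ha hb w
    have h1 := ((hη x a b ha hb).mdifferentiableAt (by simp)).hasMFDerivAt
    have h2 := ((hη' x a b ha hb).mdifferentiableAt (by simp)).hasMFDerivAt
    exact congrArg (fun T : E →L[ℂ] ℂ => T w) (h1.add (h2.const_smul t)).mfderiv
  have h1 := hcl x a b c ha hb hc
  have h2 := hcl' x a b c ha hb hc
  rw [extD] at h1 h2 ⊢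
  rw [hd hb hc, hd ha hc, hd ha hb]
  simp only [LinearMap.add_apply, LinearMap.smul_apply, smul_eq_mul]
  linear_combination h1 + t * h2

end Combination

section Pencil

variable {EB B : Type*} [NormedAddCommGroup EB] [NormedSpace ℂ EB]
  [TopologicalSpace B] [ChartedSpace EB B] [IsManifold 𝓘(ℂ, EB) ω B]
  {E M : Type*} [NormedAddCommGroup E] [NormedSpace ℂ E] [FiniteDimensional ℂ E]
  [TopologicalSpace M] [ChartedSpace E M] [IsManifold 𝓘(ℂ, E) ω M]
  {EY Y : Type*} [NormedAddCommGroup EY] [NormedSpace ℂ EY] [FiniteDimensional ℂ EY]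
  [TopologicalSpace Y] [ChartedSpace EY Y] [IsManifold 𝓘(ℂ, EY) ω Y]
  {J : PreJoyceStructure E M} {C : CotangentStructure EB B J.symp} {i : Y → TX E M}
  {R : Set J.ZInf}

open PreJoyceStructure

variable (J EY i) in
/-- The closed 2-form `i^*(2iΩ_I) + t p^*(ω)` on `Y`. -/
noncomputable def pencilForm (t : ℂ) : FormField 𝓘(ℂ, EY) Y := fun y =>
  pullbackForm (I := 𝓘(ℂ, EY)) i J.twoIOmegaI y +
    t • pullbackForm (I := 𝓘(ℂ, EY)) (proj ∘ i) J.symp y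

omit [FiniteDimensional ℂ E] [FiniteDimensional ℂ EY] [IsManifold 𝓘(ℂ, EY) ω Y] in
theorem pencilForm_apply (hR : IsLagrangianPreimage EY J R i) (t : ℂ) (y : Y)
    (η ζ : TangentSpace 𝓘(ℂ, EY) y) : pencilForm EY J i t y η ζ =
      -(J.symp (proj (i y)) (horY EY i y η) (verY EY J i y ζ) +
        J.symp (proj (i y)) (verY EY J i y η) (horY EY i y ζ)) +
      t * J.symp (proj (i y)) (horY EY i y η) (horY EY i y ζ) := by
  have h1 : MDifferentiableAt 𝓘(ℂ, EY) 𝓘(ℂ, E).tangent i y :=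
    hR.hol.contMDiffAt.mdifferentiableAt (by simp)
  have h2 : MDifferentiableAt 𝓘(ℂ, E).tangent 𝓘(ℂ, E) (proj : TX E M → M) (i y) :=
    contMDiff_proj_TX.contMDiffAt.mdifferentiableAt (by simp)
  have e2 := mfderiv_comp y h2 h1
  have e3 : ∀ η, mfderiv 𝓘(ℂ, EY) 𝓘(ℂ, E) (proj ∘ i) y η = horY EY i y η := fun η =>
    congrArg (fun T : EY →L[ℂ] E => T η) e2
  have e4 : pencilForm EY J i t y η ζ = J.twoIOmegaI (i y) (inclDeriv EY i y η)
      (inclDeriv EY i y ζ) + t * J.symp (proj (i y)) (mfderiv 𝓘(ℂ, EY) 𝓘(ℂ, E) (proj ∘ i) y η)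
        (mfderiv 𝓘(ℂ, EY) 𝓘(ℂ, E) (proj ∘ i) y ζ) := rfl
  rw [e4, e3, e3]
  rfl

omit [FiniteDimensional ℂ E] [FiniteDimensional ℂ EY] [IsManifold 𝓘(ℂ, EY) ω Y] in
theorem pencilForm_alt (t : ℂ) (y : Y) (η : TangentSpace 𝓘(ℂ, EY) y) :
    pencilForm EY J i t y η η = 0 := by
  simp only [pencilForm, LinearMap.add_apply, LinearMap.smul_apply, pullbackForm_apply]
  rw [twoIOmegaI_alt, J.isSymplectic.alt, smul_zero, add_zero]

omit [FiniteDimensional ℂ EY] in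
theorem isHolForm_pencilForm (hR : IsLagrangianPreimage EY J R i) (t : ℂ) :
    IsHolForm 𝓘(ℂ, EY) (pencilForm EY J i t) :=
  (J.isHolForm_twoIOmegaI.pullback hR.hol).add_smul
    (J.isSymplectic.isHolForm.pullback (contMDiff_proj_TX.comp hR.hol)) t

omit [FiniteDimensional ℂ EY] in
theorem isClosedForm_pencilForm (hR : IsLagrangianPreimage EY J R i) (t : ℂ) :
    IsClosedForm 𝓘(ℂ, EY) (pencilForm EY J i t) :=
  IsClosedForm.add_smul (J.isHolForm_twoIOmegaI.pullback hR.hol)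
    (J.isSymplectic.isHolForm.pullback (contMDiff_proj_TX.comp hR.hol))
    (J.isClosedForm_twoIOmegaI.pullback J.isHolForm_twoIOmegaI J.twoIOmegaI_alt hR.hol)
    (J.isSymplectic.isClosedForm.pullback J.isSymplectic.isHolForm J.isSymplectic.alt
      (contMDiff_proj_TX.comp hR.hol)) t

/-- The pencil of forms is nondegenerate on the fibres of `f`: the tangent space of the fibre is the
direct sum of `ker ρ_*` and `L`, which are isotropic and complementary, and paired by `ω`. -/
theorem pencilForm_nondeg (hR : IsLagrangianPreimage EY J R i) (hstar : Transversality EY J C i)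
    (t : ℂ) (y : Y) (η : TangentSpace 𝓘(ℂ, EY) y)
    (hη : η ∈ vertical 𝓘(ℂ, EY) 𝓘(ℂ, EB) (baseMap C i) y)
    (h : ∀ ζ ∈ vertical 𝓘(ℂ, EY) 𝓘(ℂ, EB) (baseMap C i) y, pencilForm EY J i t y η ζ = 0) :
    η = 0 := by
  rw [mem_vertical_baseMap hR] at hη
  have key : ∀ a l, mfderiv 𝓘(ℂ, E) 𝓘(ℂ, EB) C.rho (proj (i y)) a = 0 → l ∈ lagr EY i y →
      J.symp (proj (i y)) (horY EY i y η) l + J.symp (proj (i y)) (verY EY J i y η) a = 0 := by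
    intro a l ha hl
    obtain ⟨ζ, hζ, hζ'⟩ := hR.exists_tangent y a hl
    have h1 := h ζ (by rw [mem_vertical_baseMap hR, hζ, ha])
    rw [pencilForm_apply hR, hζ, hζ', C.symp_eq_zero_of_vertical hη ha] at h1
    linear_combination -h1
  refine hR.eq_zero (J.isSymplectic.nondeg _ _ fun w => ?_) (J.isSymplectic.nondeg _ _ fun w => ?_)
  · obtain ⟨a, l, ha, hl, rfl⟩ := hstar.exists_eq_add hR y w
    rw [map_add, C.symp_eq_zero_of_vertical hη ha, zero_add]
    simpa using key 0 l (map_zero _) hl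
  · obtain ⟨a, l, ha, hl, rfl⟩ := hstar.exists_eq_add hR y w
    rw [map_add, hR.symp_eq_zero (hR.verY_mem y η) hl, add_zero]
    simpa using key a 0 ha (Submodule.zero_mem _)

/-- The vectors `h(a) + t v(a)` tangent to `Y` with `a ∈ L` are in the kernel of the pencil of
forms. -/
theorem pencilForm_eq_zero (hR : IsLagrangianPreimage EY J R i) {t : ℂ} {y : Y}
    {η : TangentSpace 𝓘(ℂ, EY) y} (h1 : horY EY i y η ∈ lagr EY i y)
    (h2 : verY EY J i y η = t • horY EY i y η) (ζ : TangentSpace 𝓘(ℂ, EY) y) :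
    pencilForm EY J i t y η ζ = 0 := by
  rw [pencilForm_apply hR, h2, hR.symp_eq_zero h1 (hR.verY_mem y ζ), map_smul,
    LinearMap.smul_apply, smul_eq_mul]
  ring

/-- The linear maps `k_ε`, with `t = ε⁻¹`: the lift of `u` is the vector `h(a) + t v(a)` with `a`
the unique element of `L` such that `ρ_*(a) = u`. -/
theorem exists_pencil (hR : IsLagrangianPreimage EY J R i) (hstar : Transversality EY J C i) :
    ∃ k : ℂ → BundleMap 𝓘(ℂ, EY) 𝓘(ℂ, EB) (baseMap C i), ∀ t y u,
      mfderiv 𝓘(ℂ, EY) 𝓘(ℂ, EB) (baseMap C i) y (k t y u) = u ∧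
        horY EY i y (k t y u) ∈ lagr EY i y ∧
        verY EY J i y (k t y u) = t • horY EY i y (k t y u) := by
  have key : ∀ (t : ℂ) (y : Y), ∃ k : TangentSpace 𝓘(ℂ, EB) (baseMap C i y) →ₗ[ℂ]
      TangentSpace 𝓘(ℂ, EY) y, ∀ u, mfderiv 𝓘(ℂ, EY) 𝓘(ℂ, EB) (baseMap C i) y (k u) = u ∧
        horY EY i y (k u) ∈ lagr EY i y ∧ verY EY J i y (k u) = t • horY EY i y (k u) := by
    intro t y
    set K : Submodule ℂ (TangentSpace 𝓘(ℂ, EY) y) := (lagr EY i y).comap (horY EY i y) ⊓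
      LinearMap.ker (verY EY J i y - t • horY EY i y) with hK
    have hmem : ∀ η, η ∈ K ↔ horY EY i y η ∈ lagr EY i y ∧
        verY EY J i y η = t • horY EY i y η := by
      intro η
      rw [hK, Submodule.mem_inf, Submodule.mem_comap, LinearMap.mem_ker, LinearMap.sub_apply,
        LinearMap.smul_apply, sub_eq_zero]
    set T : K →ₗ[ℂ] TangentSpace 𝓘(ℂ, EB) (baseMap C i y) :=
      (mfderiv 𝓘(ℂ, EY) 𝓘(ℂ, EB) (baseMap C i) y).toLinearMap ∘ₗ K.subtype with hT
    have hTb : Function.Bijective T := by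
      constructor
      · refine (injective_iff_map_eq_zero T).2 fun η hη => Subtype.ext ?_
        obtain ⟨h1, h2⟩ := (hmem _).1 η.2
        have h3 : horY EY i y η.1 = 0 := hstar.eq_zero hR ((mem_vertical_baseMap hR).1 hη) h1
        rw [h3, smul_zero] at h2
        exact hR.eq_zero h3 h2
      · intro w
        obtain ⟨a₀, ha₀⟩ := C.mfderiv_rho_surjective (proj (i y)) w
        obtain ⟨a, l, ha, hl, rfl⟩ := hstar.exists_eq_add hR y a₀
        rw [map_add, ha, zero_add] at ha₀
        obtain ⟨η, h1, h2⟩ := hR.exists_tangent y l (Submodule.smul_mem _ t hl)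
        refine ⟨⟨η, (hmem η).2 ⟨h1 ▸ hl, by rw [h1, h2]⟩⟩, ?_⟩
        exact (mfderiv_baseMap hR y η).trans ((congrArg _ h1).trans ha₀)
    set e := LinearEquiv.ofBijective T hTb with he
    refine ⟨K.subtype ∘ₗ e.symm.toLinearMap, fun u => ⟨?_, ?_⟩⟩
    · exact e.apply_symm_apply u
    · exact (hmem _).1 (e.symm u).2
  choose k hk using key
  exact ⟨k, hk⟩

omit [FiniteDimensional ℂ EY] in
/-- The vector field `Ω^♯(dH_u)` is the derivative with respect to `t` of the pencil of connections
determined by the pencil of forms. -/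
theorem smul_hamFlow_eq (hR : IsLagrangianPreimage EY J R i)
    {S : HamiltonianSystem 𝓘(ℂ, EY) 𝓘(ℂ, EB) (baseMap C i)}
    (hΩ : S.Ω = relForm 𝓘(ℂ, EB) (baseMap C i) (pencilForm EY J i 0))
    (hham : S.ham = fun y => C.beta (proj (i y))) {t : ℂ} {y : Y}
    {u : ∀ b : B, TangentSpace 𝓘(ℂ, EB) b} (hu : HolVFAt 𝓘(ℂ, EB) u (baseMap C i y))
    {κ κ₀ : TangentSpace 𝓘(ℂ, EY) y}
    (hκ : mfderiv 𝓘(ℂ, EY) 𝓘(ℂ, EB) (baseMap C i) y κ = u (baseMap C i y))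
    (hκ₀ : mfderiv 𝓘(ℂ, EY) 𝓘(ℂ, EB) (baseMap C i) y κ₀ = u (baseMap C i y))
    (hκΘ : ∀ b, pencilForm EY J i t y κ b = 0) (hκ₀Θ : ∀ b, pencilForm EY J i 0 y κ₀ b = 0) :
    t • S.hamFlow u y = κ - κ₀ := by
  have hv : κ - κ₀ ∈ vertical 𝓘(ℂ, EY) 𝓘(ℂ, EB) (baseMap C i) y := by
    rw [mem_vertical, map_sub, hκ, hκ₀, sub_self]
  set α : vertical 𝓘(ℂ, EY) 𝓘(ℂ, EB) (baseMap C i) y →ₗ[ℂ] ℂ :=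
    (mfderiv 𝓘(ℂ, EY) 𝓘(ℂ, ℂ) (S.hamFun u) y).toLinearMap ∘ₗ
      (vertical 𝓘(ℂ, EY) 𝓘(ℂ, EB) (baseMap C i) y).subtype with hα
  have hp : ContMDiff 𝓘(ℂ, EY) 𝓘(ℂ, E) ω (proj ∘ i) := contMDiff_proj_TX.comp hR.hol
  have h1 : relSharp 𝓘(ℂ, EY) 𝓘(ℂ, EB) S.Ω y (t • α) = ⟨κ - κ₀, hv⟩ := by
    refine relSharp_eq (S.relSymplectic.alt y) (S.relSymplectic.nondeg y) fun b => ?_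
    have e1 : S.Ω y b ⟨κ - κ₀, hv⟩ = pencilForm EY J i 0 y b (κ - κ₀) := by rw [hΩ]; rfl
    have e2 : α b = dirDeriv 𝓘(ℂ, E) (fun m => C.beta m (u (C.rho m))) (proj (i y))
        (horY EY i y b) := by
      have f1 : S.hamFun u = (fun m => C.beta m (u (C.rho m))) ∘ (proj ∘ i) := by
        funext z
        rw [HamiltonianSystem.hamFun, hham]
        rfl
      have f2 := vDeriv_comp (F := fun m => C.beta m (u (C.rho m))) (g := proj ∘ i) (x := y)
        ((C.contMDiffAt_beta (m := proj (i y)) hu).mdifferentiableAt (by simp))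
        (hp.contMDiffAt.mdifferentiableAt (by simp)) b
      rw [← f1] at f2
      have f3 : mfderiv 𝓘(ℂ, EY) 𝓘(ℂ, E) (proj ∘ i) y b = horY EY i y b :=
        congrArg (fun T : EY →L[ℂ] E => T b.1) (mfderiv_comp y
          (contMDiff_proj_TX.contMDiffAt.mdifferentiableAt (by simp))
          (hR.hol.contMDiffAt.mdifferentiableAt (by simp)))
      rw [f3] at f2
      exact f2
    have e3 := C.symp_eq_neg_dirDeriv (m := proj (i y)) hu ((mem_vertical_baseMap hR).1 b.2)
      ((mfderiv_baseMap hR y κ).symm.trans hκ)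
    have e4 := hκΘ b
    have e5 := hκ₀Θ b
    rw [form_swap (pencilForm_alt t), pencilForm_apply hR] at e4
    rw [form_swap (pencilForm_alt 0)] at e5
    rw [e1, map_sub, pencilForm_apply hR, LinearMap.smul_apply, smul_eq_mul, e2]
    linear_combination -e4 + e5 - t * e3
  rw [map_smul] at h1
  exact congrArg Subtype.val h1

end Pencil

/-! ### Existence of the Hamiltonian system -/

section Existence

variable {EB B : Type*} [NormedAddCommGroup EB] [NormedSpace ℂ EB]
  [TopologicalSpace B] [ChartedSpace EB B] [IsManifold 𝓘(ℂ, EB) ω B]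
  {E M : Type*} [NormedAddCommGroup E] [NormedSpace ℂ E] [FiniteDimensional ℂ E]
  [TopologicalSpace M] [ChartedSpace E M] [IsManifold 𝓘(ℂ, E) ω M]
  {EY Y : Type*} [NormedAddCommGroup EY] [NormedSpace ℂ EY] [FiniteDimensional ℂ EY]
  [TopologicalSpace Y] [ChartedSpace EY Y] [IsManifold 𝓘(ℂ, EY) ω Y]
  {J : PreJoyceStructure E M} {C : CotangentStructure EB B J.symp} {i : Y → TX E M}
  {R : Set J.ZInf}

/-- The Hamiltonian system is determined by the pencil of closed forms `i^*(2iΩ_I) + ε⁻¹ p^*(ω)`: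
the connection `k_ε` spans its kernel, and the value `ε⁻¹ = 0` gives `Ω` and `k`. -/
theorem exists_isAssociated (hR : IsLagrangianPreimage EY J R i)
    (hstar : Transversality EY J C i) :
    ∃ S : HamiltonianSystem 𝓘(ℂ, EY) 𝓘(ℂ, EB) (baseMap C i),
      S.StronglyIntegrable ∧ IsAssociated J C i S := by
  obtain ⟨k, hk⟩ := exists_pencil hR hstar
  have hkf : ∀ t y u, mfderiv 𝓘(ℂ, EY) 𝓘(ℂ, EB) (baseMap C i) y (k t y u) = u :=
    fun t y u => (hk t y u).1
  have hkΘ : ∀ t y u b, pencilForm EY J i t y (k t y u) b = 0 := fun t y u b =>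
    pencilForm_eq_zero hR (hk t y u).2.1 (hk t y u).2.2 b
  have hf : IsHolSubmersion 𝓘(ℂ, EY) 𝓘(ℂ, EB) (baseMap C i) := isHolSubmersion_baseMap hR
  have hnd := pencilForm_nondeg hR hstar
  have hconn : ∀ t, IsConnection 𝓘(ℂ, EY) 𝓘(ℂ, EB) (baseMap C i) (k t) := fun t =>
    isConnection_of_ker hf (isHolForm_pencilForm hR t) (hnd t) (hkf t) (hkΘ t)
  have hflat : ∀ t, IsFlat 𝓘(ℂ, EY) 𝓘(ℂ, EB) (baseMap C i) (k t) := fun t =>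
    isFlat_of_ker (pencilForm_alt t) (isClosedForm_pencilForm hR t) (hnd t) (hkf t) (hkΘ t)
  let S : HamiltonianSystem 𝓘(ℂ, EY) 𝓘(ℂ, EB) (baseMap C i) :=
    { Ω := relForm 𝓘(ℂ, EB) (baseMap C i) (pencilForm EY J i 0)
      k := k 0
      ham := fun y => C.beta (proj (i y))
      submersion := hf
      relSymplectic := isRelSymplectic_relForm hf.hol (isHolForm_pencilForm hR 0)
        (pencilForm_alt 0) (isClosedForm_pencilForm hR 0) (hnd 0)
      connection := hconn 0
      flat := hflat 0
      symplectic := preservesRelForm_of_ker hf.hol (hconn 0) (pencilForm_alt 0)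
        (isClosedForm_pencilForm hR 0) (hkΘ 0)
      ham_hol := fun U u hU hu y hy => by
        have h1 := C.contMDiffAt_beta (m := proj (i y)) (hu.holVFAt hU hy)
        exact (h1.comp y ((contMDiff_proj_TX.comp hR.hol) y)).contMDiffWithinAt }
  have hpencil : ∀ ε : ℂ, S.IsPencil ε (k ε⁻¹) := fun ε =>
    { connection := hconn ε⁻¹
      eq := fun U u hU hu y hy => by
        have h1 := smul_hamFlow_eq (S := S) hR rfl rfl (hu.holVFAt hU hy)
          (hkf ε⁻¹ y _) (hkf 0 y _) (hkΘ ε⁻¹ y _) (hkΘ 0 y _)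
        rw [h1]
        exact (add_sub_cancel _ _).symm }
  refine ⟨S, fun ε _ => ⟨k ε⁻¹, hpencil ε, hflat ε⁻¹⟩, ?_, ?_, fun y => rfl⟩
  · intro y a b
    have h1 : S.Ω y a b = J.twoIOmegaI (i y) (inclDeriv EY i y a.1) (inclDeriv EY i y b.1) +
      (0 : ℂ) • _ := rfl
    rw [h1, zero_smul, add_zero]
    exact J.twoIOmegaI_eq _ _ _
  · intro ε hε
    refine ⟨k ε⁻¹, hpencil ε, fun y => le_antisymm ?_ ?_⟩
    · rintro _ ⟨_, ⟨u, rfl⟩, rfl⟩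
      exact ⟨⟨_, rfl⟩, mem_distr_inclDeriv.2 (hk ε⁻¹ y u).2.2⟩
    · rintro _ ⟨⟨η, rfl⟩, hη⟩
      replace hη := mem_distr_inclDeriv.1 hη
      refine ⟨η, ?_, rfl⟩
      refine (mem_horizontal_iff_of_ker (hnd ε⁻¹) (hkf ε⁻¹) (hkΘ ε⁻¹) y η).2
        (pencilForm_eq_zero hR ?_ hη)
      have h1 := Submodule.smul_mem _ ε (hR.verY_mem y η)
      rwa [hη, smul_smul, mul_inv_cancel₀ hε, one_smul] at h1

end Existence
end JoyceHam

open JoyceHam in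
theorem mainTheorem2
    {E M EB B EY Y : Type*}
    [NormedAddCommGroup E] [NormedSpace ℂ E] [FiniteDimensional ℂ E]
    [TopologicalSpace M] [ChartedSpace E M] [IsManifold 𝓘(ℂ, E) ω M]
    [NormedAddCommGroup EB] [NormedSpace ℂ EB] [FiniteDimensional ℂ EB]
    [TopologicalSpace B] [ChartedSpace EB B] [IsManifold 𝓘(ℂ, EB) ω B]
    [NormedAddCommGroup EY] [NormedSpace ℂ EY] [FiniteDimensional ℂ EY]
    [TopologicalSpace Y] [ChartedSpace EY Y] [IsManifold 𝓘(ℂ, EY) ω Y]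
    (J : JoyceStructure E M)
    (C : CotangentStructure EB B J.symp)
    (R : Set J.toPreJoyceStructure.ZInf)
    (i : Y → TX E M)
    (hR : IsLagrangianPreimage EY J.toPreJoyceStructure R i)
    (hstar : Transversality EY J.toPreJoyceStructure C i) :
    ∃ S : HamiltonianSystem 𝓘(ℂ, EY) 𝓘(ℂ, EB) (baseMap C i),
      S.StronglyIntegrable ∧
      IsAssociated J.toPreJoyceStructure C i S ∧
      ∀ S' : HamiltonianSystem 𝓘(ℂ, EY) 𝓘(ℂ, EB) (baseMap C i),
        IsAssociated J.toPreJoyceStructure C i S' → S' = S := by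
  obtain ⟨S, hS, hSa⟩ := exists_isAssociated hR hstar
  exact ⟨S, hS, hSa, fun S' hS' => hS'.unique hR.immersive hSa⟩
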